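/- **Setting.** Let $B$ be a $\mathbb Z/2$-graded $C^*$-algebra and $E=E_B$ a $\mathbb Z/2$-graded Hilbert $C^*$-module over $B$, with grading operator $\gamma$ (so $\gamma^2=1$, $\gamma(eb)=\gamma(e)\gamma_B(b)$, $\langle\gamma e,\gamma f\rangle=\gamma_B(\langle e,f\rangle)$). Write $\mathrm{End}^*_B(E)$ for the adjointable operators and $\gamma(T)=\gamma T\gamma$; $T$ is even if $\gamma(T)=T$. Let $\mathcal D:\mathrm{Dom}\,\mathcal D\subset E\to E$ be a self-adjoint regular operator. Commutators are graded: $[\mathcal D,a]=\mathcal Da-\gamma(a)\mathcal D$. Let $$\mathrm{Lip}(\mathcal D)=\{a\in \mathrm{End}^*_B(E): a\,\mathrm{Dom}\,\mathcal D\subset\mathrm{Dom}\,\mathcal D,\ [\mathcal D,a]\in\mathrm{End}_B^*(E)\},\qquad \pi_{\mathcal D}(a)=\begin{pmatrix}a&0\\ [\mathcal D,a]&\gamma(a)\end{pmatrix}\in\mathrm{End}_B^*(E\oplus E),$$ normed by $\|a\|_{\mathcal D}=\|\pi_{\mathcal D}(a)\|$. Let $\mathcal A\subset\mathrm{Lip}(\mathcal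 D)$ be a differentiable algebra, i.e. a subalgebra that is closed under $*$ and under $\gamma$, and that is separable and closed for $\|\cdot\|_{\mathcal D}$. Let $A$ be the closure of $\mathcal A$ in $\mathrm{End}_B^*(E)$ and assume that $AE$ spans a dense subspace of $E$. *Self-adjoint multipliers.* A self-adjoint unbounded multiplier of $\mathcal A$ is a linear map $c:\mathrm{Dom}\,c\to\mathcal A$ on a $\|\cdot\|_{\mathcal D}$-dense right ideal $\mathrm{Dom}\,c\subset\mathcal A$ with $c(ab)=(ca)b$ for $a\in \mathrm{Dom}\,c$, $b\in\mathcal A$, with closed graph, with $(ca)^*b=a^*(cb)$ for $a,b\in\mathrm{Dom}\,c$, and such that $c\pm i$ are bijections $\mathrm{Dom}\,c\to\mathcal A$ whose inverses lie in the multiplier algebra (the strict closure) of $\mathcal A$. It is positive if $(ca)^*a\ge0$ in $A$ for all $a\in\mathrm{Dom}\,c$, and even if $\gamma(\mathrm{Dom}\,c)\subset \mathrm{Dom}\,c$ and $c\gamma(a)=\gamma(ca)$. An even self-adjoint multiplier $c$ is complete if: $(c\pm i)^{-1}\in\mathcal A$; $\mathrm{im}\,(\mathcal D\pm i)^{-1}(c\pm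 i)^{-1}=\mathrm{im}\,(c\pm i)^{-1}(\mathcal D\pm i)^{-1}\subset E$; and $\mathcal Dc-c\mathcal D$ is bounded on these subspaces, where $c$ also denotes the induced operator on $E$ with domain $\mathrm{im}\,(c\pm i)^{-1}$. *Strict positivity.* A self-adjoint $h\in\mathcal A$ is strictly positive if its spectrum is contained in $[0,\infty)$ and $h\mathcal A$ is $\|\cdot\|_{\mathcal D}$-dense in $\mathcal A$. **Theorem.** Suppose that $\mathcal D$ is odd, that is, $\gamma\,\mathrm{Dom}\,\mathcal D\subset\mathrm{Dom}\,\mathcal D$ and $\mathcal D\gamma=-\gamma\mathcal D$. Then the following are equivalent: 1. there is a sequence $(u_n)\subset\mathcal A$ of pairwise commuting elements with $u_n\le u_{n+1}$, $\sup_n\|u_n\|_{\mathcal D}<\infty$, $\|u_na-a\|_{\mathcal D}\to0$ and $\|au_n-a\|_{\mathcal D}\to0$ for all $a\in\mathcal A$, and $\|[\mathcal D,u_n]\|\to0$; 2. there is a positive (even) self-adjoint complete multiplier $c$ of $\mathcal A$; 3. there are an (even) strictly positive $h\in\mathcal A$ with $\mathrm{im}\,(\mathcal D\pm i)^{-1}h=\mathrm{im}\,h(\mathcal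 D\pm i)^{-1}$ and a constant $C>0$ with $i[\mathcal D,h]\le Ch^2$. If instead the grading of $E$ is trivial and $\mathcal D$ is an arbitrary self-adjoint regular operator, then (1), (2) and (3) are equivalent when the inequality in (3) is read two-sidedly, $-Ch^2\le i[\mathcal D,h]\le Ch^2$. -/

import Mathlib

open Filter Topology
open scoped WithCStarModule

noncomputable section

namespace DiffAlg

/-! ### Adjointable operators on a Hilbert C*-module -/

section Adjointable

variable (B : Type*) {E : Type*} [NonUnitalCStarAlgebra B] [PartialOrder B] [StarOrderedRing B]
  [NormedAddCommGroup E] [NormedSpace ℂ E] [SMul B E] [CStarModule B E]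

/-- `S` is an adjoint of `T` for the `B`-valued inner product. -/
def IsAdjointPair (T S : E →L[ℂ] E) : Prop :=
  ∀ x y : E, inner B (T x) y = inner B x (S y)

/-- Membership in `End*_B(E)`. -/
def IsAdjointable (T : E →L[ℂ] E) : Prop := ∃ S : E →L[ℂ] E, IsAdjointPair B T S

open Classical in
/-- The (unique) adjoint of an adjointable operator. -/
def adj (T : E →L[ℂ] E) : E →L[ℂ] E :=
  if h : IsAdjointable B T then h.choose else 0

/-- Positivity in the C*-algebra `End*_B(E)`. -/
def IsPos (T : E →L[ℂ] E) : Prop :=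
  IsAdjointable B T ∧ ∀ x : E, 0 ≤ inner B x (T x)

end Adjointable

/-! ### Gradings -/

/-- A `ℤ/2`-grading of the Hilbert module `E` over the `ℤ/2`-graded C*-algebra `B`. -/
structure ModuleGrading (B E : Type*) [NonUnitalCStarAlgebra B] [PartialOrder B]
    [StarOrderedRing B] [NormedAddCommGroup E] [NormedSpace ℂ E] [SMul B E]
    [CStarModule B E] where
  /-- the grading automorphism of `B` -/
  onB : B ≃⋆ₐ[ℂ] B
  /-- the grading operator of `E` (in general not `B`-linear) -/
  onE : E →L[ℂ] E
  onB_onB : ∀ b, onB (onB b) = b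
  onE_onE : ∀ x, onE (onE x) = x
  onE_smul : ∀ (b : B) (x : E), onE (b • x) = onB b • onE x
  inner_onE : ∀ x y : E, inner B (onE x) (onE y) = onB (inner B x y)

section Main

variable {B E : Type*} [NonUnitalCStarAlgebra B] [PartialOrder B] [StarOrderedRing B]
  [NormedAddCommGroup E] [NormedSpace ℂ E] [SMul B E] [CStarModule B E]

/-- The induced grading `T ↦ γ T γ` on operators. -/
def ModuleGrading.gr (γ : ModuleGrading B E) (T : E →L[ℂ] E) : E →L[ℂ] E :=
  γ.onE ∘L T ∘L γ.onE

/-- The operator `T` has degree zero. -/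
def ModuleGrading.IsEven (γ : ModuleGrading B E) (T : E →L[ℂ] E) : Prop := γ.gr T = T

/-- The grading of `E` is trivial. -/
def ModuleGrading.IsTrivial (γ : ModuleGrading B E) : Prop := ∀ x, γ.onE x = x

/-- The unbounded operator `D` is odd. -/
def ModuleGrading.IsOdd (γ : ModuleGrading B E) (D : E →ₗ.[ℂ] E) : Prop :=
  ∀ x v, (x, v) ∈ D.graph → (γ.onE x, -γ.onE v) ∈ D.graph

/-! ### Self-adjoint regular operators -/

variable (B) in
/-- The pair `(y, z)` belongs to the graph of the adjoint `D*`. -/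
def InAdjointGraph (D : E →ₗ.[ℂ] E) (y z : E) : Prop :=
  ∀ x v, (x, v) ∈ D.graph → inner B v y = inner B x z

variable (B) in
/-- `D` is densely defined and `D = D*`. -/
def IsSelfAdjointOp (D : E →ₗ.[ℂ] E) : Prop :=
  Dense (D.domain : Set E) ∧ ∀ y z, (y, z) ∈ D.graph ↔ InAdjointGraph B D y z

variable (B) in
/-- `D` is regular: closed, densely defined with densely defined adjoint, and `1 + D*D` has dense
range. -/
def IsRegularOp (D : E →ₗ.[ℂ] E) : Prop :=
  D.IsClosed ∧ Dense (D.domain : Set E) ∧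
    Dense {y : E | ∃ z, InAdjointGraph B D y z} ∧
    Dense {w : E | ∃ x v u, (x, v) ∈ D.graph ∧ InAdjointGraph B D v u ∧ w = x + u}

/-! ### The Lipschitz algebra and its standard representation -/

/-- `a` preserves `Dom D` and the graded commutator `D a - γ(a) D` agrees with `K` on `Dom D`. -/
def IsComm (γ : ModuleGrading B E) (D : E →ₗ.[ℂ] E) (a K : E →L[ℂ] E) : Prop :=
  ∀ x v, (x, v) ∈ D.graph → (a x, γ.gr a v + K x) ∈ D.graph

/-- The Lipschitz algebra `Lip(D)` of a self-adjoint operator `D`. -/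
def Lip (γ : ModuleGrading B E) (D : E →ₗ.[ℂ] E) : Set (E →L[ℂ] E) :=
  {a | IsAdjointable B a ∧ ∃ K, IsAdjointable B K ∧ IsComm γ D a K}

open Classical in
/-- The graded commutator `[D, a] ∈ End*_B(E)` of `a ∈ Lip(D)`, unique since `Dom D` is dense. -/
def comm (γ : ModuleGrading B E) (D : E →ₗ.[ℂ] E) (a : E →L[ℂ] E) : E →L[ℂ] E :=
  if h : ∃ K, IsAdjointable B K ∧ IsComm γ D a K then h.choose else 0

/-- The operator matrix `((a, 0), ([D, a], γ(a)))` on the Hilbert module `E ⊕ E`. -/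
def piD (γ : ModuleGrading B E) (D : E →ₗ.[ℂ] E) (a : E →L[ℂ] E) :
    C⋆ᵐᵒᵈ(B, E × E) →L[ℂ] C⋆ᵐᵒᵈ(B, E × E) :=
  (WithCStarModule.equivL ℂ : C⋆ᵐᵒᵈ(B, E × E) ≃L[ℂ] E × E).symm.toContinuousLinearMap ∘L
    ((a ∘L ContinuousLinearMap.fst ℂ E E).prod
      (comm γ D a ∘L ContinuousLinearMap.fst ℂ E E + γ.gr a ∘L ContinuousLinearMap.snd ℂ E E)) ∘L
    (WithCStarModule.equivL ℂ : C⋆ᵐᵒᵈ(B, E × E) ≃L[ℂ] E × E).toContinuousLinearMap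

/-- The norm of `Lip(D)`. -/
def lipNorm (γ : ModuleGrading B E) (D : E →ₗ.[ℂ] E) (a : E →L[ℂ] E) : ℝ := ‖piD γ D a‖

/-- A differentiable algebra: a separable graded `*`-subalgebra of `Lip(D)` which is closed in the
representation `piD`. -/
structure IsDifferentiableAlgebra (γ : ModuleGrading B E) (D : E →ₗ.[ℂ] E)
    (𝒜 : NonUnitalSubalgebra ℂ (E →L[ℂ] E)) : Prop where
  mem_lip : ∀ a ∈ 𝒜, a ∈ Lip γ D
  adj_mem : ∀ a ∈ 𝒜, adj B a ∈ 𝒜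
  gr_mem : ∀ a ∈ 𝒜, γ.gr a ∈ 𝒜
  isClosed : IsClosed (piD γ D '' (𝒜 : Set (E →L[ℂ] E)))
  isSeparable : TopologicalSpace.IsSeparable (piD γ D '' (𝒜 : Set (E →L[ℂ] E)))

/-- `[A E] = E`, where `A` is the closure of `𝒜` in the operator norm. -/
def IsEssential (𝒜 : NonUnitalSubalgebra ℂ (E →L[ℂ] E)) : Prop :=
  (Submodule.span ℂ
    {x : E | ∃ a ∈ closure (𝒜 : Set (E →L[ℂ] E)), ∃ e : E, x = a e}).topologicalClosure = ⊤

/-- `S` is dense in `𝒜` for the Lipschitz norm. -/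
def LipDense (γ : ModuleGrading B E) (D : E →ₗ.[ℂ] E)
    (𝒜 : NonUnitalSubalgebra ℂ (E →L[ℂ] E)) (S : Set (E →L[ℂ] E)) : Prop :=
  S ⊆ 𝒜 ∧ ∀ a ∈ 𝒜, ∀ ε > 0, ∃ b ∈ S, lipNorm γ D (a - b) < ε

/-! ### Approximate units -/

/-- A sequential bounded approximate unit of `𝒜` for the Lipschitz norm. -/
structure IsApproxUnit (γ : ModuleGrading B E) (D : E →ₗ.[ℂ] E)
    (𝒜 : NonUnitalSubalgebra ℂ (E →L[ℂ] E)) (u : ℕ → E →L[ℂ] E) : Prop where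
  mem : ∀ n, u n ∈ 𝒜
  bounded : ∃ M : ℝ, ∀ n, lipNorm γ D (u n) ≤ M
  left : ∀ a ∈ 𝒜, Tendsto (fun n => lipNorm γ D (u n * a - a)) atTop (𝓝 0)
  right : ∀ a ∈ 𝒜, Tendsto (fun n => lipNorm γ D (a * u n - a)) atTop (𝓝 0)

/-- There is an increasing commutative approximate unit `(u n)` in `𝒜` with `‖[D, u n]‖ → 0`. -/
def HasGoodApproxUnit (γ : ModuleGrading B E) (D : E →ₗ.[ℂ] E)
    (𝒜 : NonUnitalSubalgebra ℂ (E →L[ℂ] E)) : Prop :=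
  ∃ u : ℕ → E →L[ℂ] E, IsApproxUnit γ D 𝒜 u ∧
    (∀ n, IsPos B (u (n + 1) - u n)) ∧
    (∀ m n, u m * u n = u n * u m) ∧
    Tendsto (fun n => ‖comm γ D (u n)‖) atTop (𝓝 0)

/-! ### Unbounded multipliers -/

/-- The map `T : 𝒜 → 𝒜` belongs to the multiplier algebra of `𝒜`, i.e. to the strict closure of
`𝒜`: some net `b` in `𝒜` satisfies `b a → T a`, and `a b` converges in `𝒜`, for all `a ∈ 𝒜`. -/
def InMultiplierAlgebra (γ : ModuleGrading B E) (D : E →ₗ.[ℂ] E)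
    (𝒜 : NonUnitalSubalgebra ℂ (E →L[ℂ] E)) (T : (E →L[ℂ] E) → (E →L[ℂ] E)) : Prop :=
  ∃ l : Filter (E →L[ℂ] E), l.NeBot ∧ (∀ᶠ b in l, b ∈ 𝒜) ∧
    ∀ a ∈ 𝒜,
      (T a ∈ 𝒜 ∧ Tendsto (fun b => lipNorm γ D (b * a - T a)) l (𝓝 0)) ∧
      ∃ aT ∈ 𝒜, Tendsto (fun b => lipNorm γ D (a * b - aT)) l (𝓝 0)

/-- `c + s : Dom c → 𝒜` is bijective and `T` is its inverse. -/
def IsInverseAt (𝒜 : NonUnitalSubalgebra ℂ (E →L[ℂ] E))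
    (c : (E →L[ℂ] E) →ₗ.[ℂ] (E →L[ℂ] E)) (s : ℂ) (T : (E →L[ℂ] E) → (E →L[ℂ] E)) : Prop :=
  (∀ a ∈ 𝒜, (T a, a - s • T a) ∈ c.graph) ∧
    ∀ a b, (a, b) ∈ c.graph → T (b + s • a) = a

/-- `c` is a self-adjoint unbounded multiplier of `𝒜`. -/
structure IsSelfAdjointMultiplier (γ : ModuleGrading B E) (D : E →ₗ.[ℂ] E)
    (𝒜 : NonUnitalSubalgebra ℂ (E →L[ℂ] E))
    (c : (E →L[ℂ] E) →ₗ.[ℂ] (E →L[ℂ] E)) : Prop where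
  dense : LipDense γ D 𝒜 (c.domain : Set (E →L[ℂ] E))
  maps : ∀ a b, (a, b) ∈ c.graph → b ∈ 𝒜
  /-- `Dom c` is a right ideal and `c (a b) = (c a) b` -/
  mul : ∀ a ca, (a, ca) ∈ c.graph → ∀ b ∈ 𝒜, (a * b, ca * b) ∈ c.graph
  closed : ∀ (a ca : ℕ → E →L[ℂ] E) (a' b' : E →L[ℂ] E), a' ∈ 𝒜 → b' ∈ 𝒜 →
    (∀ n, (a n, ca n) ∈ c.graph) →
    Tendsto (fun n => lipNorm γ D (a n - a')) atTop (𝓝 0) →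
    Tendsto (fun n => lipNorm γ D (ca n - b')) atTop (𝓝 0) → (a', b') ∈ c.graph
  symmetric : ∀ a ca b cb, (a, ca) ∈ c.graph → (b, cb) ∈ c.graph →
    adj B ca * b = adj B a * cb
  resolvent : ∀ s : ℂ, s = Complex.I ∨ s = -Complex.I →
    ∃ T, IsInverseAt 𝒜 c s T ∧ InMultiplierAlgebra γ D 𝒜 T

variable (B) in
/-- `(c a)* a ≥ 0` for all `a ∈ Dom c`. -/
def IsPositiveMultiplier (c : (E →L[ℂ] E) →ₗ.[ℂ] (E →L[ℂ] E)) : Prop :=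
  ∀ a ca, (a, ca) ∈ c.graph → IsPos B (adj B ca * a)

/-- `c` has degree zero. -/
def IsEvenMultiplier (γ : ModuleGrading B E) (c : (E →L[ℂ] E) →ₗ.[ℂ] (E →L[ℂ] E)) : Prop :=
  ∀ a ca, (a, ca) ∈ c.graph → (γ.gr a, γ.gr ca) ∈ c.graph

/-- `x = (D + s)⁻¹ e`. -/
def IsResolvent (D : E →ₗ.[ℂ] E) (s : ℂ) (e x : E) : Prop :=
  ∃ v, (x, v) ∈ D.graph ∧ v + s • x = e

/-- The image of `(D + s)⁻¹ r`. -/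
def imResolventMul (D : E →ₗ.[ℂ] E) (s : ℂ) (r : E →L[ℂ] E) : Set E :=
  {x | ∃ e, IsResolvent D s (r e) x}

/-- The image of `r (D + s)⁻¹`. -/
def imMulResolvent (D : E →ₗ.[ℂ] E) (s : ℂ) (r : E →L[ℂ] E) : Set E :=
  {x | ∃ e y, IsResolvent D s e y ∧ x = r y}

/-- The graph of the operator on `E` affiliated to a multiplier `c` with `(c + s)⁻¹ = r`:
its domain is `im r` and `c (r e) = e - s r e`. -/
def affiliatedGraph (s : ℂ) (r : E →L[ℂ] E) : Set (E × E) :=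
  {p | ∃ e, p.1 = r e ∧ p.2 = e - s • r e}

/-- The conditions on a complete multiplier, for the sign `s = ± i`. For all `x` in
`im (D + s)⁻¹ (c + s)⁻¹` the vectors `D c x` and `c D x` are defined, and the norm of
`D c x - c D x` is at most a constant times the norm of `x`. -/
def IsCompleteAt (D : E →ₗ.[ℂ] E) (𝒜 : NonUnitalSubalgebra ℂ (E →L[ℂ] E))
    (c : (E →L[ℂ] E) →ₗ.[ℂ] (E →L[ℂ] E)) (s : ℂ) : Prop :=
  ∃ r ∈ 𝒜, IsInverseAt 𝒜 c s (fun a => r * a) ∧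
    imResolventMul D s r = imMulResolvent D s r ∧
    ∃ M : ℝ, ∀ x ∈ imResolventMul D s r, ∃ cx Dcx Dx cDx,
      (x, cx) ∈ affiliatedGraph s r ∧ (cx, Dcx) ∈ D.graph ∧
      (x, Dx) ∈ D.graph ∧ (Dx, cDx) ∈ affiliatedGraph s r ∧ ‖Dcx - cDx‖ ≤ M * ‖x‖

/-- There is a positive self-adjoint complete multiplier (of degree zero) for `𝒜`. -/
def HasCompleteMultiplier (γ : ModuleGrading B E) (D : E →ₗ.[ℂ] E)
    (𝒜 : NonUnitalSubalgebra ℂ (E →L[ℂ] E)) : Prop :=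
  ∃ c : (E →L[ℂ] E) →ₗ.[ℂ] (E →L[ℂ] E), IsSelfAdjointMultiplier γ D 𝒜 c ∧
    IsPositiveMultiplier B c ∧ IsEvenMultiplier γ c ∧
    ∀ s : ℂ, s = Complex.I ∨ s = -Complex.I → IsCompleteAt D 𝒜 c s

/-! ### Strictly positive elements -/

/-- `h ∈ 𝒜` is self-adjoint with positive spectrum (in `𝒜`), and `h 𝒜` is dense in `𝒜`. -/
def IsStrictlyPositive (γ : ModuleGrading B E) (D : E →ₗ.[ℂ] E)
    (𝒜 : NonUnitalSubalgebra ℂ (E →L[ℂ] E)) (h : 𝒜) : Prop :=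
  adj B (h : E →L[ℂ] E) = h ∧
    (∀ z ∈ quasispectrum ℂ h, 0 ≤ z.re ∧ z.im = 0) ∧
    LipDense γ D 𝒜 {b | ∃ a ∈ 𝒜, b = (h : E →L[ℂ] E) * a}

/-- There are a strictly positive `h ∈ 𝒜` (of degree zero) with
`im (D ± i)⁻¹ h = im h (D ± i)⁻¹` and a constant `C > 0` with `i [D, h] ≤ C h ^ 2`. -/
def HasGoodPositiveElement (γ : ModuleGrading B E) (D : E →ₗ.[ℂ] E)
    (𝒜 : NonUnitalSubalgebra ℂ (E →L[ℂ] E)) : Prop :=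
  ∃ h : 𝒜, IsStrictlyPositive γ D 𝒜 h ∧ γ.IsEven (h : E →L[ℂ] E) ∧
    (∀ s : ℂ, s = Complex.I ∨ s = -Complex.I →
      imResolventMul D s (h : E →L[ℂ] E) = imMulResolvent D s h) ∧
    ∃ C : ℝ, 0 < C ∧
      IsPos B ((C : ℂ) • (h * h : E →L[ℂ] E) - Complex.I • comm γ D h)

/-- The same with the two-sided bound `- C h ^ 2 ≤ i [D, h] ≤ C h ^ 2`. -/
def HasGoodPositiveElementTwoSided (γ : ModuleGrading B E) (D : E →ₗ.[ℂ] E)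
    (𝒜 : NonUnitalSubalgebra ℂ (E →L[ℂ] E)) : Prop :=
  ∃ h : 𝒜, IsStrictlyPositive γ D 𝒜 h ∧ γ.IsEven (h : E →L[ℂ] E) ∧
    (∀ s : ℂ, s = Complex.I ∨ s = -Complex.I →
      imResolventMul D s (h : E →L[ℂ] E) = imMulResolvent D s h) ∧
    ∃ C : ℝ, 0 < C ∧
      IsPos B ((C : ℂ) • (h * h : E →L[ℂ] E) - Complex.I • comm γ D h) ∧
      IsPos B ((C : ℂ) • (h * h : E →L[ℂ] E) + Complex.I • comm γ D h)

end Main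

end DiffAlg

end

set_option linter.unusedSectionVars false

noncomputable section

namespace DiffAlg

/-! ### The C*-algebra of adjointable operators -/

section AdjointableAlgebra

variable {B E : Type*} [NonUnitalCStarAlgebra B] [PartialOrder B] [StarOrderedRing B]
  [NormedAddCommGroup E] [NormedSpace ℂ E] [SMul B E] [CStarModule B E]

/-! The implications proved are (1) ⇒ (3) ⇒ (2) ⇒ (1), where (3) is used in its two-sided form. If
`D` is odd, applying the grading to `i[D, h] ≤ C h²` with `h` even reverses the sign of the
commutator, so one inequality gives both (`HasGoodPositiveElement.twoSided`).

Spectral invariance supplies the elements of `𝒜` that are needed. The matrix `piD a` is lower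
triangular with diagonal `a, γ(a)`, hence invertible as soon as `a` is. For self-adjoint `x ∈ 𝒜` the
spectrum of `piD x` is therefore real, its complement is connected, and inverses stay in the closed
algebra generated by `piD 𝒜`. So an inverse of `1 + z x` taken in `End*_B(E)` lies in `1 + 𝒜`
(`exists_inverse_of_isUnit`).

(1) ⇒ (3): average the approximate unit over the grading, choose a fast subsequence `V k` with `∑
‖[D, V k]‖ ≤ 1/2`, and put `h = (1 + ∑ (1 - V k))⁻¹`. The series need not converge in norm, but the
inverses of its partial sums do (`exists_tendsto_inverse`), because `(1 - V k) V j` is tiny for `j <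
k`. With `K = -∑ [D, V k]`, which is skew-adjoint of norm at most `1/2`, one gets `[D, h] = -h K h`.
This yields `± i[D, h] ≤ h²` and also the equality of the two images
(`imResolventMul_eq_imMulResolvent`).

(3) ⇒ (2): take `c = h⁻¹`. Formally `[D, c] = -h⁻¹ [D, h] h⁻¹`, and the bounds `± i[D, h] ≤ C h²`
say that its form is bounded; polarization turns this into a norm bound
(`norm_inner_le_of_form_bounds`, `norm_le_of_norm_inner_le`).

(2) ⇒ (1): take `u = n (n + c)⁻¹`, `n ≥ 1`. Then `[D, u] = -n (n + c)⁻¹ [D, c] (n + c)⁻¹` has norm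
`O(1/n)`. The resolvents at `-n` are built inside `1 + 𝒜` from `p = (1 + c²)⁻¹` and `q = c (1 +
c²)⁻¹` (`exists_boundedTransform`, `boundedTransform_approximateUnit`). -/

lemma eq_of_forall_inner_eq {y z : E} (h : ∀ x : E, inner B x y = inner B x z) : y = z := by
  rw [← sub_eq_zero, ← CStarModule.inner_self (A := B), CStarModule.inner_sub_right, h, sub_self]

lemma eq_of_dense_forall_inner_eq {s : Set E} (hs : Dense s) {y z : E}
    (h : ∀ x ∈ s, inner B x y = inner B x z) : y = z := by
  refine eq_of_forall_inner_eq (B := B) fun x => ?_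
  have hy : Continuous fun x : E => inner B x y :=
    CStarModule.continuous_inner.comp (by fun_prop : Continuous fun x : E => (x, y))
  have hz : Continuous fun x : E => inner B x z :=
    CStarModule.continuous_inner.comp (by fun_prop : Continuous fun x : E => (x, z))
  exact congrFun (Continuous.ext_on hs hy hz h) x

lemma IsAdjointPair.unique {T S S' : E →L[ℂ] E} (h : IsAdjointPair B T S)
    (h' : IsAdjointPair B T S') : S = S' :=
  ContinuousLinearMap.ext fun y => eq_of_forall_inner_eq (B := B) fun x => by rw [← h, ← h']

lemma IsAdjointPair.isAdjointable {T S : E →L[ℂ] E} (h : IsAdjointPair B T S) :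
    IsAdjointable B T := ⟨S, h⟩

lemma IsAdjointable.pair {T : E →L[ℂ] E} (h : IsAdjointable B T) :
    IsAdjointPair B T (adj B T) := by
  rw [adj, dif_pos h]; exact h.choose_spec

lemma IsAdjointPair.adj_eq {T S : E →L[ℂ] E} (h : IsAdjointPair B T S) : adj B T = S :=
  h.isAdjointable.pair.unique h

lemma IsAdjointPair.symm {T S : E →L[ℂ] E} (h : IsAdjointPair B T S) : IsAdjointPair B S T :=
  fun x y => by rw [← CStarModule.star_inner y, ← h, CStarModule.star_inner]

lemma IsAdjointPair.add {T S T' S' : E →L[ℂ] E} (h : IsAdjointPair B T S)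
    (h' : IsAdjointPair B T' S') : IsAdjointPair B (T + T') (S + S') :=
  fun x y => by simp [h x y, h' x y]

lemma IsAdjointPair.mul {T S T' S' : E →L[ℂ] E} (h : IsAdjointPair B T S)
    (h' : IsAdjointPair B T' S') : IsAdjointPair B (T * T') (S' * S) :=
  fun x y => by simp [h _ y, h' x _]

lemma IsAdjointPair.smul {T S : E →L[ℂ] E} (h : IsAdjointPair B T S) (z : ℂ) :
    IsAdjointPair B (z • T) (star z • S) :=
  fun x y => by simp [h x y]

lemma IsAdjointPair.neg {T S : E →L[ℂ] E} (h : IsAdjointPair B T S) :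
    IsAdjointPair B (-T) (-S) :=
  fun x y => by simp [h x y]

variable (B) in
lemma IsAdjointPair.one : IsAdjointPair B (1 : E →L[ℂ] E) 1 := fun _ _ => rfl

lemma norm_sq_le_of_isAdjointPair {T S : E →L[ℂ] E} (h : IsAdjointPair B T S) :
    ‖T‖ * ‖T‖ ≤ ‖S * T‖ := by
  have key : ‖T‖ ≤ √‖S * T‖ := by
    refine T.opNorm_le_bound (Real.sqrt_nonneg _) fun x => ?_
    refine le_of_sq_le_sq ?_ (by positivity)
    rw [mul_pow, Real.sq_sqrt (norm_nonneg _), CStarModule.norm_sq_eq B, h]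
    calc _ ≤ ‖x‖ * ‖(S * T) x‖ := CStarModule.norm_inner_le E
      _ ≤ ‖x‖ * (‖S * T‖ * ‖x‖) := by gcongr; exact (S * T).le_opNorm x
      _ = _ := by ring
  calc ‖T‖ * ‖T‖ ≤ √‖S * T‖ * √‖S * T‖ := by gcongr
    _ = _ := Real.mul_self_sqrt (norm_nonneg _)

lemma norm_le_of_isAdjointPair {T S : E →L[ℂ] E} (h : IsAdjointPair B T S) : ‖T‖ ≤ ‖S‖ := by
  have h1 := (norm_sq_le_of_isAdjointPair h).trans (norm_mul_le _ _)
  rcases (norm_nonneg T).eq_or_lt with h0 | h0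
  · rw [← h0]; exact norm_nonneg _
  · exact le_of_mul_le_mul_right h1 h0

variable (B E) in
/-- The algebra `End*_B(E)`. -/
def adjointableSubalgebra : Subalgebra ℂ (E →L[ℂ] E) where
  carrier := {T | IsAdjointable B T}
  mul_mem' := fun ⟨_, h⟩ ⟨_, h'⟩ => (h.mul h').isAdjointable
  add_mem' := fun ⟨_, h⟩ ⟨_, h'⟩ => (h.add h').isAdjointable
  algebraMap_mem' z := by
    rw [Algebra.algebraMap_eq_smul_one]
    exact ((IsAdjointPair.one B).smul z).isAdjointable

variable (B E) in
/-- The C*-algebra `End*_B(E)`. -/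
abbrev EndStar := ↥(adjointableSubalgebra B E)

instance : Star (EndStar B E) where
  star T := ⟨adj B T, T.2.pair.symm.isAdjointable⟩

lemma EndStar.pair (T : EndStar B E) :
    IsAdjointPair B (T : E →L[ℂ] E) ((star T : EndStar B E) : E →L[ℂ] E) := T.2.pair

instance : StarRing (EndStar B E) where
  star_involutive T := Subtype.ext T.pair.symm.adj_eq
  star_mul T S := Subtype.ext (T.pair.mul S.pair).adj_eq
  star_add T S := Subtype.ext (T.pair.add S.pair).adj_eq

instance : StarModule ℂ (EndStar B E) where
  star_smul z T := Subtype.ext (T.pair.smul z).adj_eq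

instance : CStarRing (EndStar B E) where
  norm_mul_self_le T := norm_sq_le_of_isAdjointPair T.pair

variable [CompleteSpace E]

/-- Taking adjoints is isometric, so the adjoints of a convergent sequence are Cauchy, and their
limit is an adjoint of the limit. -/
lemma isClosed_adjointableSubalgebra : IsClosed (adjointableSubalgebra B E : Set (E →L[ℂ] E)) := by
  refine isClosed_of_closure_subset fun T hT => ?_
  obtain ⟨t, ht, hlim⟩ := mem_closure_iff_seq_limit.1 hT
  have hc : CauchySeq fun n => adj B (t n) := by
    have h0 := hlim.cauchySeq
    rw [Metric.cauchySeq_iff'] at h0 ⊢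
    intro ε hε
    obtain ⟨N, hN⟩ := h0 ε hε
    refine ⟨N, fun n hn => lt_of_le_of_lt ?_ (hN n hn)⟩
    rw [dist_eq_norm, dist_eq_norm]
    have := ((ht n).pair.add (ht N).pair.neg).symm
    simpa [sub_eq_add_neg] using norm_le_of_isAdjointPair this
  obtain ⟨S, hS⟩ := cauchySeq_tendsto_of_complete hc
  refine ⟨S, fun x y => ?_⟩
  have h1 : Tendsto (fun n => inner B (t n x) y) atTop (𝓝 (inner B (T x) y)) :=
    (CStarModule.continuous_inner (A := B) (E := E)).tendsto (T x, y) |>.comp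
      (((ContinuousLinearMap.apply ℂ E x).continuous.tendsto T |>.comp hlim).prodMk_nhds
        tendsto_const_nhds)
  have h2 : Tendsto (fun n => inner B x (adj B (t n) y)) atTop (𝓝 (inner B x (S y))) :=
    (CStarModule.continuous_inner (A := B) (E := E)).tendsto (x, S y) |>.comp
      (tendsto_const_nhds.prodMk_nhds
        ((ContinuousLinearMap.apply ℂ E y).continuous.tendsto S |>.comp hS))
  exact tendsto_nhds_unique h1 (h2.congr fun n => ((ht n).pair x y).symm)

instance : CompleteSpace (EndStar B E) := isClosed_adjointableSubalgebra.completeSpace_coe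

instance : CStarAlgebra (EndStar B E) where

instance : PartialOrder (EndStar B E) := CStarAlgebra.spectralOrder _

instance : StarOrderedRing (EndStar B E) := CStarAlgebra.spectralOrderedRing _

lemma inner_nonneg_of_nonneg {T : EndStar B E} (hT : 0 ≤ T) (x : E) :
    0 ≤ inner B x ((T : E →L[ℂ] E) x) := by
  obtain ⟨S, rfl⟩ := CStarAlgebra.nonneg_iff_eq_star_mul_self.1 hT
  have : inner B x (((star S * S : EndStar B E) : E →L[ℂ] E) x)
      = inner B ((S : E →L[ℂ] E) x) ((S : E →L[ℂ] E) x) := (S.pair _ _).symm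
  rw [this]
  exact CStarModule.inner_self_nonneg

/-- Polarization with `x + y` and `x + i y`. -/
lemma eq_zero_of_forall_inner_apply_self {t : E →L[ℂ] E} (h : ∀ x, inner B x (t x) = 0) :
    t = 0 := by
  ext y
  refine eq_of_forall_inner_eq (B := B) fun x => ?_
  have h1 := h (x + y)
  have h2 := h (x + Complex.I • y)
  simp only [map_add, map_smul, CStarModule.inner_add_right, CStarModule.inner_add_left,
    CStarModule.inner_smul_right_complex, CStarModule.inner_smul_left_complex,
    h x, h y, zero_add, add_zero, smul_zero] at h1 h2
  have h3 : inner B y (t x) = - inner B x (t y) := eq_neg_of_add_eq_zero_left h1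
  rw [h3, RCLike.star_def, Complex.conj_I, neg_smul, smul_neg, neg_neg, ← two_smul ℂ, smul_smul,
    smul_eq_zero] at h2
  simpa using h2

lemma isSelfAdjoint_of_isPos {T : EndStar B E} (hT : IsPos B (T : E →L[ℂ] E)) :
    IsSelfAdjoint T := by
  have h : ((star T - T : EndStar B E) : E →L[ℂ] E) = 0 := by
    refine eq_zero_of_forall_inner_apply_self (B := B) fun x => ?_
    have h1 : inner B x (((star T : EndStar B E) : E →L[ℂ] E) x) = inner B x ((T : E →L[ℂ] E) x) := by
      rw [← T.pair x x, ← CStarModule.star_inner x, (IsSelfAdjoint.of_nonneg (hT.2 x)).star_eq]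
    simp only [AddSubgroupClass.coe_sub, sub_apply,
      CStarModule.inner_sub_right, h1, sub_self]
  exact sub_eq_zero.1 (Subtype.ext h)

/-- This identifies positivity of forms with the order of the C*-algebra `EndStar B E`, so that
functional calculus applies. If the form of `T` is positive and `N` is the negative part, then `N T
N = -N³` has both a positive and a negative form, so `N³ = 0` and `N = 0`. -/
lemma nonneg_iff_isPos {T : EndStar B E} : 0 ≤ T ↔ IsPos B (T : E →L[ℂ] E) := by
  refine ⟨fun h => ⟨T.2, inner_nonneg_of_nonneg h⟩, fun h => ?_⟩
  have hsa := isSelfAdjoint_of_isPos h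
  rw [← CFC.negPart_eq_zero_iff T hsa]
  set N : EndStar B E := T⁻ with hN
  have hN0 : 0 ≤ N := CFC.negPart_nonneg T
  have hNsa : star N = N := (IsSelfAdjoint.of_nonneg hN0).star_eq
  have h1 : N * T * N = - (N * N * N) := by
    nth_rw 1 [← CFC.posPart_sub_negPart T hsa]
    rw [mul_sub, CFC.negPart_mul_posPart, ← hN, zero_sub, neg_mul]
  have h2 : 0 ≤ N * N * N := conjugate_nonneg_of_nonneg hN0 hN0
  have h3 : N * N * N = 0 := by
    refine Subtype.ext (eq_zero_of_forall_inner_apply_self (B := B) fun x =>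
      le_antisymm ?_ (inner_nonneg_of_nonneg h2 x))
    have h4 : inner B x (((N * T * N : EndStar B E) : E →L[ℂ] E) x)
        = inner B ((N : E →L[ℂ] E) x) ((T : E →L[ℂ] E) ((N : E →L[ℂ] E) x)) := by
      rw [N.pair, hNsa]; rfl
    have h5 := h.2 ((N : E →L[ℂ] E) x)
    rw [← h4, h1] at h5
    simpa using h5
  have h4 : star (N * N) * (N * N) = 0 := by
    rw [star_mul, hNsa, ← mul_assoc, h3, zero_mul]
  have h5 : star N * N = 0 := by
    rw [hNsa]; exact CStarRing.star_mul_self_eq_zero_iff _ |>.1 h4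
  exact CStarRing.star_mul_self_eq_zero_iff _ |>.1 h5

end AdjointableAlgebra

end DiffAlg

end

noncomputable section

namespace DiffAlg

variable {B E : Type*} [NonUnitalCStarAlgebra B] [PartialOrder B] [StarOrderedRing B]
  [NormedAddCommGroup E] [NormedSpace ℂ E] [SMul B E] [CStarModule B E]

/-! ### The grading of operators -/

namespace ModuleGrading

variable (γ : ModuleGrading B E)

@[simp] lemma gr_apply (T : E →L[ℂ] E) (x : E) : γ.gr T x = γ.onE (T (γ.onE x)) := rfl

/-- The grading of operators as an algebra homomorphism. -/
def grHom : (E →L[ℂ] E) →ₐ[ℂ] (E →L[ℂ] E) where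
  toFun := γ.gr
  map_one' := by ext x; simp [γ.onE_onE]
  map_mul' S T := by ext x; simp [γ.onE_onE]
  map_zero' := by ext x; simp
  map_add' S T := by ext x; simp
  commutes' z := by ext x; simp [Algebra.algebraMap_eq_smul_one, γ.onE_onE]

lemma gr_add (S T : E →L[ℂ] E) : γ.gr (S + T) = γ.gr S + γ.gr T := map_add γ.grHom S T
lemma gr_sub (S T : E →L[ℂ] E) : γ.gr (S - T) = γ.gr S - γ.gr T := map_sub γ.grHom S T
lemma gr_mul (S T : E →L[ℂ] E) : γ.gr (S * T) = γ.gr S * γ.gr T := map_mul γ.grHom S T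
lemma gr_smul (z : ℂ) (T : E →L[ℂ] E) : γ.gr (z • T) = z • γ.gr T := map_smul γ.grHom z T
lemma gr_one : γ.gr (1 : E →L[ℂ] E) = 1 := map_one γ.grHom
lemma gr_gr (T : E →L[ℂ] E) : γ.gr (γ.gr T) = T := by ext x; simp [γ.onE_onE]

lemma norm_onE (x : E) : ‖γ.onE x‖ = ‖x‖ := by
  rw [← sq_eq_sq₀ (norm_nonneg _) (norm_nonneg _), CStarModule.norm_sq_eq B,
    CStarModule.norm_sq_eq B, γ.inner_onE, StarAlgEquiv.norm_map]

lemma norm_gr_le (T : E →L[ℂ] E) : ‖γ.gr T‖ ≤ ‖T‖ := by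
  refine (γ.gr T).opNorm_le_bound (norm_nonneg _) fun x => ?_
  rw [gr_apply, norm_onE]
  exact (T.le_opNorm _).trans_eq (by rw [norm_onE])

lemma norm_gr (T : E →L[ℂ] E) : ‖γ.gr T‖ = ‖T‖ :=
  le_antisymm (γ.norm_gr_le T) (by simpa [gr_gr] using γ.norm_gr_le (γ.gr T))

lemma continuous_gr : Continuous γ.gr :=
  (AddMonoidHomClass.isometry_of_norm γ.grHom γ.norm_gr).continuous

lemma onB_nonneg {b : B} (hb : 0 ≤ b) : 0 ≤ γ.onB b := by
  obtain ⟨c, rfl⟩ := CStarAlgebra.nonneg_iff_eq_star_mul_self.1 hb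
  rw [map_mul, map_star]
  exact star_mul_self_nonneg _

lemma _root_.DiffAlg.IsAdjointPair.gr {T S : E →L[ℂ] E} (h : IsAdjointPair B T S) :
    IsAdjointPair B (γ.gr T) (γ.gr S) := fun x y => by
  rw [gr_apply, gr_apply]
  nth_rw 1 [← γ.onE_onE y]
  nth_rw 2 [← γ.onE_onE x]
  rw [γ.inner_onE, γ.inner_onE, h]

lemma _root_.DiffAlg.IsPos.gr {T : E →L[ℂ] E} (h : IsPos B T) : IsPos B (γ.gr T) := by
  obtain ⟨⟨S, hS⟩, h⟩ := h
  refine ⟨(hS.gr γ).isAdjointable, fun x => ?_⟩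
  have := γ.onB_nonneg (h (γ.onE x))
  rwa [← γ.inner_onE, γ.onE_onE] at this

lemma IsTrivial.gr_eq {γ : ModuleGrading B E} (h : γ.IsTrivial) (T : E →L[ℂ] E) : γ.gr T = T := by
  ext x; simp [h x, h (T x)]

end ModuleGrading

/-! ### Self-adjoint operators -/

section SelfAdjoint

variable {γ : ModuleGrading B E} {D : E →ₗ.[ℂ] E}

lemma graph_unique {x v w : E} (h : (x, v) ∈ D.graph) (h' : (x, w) ∈ D.graph) : v = w :=
  D.mem_graph_snd_inj h h' rfl

lemma exists_mem_graph {x : E} (h : x ∈ D.domain) : ∃ v, (x, v) ∈ D.graph :=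
  ⟨D ⟨x, h⟩, D.mem_graph ⟨x, h⟩⟩

lemma graph_add {x v y w : E} (h : (x, v) ∈ D.graph) (h' : (y, w) ∈ D.graph) :
    (x + y, v + w) ∈ D.graph := D.graph.add_mem h h'

lemma graph_sub {x v y w : E} (h : (x, v) ∈ D.graph) (h' : (y, w) ∈ D.graph) :
    (x - y, v - w) ∈ D.graph := D.graph.sub_mem h h'

lemma graph_smul {x v : E} (z : ℂ) (h : (x, v) ∈ D.graph) : (z • x, z • v) ∈ D.graph :=
  D.graph.smul_mem z h

lemma IsSelfAdjointOp.inner_eq (hsa : IsSelfAdjointOp B D) {x v y w : E} (h : (x, v) ∈ D.graph)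
    (h' : (y, w) ∈ D.graph) : inner B v y = inner B x w := (hsa.2 y w).1 h' x v h

lemma IsSelfAdjointOp.eq_of_forall_graph (hsa : IsSelfAdjointOp B D) {S T : E →L[ℂ] E}
    (h : ∀ x v, (x, v) ∈ D.graph → S x = T x) : S = T := by
  refine ContinuousLinearMap.ext fun x => congrFun (Continuous.ext_on hsa.1 S.continuous
    T.continuous fun y hy => ?_) x
  obtain ⟨v, hv⟩ := exists_mem_graph hy
  exact h y v hv

lemma IsSelfAdjointOp.norm_le_of_forall_graph (hsa : IsSelfAdjointOp B D) {T : E →L[ℂ] E} {M : ℝ}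
    (hM : 0 ≤ M) (h : ∀ x v, (x, v) ∈ D.graph → ‖T x‖ ≤ M * ‖x‖) : ‖T‖ ≤ M := by
  refine T.opNorm_le_bound hM fun x => ?_
  refine closure_minimal (s := (D.domain : Set E)) (t := {x | ‖T x‖ ≤ M * ‖x‖}) (fun y hy => ?_)
    (isClosed_le (by fun_prop) (by fun_prop)) (hsa.1 x)
  obtain ⟨v, hv⟩ := exists_mem_graph hy
  exact h y v hv

/-- For `s = ± i`, `‖D x + s x‖² ≥ ‖x‖²`. -/
lemma IsSelfAdjointOp.norm_le_norm_add (hsa : IsSelfAdjointOp B D) {s : ℂ}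
    (hs : s = Complex.I ∨ s = -Complex.I) {x v : E} (h : (x, v) ∈ D.graph) :
    ‖x‖ ≤ ‖v + s • x‖ := by
  -- The cross terms cancel, since `D` is symmetric and `s` is imaginary.
  have key : inner B (v + s • x) (v + s • x) = inner B v v + inner B x x := by
    have h1 : inner B v x = inner B x v := hsa.inner_eq h h
    rcases hs with rfl | rfl <;>
      simp only [CStarModule.inner_add_right, CStarModule.inner_add_left, neg_smul,
        CStarModule.inner_neg_right, CStarModule.inner_neg_left, h1, smul_neg, neg_neg,
        CStarModule.inner_smul_right_complex, CStarModule.inner_smul_left_complex, smul_smul,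
        RCLike.star_def, Complex.conj_I, smul_add, Complex.I_mul_I, one_smul] <;>
      abel
  rw [← sq_le_sq₀ (norm_nonneg _) (norm_nonneg _), CStarModule.norm_sq_eq B,
    CStarModule.norm_sq_eq B, key]
  exact CStarAlgebra.norm_le_norm_of_nonneg_of_le CStarModule.inner_self_nonneg
    (le_add_of_nonneg_left CStarModule.inner_self_nonneg)

/-- Regularity makes the range of `(D + s)(D - s) = D² + 1` dense; `D + s` is closed and bounded
below, so its range is closed. -/
lemma exists_resolvent [CompleteSpace E] (hsa : IsSelfAdjointOp B D) (hreg : IsRegularOp B D)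
    {s : ℂ} (hs : s = Complex.I ∨ s = -Complex.I) (e : E) :
    ∃ x v, (x, v) ∈ D.graph ∧ v + s • x = e := by
  have hdense : Dense {e : E | ∃ x v, (x, v) ∈ D.graph ∧ v + s • x = e} := by
    refine hreg.2.2.2.mono ?_
    rintro w ⟨x, v, u, hxv, hvu, rfl⟩
    refine ⟨v - s • x, u - s • v, graph_sub ((hsa.2 _ _).2 hvu) (graph_smul s hxv), ?_⟩
    have : s * s = -1 := by rcases hs with rfl | rfl <;> simp
    rw [smul_sub, smul_smul, this]; simp [add_comm]
  obtain ⟨e', he', hlim⟩ := mem_closure_iff_seq_limit.1 (hdense e)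
  choose x v hxv hev using he'
  have hx : CauchySeq x := by
    have h0 := hlim.cauchySeq
    rw [Metric.cauchySeq_iff'] at h0 ⊢
    intro ε hε
    obtain ⟨N, hN⟩ := h0 ε hε
    refine ⟨N, fun n hn => lt_of_le_of_lt ?_ (hN n hn)⟩
    rw [dist_eq_norm, dist_eq_norm]
    refine (hsa.norm_le_norm_add hs (graph_sub (hxv n) (hxv N))).trans_eq ?_
    rw [← hev, ← hev, smul_sub]; congr 1; abel
  obtain ⟨x₀, hx₀⟩ := cauchySeq_tendsto_of_complete hx
  have hv : Tendsto v atTop (𝓝 (e - s • x₀)) :=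
    (hlim.sub (hx₀.const_smul s)).congr fun n => by rw [← hev]; abel
  exact ⟨x₀, e - s • x₀, hreg.1.mem_of_tendsto (hx₀.prodMk_nhds hv)
    (Eventually.of_forall hxv), by abel⟩

/-! ### Commutators -/

lemma IsComm.unique (hsa : IsSelfAdjointOp B D) {a K K' : E →L[ℂ] E} (h : IsComm γ D a K)
    (h' : IsComm γ D a K') : K = K' :=
  hsa.eq_of_forall_graph fun x v hv => by
    simpa using graph_unique (h x v hv) (h' x v hv)

lemma IsComm.add {a b K L : E →L[ℂ] E} (h : IsComm γ D a K) (h' : IsComm γ D b L) :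
    IsComm γ D (a + b) (K + L) := fun x v hv => by
  have := graph_add (h x v hv) (h' x v hv)
  rw [add_add_add_comm] at this
  rw [γ.gr_add]
  exact this

lemma IsComm.smul {a K : E →L[ℂ] E} (h : IsComm γ D a K) (z : ℂ) :
    IsComm γ D (z • a) (z • K) := fun x v hv => by
  have := graph_smul z (h x v hv)
  simpa [γ.gr_smul] using this

lemma IsComm.mul {a b K L : E →L[ℂ] E} (h : IsComm γ D a K) (h' : IsComm γ D b L) :
    IsComm γ D (a * b) (K * b + γ.gr a * L) := fun x v hv => by
  have := h _ _ (h' x v hv)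
  rwa [map_add, add_assoc, add_comm (γ.gr a (L x)), ← mul_apply_eq_comp (γ.gr a) (γ.gr b),
    ← γ.gr_mul] at this

lemma IsComm.one : IsComm γ D 1 0 := fun x v hv => by simpa [γ.gr_one, γ.onE_onE] using hv

lemma comm_isComm {a : E →L[ℂ] E} (ha : a ∈ Lip γ D) : IsComm γ D a (comm γ D a) := by
  rw [comm, dif_pos ha.2]; exact ha.2.choose_spec.2

lemma comm_isAdjointable {a : E →L[ℂ] E} (ha : a ∈ Lip γ D) : IsAdjointable B (comm γ D a) := by
  rw [comm, dif_pos ha.2]; exact ha.2.choose_spec.1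

lemma comm_eq (hsa : IsSelfAdjointOp B D) {a K : E →L[ℂ] E} (ha : a ∈ Lip γ D)
    (h : IsComm γ D a K) : comm γ D a = K := (comm_isComm ha).unique hsa h

variable (γ D) in
/-- `Lip(D)` as a subalgebra. -/
def lipSubalgebra : Subalgebra ℂ (E →L[ℂ] E) where
  carrier := Lip γ D
  mul_mem' := by
    rintro a b ⟨ha, K, hK, hc⟩ ⟨hb, L, hL, hc'⟩
    refine ⟨(adjointableSubalgebra B E).mul_mem ha hb, _, ?_, hc.mul hc'⟩
    obtain ⟨a', ha⟩ := ha
    exact (adjointableSubalgebra B E).add_mem ((adjointableSubalgebra B E).mul_mem hK hb)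
      ((adjointableSubalgebra B E).mul_mem (ha.gr γ).isAdjointable hL)
  add_mem' := by
    rintro a b ⟨ha, K, hK, hc⟩ ⟨hb, L, hL, hc'⟩
    exact ⟨(adjointableSubalgebra B E).add_mem ha hb, _,
      (adjointableSubalgebra B E).add_mem hK hL, hc.add hc'⟩
  algebraMap_mem' z := by
    rw [Algebra.algebraMap_eq_smul_one]
    exact ⟨(adjointableSubalgebra B E).smul_mem (adjointableSubalgebra B E).one_mem z, _,
      (adjointableSubalgebra B E).smul_mem (adjointableSubalgebra B E).zero_mem z,
      IsComm.one.smul z⟩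

variable {a b : E →L[ℂ] E}

lemma comm_add (hsa : IsSelfAdjointOp B D) (ha : a ∈ Lip γ D) (hb : b ∈ Lip γ D) :
    comm γ D (a + b) = comm γ D a + comm γ D b :=
  comm_eq hsa ((lipSubalgebra γ D).add_mem ha hb) ((comm_isComm ha).add (comm_isComm hb))

lemma comm_smul (hsa : IsSelfAdjointOp B D) (ha : a ∈ Lip γ D) (z : ℂ) :
    comm γ D (z • a) = z • comm γ D a :=
  comm_eq hsa ((lipSubalgebra γ D).smul_mem ha z) ((comm_isComm ha).smul z)

lemma comm_sub (hsa : IsSelfAdjointOp B D) (ha : a ∈ Lip γ D) (hb : b ∈ Lip γ D) :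
    comm γ D (a - b) = comm γ D a - comm γ D b := by
  have := comm_add hsa ha ((lipSubalgebra γ D).smul_mem hb (-1))
  rw [comm_smul hsa hb] at this
  simpa [sub_eq_add_neg] using this

lemma comm_mul (hsa : IsSelfAdjointOp B D) (ha : a ∈ Lip γ D) (hb : b ∈ Lip γ D) :
    comm γ D (a * b) = comm γ D a * b + γ.gr a * comm γ D b :=
  comm_eq hsa ((lipSubalgebra γ D).mul_mem ha hb) ((comm_isComm ha).mul (comm_isComm hb))

lemma one_mem_lip : (1 : E →L[ℂ] E) ∈ Lip γ D := (lipSubalgebra γ D).one_mem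

lemma comm_one (hsa : IsSelfAdjointOp B D) : comm γ D (1 : E →L[ℂ] E) = 0 :=
  comm_eq hsa one_mem_lip IsComm.one

lemma comm_sum (hsa : IsSelfAdjointOp B D) {ι : Type*} (s : Finset ι) {f : ι → E →L[ℂ] E}
    (hf : ∀ i, f i ∈ Lip γ D) : comm γ D (∑ i ∈ s, f i) = ∑ i ∈ s, comm γ D (f i) := by
  classical
  induction s using Finset.induction_on with
  | empty => simpa using comm_smul hsa (one_mem_lip (γ := γ) (D := D)) 0
  | insert i s hi ih =>
    rw [Finset.sum_insert hi, Finset.sum_insert hi,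
      comm_add hsa (hf i) ((lipSubalgebra γ D).sum_mem fun i _ => hf i), ih]

/-- `[D, γ(a)*] = -[D, a]*`. -/
lemma comm_adj_gr (hsa : IsSelfAdjointOp B D) (ha : a ∈ Lip γ D)
    (ha' : γ.gr (adj B a) ∈ Lip γ D) :
    comm γ D (γ.gr (adj B a)) = -adj B (comm γ D a) := by
  refine hsa.eq_of_forall_graph fun y w hw => ?_
  refine eq_of_dense_forall_inner_eq (B := B) hsa.1 fun x hx => ?_
  obtain ⟨v, hv⟩ := exists_mem_graph hx
  have h1 := hsa.inner_eq (comm_isComm ha x v hv) hw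
  have h2 := hsa.inner_eq hv (comm_isComm ha' y w hw)
  rw [γ.gr_gr, CStarModule.inner_add_right] at h2
  rw [CStarModule.inner_add_left, ha.1.pair.gr γ, h2, (comm_isAdjointable ha).pair,
    ha.1.pair] at h1
  rw [neg_apply, CStarModule.inner_neg_right, eq_neg_iff_add_eq_zero]
  rw [add_assoc] at h1
  exact add_eq_left.1 h1

/-- `D` is odd, or the grading is trivial. -/
def IsHomogeneous (γ : ModuleGrading B E) (D : E →ₗ.[ℂ] E) : Prop := γ.IsOdd D ∨ γ.IsTrivial

lemma IsComm.gr_of_isOdd (hD : γ.IsOdd D) {a K : E →L[ℂ] E} (h : IsComm γ D a K) :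
    IsComm γ D (γ.gr a) (-γ.gr K) := fun x v hv => by
  have := hD _ _ (h _ _ (hD x v hv))
  simpa [γ.onE_onE, add_comm] using this

lemma gr_mem_lip (hD : IsHomogeneous γ D) (ha : a ∈ Lip γ D) : γ.gr a ∈ Lip γ D := by
  rcases hD with hD | hD
  · obtain ⟨⟨a', ha⟩, K, ⟨K', hK⟩, hc⟩ := ha
    exact ⟨(ha.gr γ).isAdjointable, _, (hK.gr γ).neg.isAdjointable, hc.gr_of_isOdd hD⟩
  · rwa [hD.gr_eq]

lemma norm_comm_gr (hsa : IsSelfAdjointOp B D) (hD : IsHomogeneous γ D) (ha : a ∈ Lip γ D) :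
    ‖comm γ D (γ.gr a)‖ = ‖comm γ D a‖ := by
  have ha' := gr_mem_lip hD ha
  rcases hD with hD | hD
  · rw [comm_eq hsa ha' ((comm_isComm ha).gr_of_isOdd hD), norm_neg, γ.norm_gr]
  · rw [hD.gr_eq]

lemma norm_adj (ha : IsAdjointable B a) : ‖adj B a‖ = ‖a‖ :=
  le_antisymm (norm_le_of_isAdjointPair ha.pair.symm) (norm_le_of_isAdjointPair ha.pair)

lemma norm_comm_adj (hsa : IsSelfAdjointOp B D) (hD : IsHomogeneous γ D) (ha : a ∈ Lip γ D)
    (ha' : adj B a ∈ Lip γ D) : ‖comm γ D (adj B a)‖ = ‖comm γ D a‖ := by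
  rw [← norm_comm_gr hsa hD ha', comm_adj_gr hsa ha (gr_mem_lip hD ha'), norm_neg,
    norm_adj (comm_isAdjointable ha)]

/-! ### The Lipschitz norm -/

/-- The operator matrix `((a, 0), (k, g))`. -/
def lowerTriangular (a k g : E →L[ℂ] E) : C⋆ᵐᵒᵈ(B, E × E) →L[ℂ] C⋆ᵐᵒᵈ(B, E × E) :=
  (WithCStarModule.equivL ℂ : C⋆ᵐᵒᵈ(B, E × E) ≃L[ℂ] E × E).symm.toContinuousLinearMap ∘L
    ((a ∘L ContinuousLinearMap.fst ℂ E E).prod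
      (k ∘L ContinuousLinearMap.fst ℂ E E + g ∘L ContinuousLinearMap.snd ℂ E E)) ∘L
    (WithCStarModule.equivL ℂ : C⋆ᵐᵒᵈ(B, E × E) ≃L[ℂ] E × E).toContinuousLinearMap

variable (a) in
lemma piD_eq : piD γ D a = lowerTriangular a (comm γ D a) (γ.gr a) := rfl

lemma lowerTriangular_apply (a k g : E →L[ℂ] E) (x : C⋆ᵐᵒᵈ(B, E × E)) :
    lowerTriangular a k g x
      = (WithCStarModule.equiv B (E × E)).symm (a x.1, k x.1 + g x.2) := rfl

lemma lowerTriangular_mul (a k g a' k' g' : E →L[ℂ] E) :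
    (lowerTriangular a k g * lowerTriangular a' k' g' :
      C⋆ᵐᵒᵈ(B, E × E) →L[ℂ] C⋆ᵐᵒᵈ(B, E × E))
      = lowerTriangular (a * a') (k * a' + g * k') (g * g') := by
  ext x
  simp only [mul_apply_eq_comp, lowerTriangular_apply]
  refine congrArg (WithCStarModule.equiv B (E × E)).symm (Prod.ext rfl ?_)
  simp [add_assoc]

lemma lowerTriangular_add (a k g a' k' g' : E →L[ℂ] E) :
    (lowerTriangular (a + a') (k + k') (g + g') :
      C⋆ᵐᵒᵈ(B, E × E) →L[ℂ] C⋆ᵐᵒᵈ(B, E × E))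
      = lowerTriangular a k g + lowerTriangular a' k' g' := by
  ext x
  simp only [add_apply, lowerTriangular_apply]
  refine congrArg (WithCStarModule.equiv B (E × E)).symm (Prod.ext rfl ?_)
  exact add_add_add_comm (k x.1) (k' x.1) (g x.2) (g' x.2)

lemma lowerTriangular_smul (z : ℂ) (a k g : E →L[ℂ] E) :
    (lowerTriangular (z • a) (z • k) (z • g) :
      C⋆ᵐᵒᵈ(B, E × E) →L[ℂ] C⋆ᵐᵒᵈ(B, E × E)) = z • lowerTriangular a k g := by
  ext x
  simp only [smul_apply, lowerTriangular_apply]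
  refine congrArg (WithCStarModule.equiv B (E × E)).symm (Prod.ext rfl ?_)
  simp

lemma lowerTriangular_one :
    (lowerTriangular 1 0 1 : C⋆ᵐᵒᵈ(B, E × E) →L[ℂ] C⋆ᵐᵒᵈ(B, E × E)) = 1 := by
  ext x
  simp only [lowerTriangular_apply]
  refine congrArg (WithCStarModule.equiv B (E × E)).symm (Prod.ext rfl ?_)
  simp

lemma norm_lowerTriangular_le (a k g : E →L[ℂ] E) :
    ‖(lowerTriangular a k g : C⋆ᵐᵒᵈ(B, E × E) →L[ℂ] C⋆ᵐᵒᵈ(B, E × E))‖ ≤ ‖a‖ + ‖k‖ + ‖g‖ := by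
  refine ContinuousLinearMap.opNorm_le_bound _ (by positivity) fun x => ?_
  refine (WithCStarModule.prod_norm_le_norm_add _).trans ?_
  have h := WithCStarModule.max_le_prod_norm x
  have h1 : ‖x.1‖ ≤ ‖x‖ := (le_max_left _ _).trans h
  have h2 : ‖x.2‖ ≤ ‖x‖ := (le_max_right _ _).trans h
  calc ‖a x.1‖ + ‖k x.1 + g x.2‖ ≤ ‖a‖ * ‖x.1‖ + (‖k‖ * ‖x.1‖ + ‖g‖ * ‖x.2‖) :=
        add_le_add (a.le_opNorm _) ((norm_add_le _ _).trans
          (add_le_add (k.le_opNorm _) (g.le_opNorm _)))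
    _ ≤ ‖a‖ * ‖x‖ + (‖k‖ * ‖x‖ + ‖g‖ * ‖x‖) := by gcongr
    _ = _ := by ring

lemma norm_inl (x : E) : ‖(WithCStarModule.equiv B (E × E)).symm (x, 0)‖ = ‖x‖ := by
  rw [WithCStarModule.prod_norm]
  simp [← CStarModule.norm_sq_eq B]

lemma max_le_norm_lowerTriangular (a k g : E →L[ℂ] E) :
    max ‖a‖ ‖k‖ ≤ ‖(lowerTriangular a k g : C⋆ᵐᵒᵈ(B, E × E) →L[ℂ] C⋆ᵐᵒᵈ(B, E × E))‖ := by
  set T : C⋆ᵐᵒᵈ(B, E × E) →L[ℂ] C⋆ᵐᵒᵈ(B, E × E) := lowerTriangular a k g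
  have key : ∀ x : E, max ‖a x‖ ‖k x‖ ≤ ‖T‖ * ‖x‖ := fun x => by
    have h := T.le_opNorm ((WithCStarModule.equiv B (E × E)).symm (x, 0))
    rw [norm_inl] at h
    refine le_trans ?_ ((WithCStarModule.max_le_prod_norm _).trans h)
    simp [T, lowerTriangular_apply]
  exact max_le (a.opNorm_le_bound T.opNorm_nonneg fun x => (le_max_left _ _).trans (key x))
    (k.opNorm_le_bound T.opNorm_nonneg fun x => (le_max_right _ _).trans (key x))

variable (γ D) in
lemma norm_le_lipNorm (a : E →L[ℂ] E) : ‖a‖ ≤ lipNorm γ D a :=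
  (le_max_left _ _).trans (max_le_norm_lowerTriangular _ _ _)

variable (γ D) in
lemma norm_comm_le_lipNorm (a : E →L[ℂ] E) : ‖comm γ D a‖ ≤ lipNorm γ D a :=
  (le_max_right _ _).trans (max_le_norm_lowerTriangular _ _ _)

-- With `norm_le_lipNorm` and `norm_comm_le_lipNorm` this makes the Lipschitz norm equivalent to
-- `‖a‖ + ‖[D, a]‖`, which is how it is estimated from here on.
variable (γ D) in
lemma lipNorm_le (a : E →L[ℂ] E) : lipNorm γ D a ≤ 2 * ‖a‖ + ‖comm γ D a‖ := by
  refine (norm_lowerTriangular_le _ _ _).trans_eq ?_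
  rw [γ.norm_gr]; ring

lemma piD_mul (hsa : IsSelfAdjointOp B D) (ha : a ∈ Lip γ D) (hb : b ∈ Lip γ D) :
    piD γ D (a * b) = piD γ D a * piD γ D b := by
  rw [piD_eq, piD_eq, piD_eq, lowerTriangular_mul, comm_mul hsa ha hb, γ.gr_mul]

lemma piD_add (hsa : IsSelfAdjointOp B D) (ha : a ∈ Lip γ D) (hb : b ∈ Lip γ D) :
    piD γ D (a + b) = piD γ D a + piD γ D b := by
  rw [piD_eq, piD_eq, piD_eq, ← lowerTriangular_add, comm_add hsa ha hb, γ.gr_add]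

lemma piD_smul (hsa : IsSelfAdjointOp B D) (ha : a ∈ Lip γ D) (z : ℂ) :
    piD γ D (z • a) = z • piD γ D a := by
  rw [piD_eq, piD_eq, ← lowerTriangular_smul, comm_smul hsa ha, γ.gr_smul]

lemma piD_sub (hsa : IsSelfAdjointOp B D) (ha : a ∈ Lip γ D) (hb : b ∈ Lip γ D) :
    piD γ D (a - b) = piD γ D a - piD γ D b := by
  have := piD_add hsa ha ((lipSubalgebra γ D).smul_mem hb (-1))
  rwa [piD_smul hsa hb, neg_one_smul, ← sub_eq_add_neg,
    show (-1 : ℂ) • piD γ D b = -piD γ D b from neg_one_smul ℂ (piD γ D b),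
    ← sub_eq_add_neg] at this

lemma piD_one (hsa : IsSelfAdjointOp B D) : piD γ D (1 : E →L[ℂ] E) = 1 := by
  rw [piD_eq, comm_one hsa, γ.gr_one, lowerTriangular_one]

variable (γ D) in
lemma piD_injective : Function.Injective (piD γ D) := fun a b h => by
  ext x
  have h1 := congrArg (fun T => (T ((WithCStarModule.equiv B (E × E)).symm (x, 0))).1) h
  simpa [piD_eq, lowerTriangular_apply] using h1

lemma lipNorm_mul_le (hsa : IsSelfAdjointOp B D) (ha : a ∈ Lip γ D) (hb : b ∈ Lip γ D) :
    lipNorm γ D (a * b) ≤ lipNorm γ D a * lipNorm γ D b := by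
  rw [lipNorm, piD_mul hsa ha hb]; exact ContinuousLinearMap.opNorm_comp_le (piD γ D a) (piD γ D b)

lemma lipNorm_add_le (hsa : IsSelfAdjointOp B D) (ha : a ∈ Lip γ D) (hb : b ∈ Lip γ D) :
    lipNorm γ D (a + b) ≤ lipNorm γ D a + lipNorm γ D b := by
  rw [lipNorm, piD_add hsa ha hb]; exact norm_add_le (piD γ D a) (piD γ D b)

lemma lipNorm_smul_le (hsa : IsSelfAdjointOp B D) (ha : a ∈ Lip γ D) (z : ℂ) :
    lipNorm γ D (z • a) ≤ ‖z‖ * lipNorm γ D a := by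
  rw [lipNorm, piD_smul hsa ha]; exact (piD γ D a).opNorm_smul_le z

lemma lipNorm_sub_le (hsa : IsSelfAdjointOp B D) (ha : a ∈ Lip γ D) (hb : b ∈ Lip γ D) :
    lipNorm γ D (a - b) ≤ lipNorm γ D a + lipNorm γ D b := by
  rw [lipNorm, piD_sub hsa ha hb]; exact norm_sub_le (piD γ D a) (piD γ D b)

variable (γ D) in
lemma lipNorm_nonneg (a : E →L[ℂ] E) : 0 ≤ lipNorm γ D a := norm_nonneg (piD γ D a)

lemma tendsto_lipNorm_zero {ι : Type*} {l : Filter ι} {f : ι → E →L[ℂ] E}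
    (h : Tendsto (fun i => ‖f i‖) l (𝓝 0)) (h' : Tendsto (fun i => ‖comm γ D (f i)‖) l (𝓝 0)) :
    Tendsto (fun i => lipNorm γ D (f i)) l (𝓝 0) :=
  squeeze_zero (fun _ => lipNorm_nonneg γ D _) (fun _ => lipNorm_le γ D _)
    (by simpa using (h.const_mul 2).add h')

end SelfAdjoint

end DiffAlg

end

noncomputable section

namespace DiffAlg

/-! ### Spectral invariance of differentiable algebras -/

/-- The complement is the union of its parts in the closed upper and lower half-planes. Each
contains an open half-plane and lies in its closure, and the two share a real point outside the
bounded set `s`. -/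
lemma isPreconnected_compl_of_im_eq_zero {s : Set ℂ} (hb : Bornology.IsBounded s)
    (hs : ∀ z ∈ s, z.im = 0) : IsPreconnected sᶜ := by
  suffices IsConnected ((sᶜ ∩ {z | 0 ≤ z.im}) ∪ sᶜ ∩ {z | z.im ≤ 0}) by
    rw [← Set.inter_union_distrib_left, ← Set.ofPred_or] at this
    rw [← Set.inter_univ sᶜ]
    convert this.isPreconnected
    exact Eq.symm <| Set.eq_univ_of_forall (fun z ↦ le_total 0 z.im)
  refine IsConnected.union ?nonempty ?upper ?lower
  case nonempty =>
    have := Filter.NeBot.nonempty_of_mem inferInstance <| Filter.mem_map.mp <|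
      Complex.isometry_ofReal.antilipschitz.tendsto_cobounded hb.compl
    exact this.image Complex.ofReal |>.mono <| by simp
  case' upper => apply Complex.isConnected_of_upperHalfPlane ?_ <| Set.inter_subset_right
  case' lower => apply Complex.isConnected_of_lowerHalfPlane ?_ <| Set.inter_subset_right
  all_goals
    refine Set.subset_inter (fun z hz hz' ↦ ?_) (fun _ ↦ by simpa using le_of_lt)
    rw [Set.mem_ofPred_eq, hs z hz'] at hz
    simp_all

section Permanence

variable {R : Type*} [NormedRing R] [NormedAlgebra ℂ R]

/-- A closed algebra is an ideal in the closed unital algebra that it generates; this returns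
inverses from the unitization to `J`. -/
lemma mul_mem_of_mem_closure_adjoin {J : Set R} (hJ : IsClosed J)
    (hadd : ∀ a ∈ J, ∀ b ∈ J, a + b ∈ J) (hmul : ∀ a ∈ J, ∀ b ∈ J, a * b ∈ J)
    (hsmul : ∀ z : ℂ, ∀ a ∈ J, z • a ∈ J) {s t : R}
    (hs : s ∈ (Algebra.adjoin ℂ J).topologicalClosure) (ht : t ∈ J) : t * s ∈ J := by
  refine closure_minimal (s := (Algebra.adjoin ℂ J : Set R)) (t := {s | t * s ∈ J})
    (fun s hs => ?_) (hJ.preimage (continuous_const_mul t)) hs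
  change t * s ∈ J
  induction hs using Algebra.adjoin_induction generalizing t with
  | mem x hx => exact hmul t ht x hx
  | algebraMap z =>
    rw [Algebra.algebraMap_eq_smul_one, mul_smul_one]
    exact hsmul z t ht
  | add x y _ _ hx hy => rw [mul_add]; exact hadd _ (hx ht) _ (hy ht)
  | mul x y _ _ hx hy => rw [← mul_assoc]; exact hy (hx ht)

/-- A closed subalgebra `J` of a Banach algebra contains the quasi-inverses of its elements with
real spectrum. -/
lemma exists_quasiInverse_of_isUnit [CompleteSpace R] {J : Set R} (hJ : IsClosed J)
    (hadd : ∀ a ∈ J, ∀ b ∈ J, a + b ∈ J) (hmul : ∀ a ∈ J, ∀ b ∈ J, a * b ∈ J)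
    (hsmul : ∀ z : ℂ, ∀ a ∈ J, z • a ∈ J) {t : R} (ht : t ∈ J)
    (hreal : ∀ w ∈ spectrum ℂ t, w.im = 0) {z : ℂ} (hz : z ≠ 0) (hu : IsUnit (1 + z • t)) :
    ∃ y ∈ J, (1 + z • t) * (1 + y) = 1 ∧ (1 + y) * (1 + z • t) = 1 := by
  set S := (Algebra.adjoin ℂ J).topologicalClosure with hS
  have hScl : IsClosed (S : Set R) := Subalgebra.isClosed_topologicalClosure _
  let T : S := ⟨t, Subalgebra.le_topologicalClosure _ (Algebra.subset_adjoin ht)⟩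
  -- Passing to a closed subalgebra can only fill holes of the spectrum, and a bounded real set has
  -- none.
  have hspec := Subalgebra.spectrum_eq_of_isPreconnected_compl S T
    (isPreconnected_compl_of_im_eq_zero (spectrum.isBounded _) hreal)
  have h1 : (-z⁻¹) ∉ spectrum ℂ T := by
    rw [hspec, spectrum.notMem_iff]
    have : algebraMap ℂ R (-z⁻¹) - t = (-z⁻¹) • (1 + z • t) := by
      rw [Algebra.algebraMap_eq_smul_one, smul_add, smul_smul, neg_mul, inv_mul_cancel₀ hz,
        neg_one_smul, sub_eq_add_neg]
    exact this ▸ (IsUnit.smul (Units.mk0 (-z⁻¹) (by simpa using hz)) hu :)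
  rw [spectrum.notMem_iff] at h1
  have h2 : IsUnit (1 + z • T) := by
    have : 1 + z • T = (-z) • (algebraMap ℂ S (-z⁻¹) - T) := by
      rw [Algebra.algebraMap_eq_smul_one, smul_sub, smul_smul, neg_mul_neg, mul_inv_cancel₀ hz,
        one_smul, neg_smul, sub_neg_eq_add]
    exact this ▸ (IsUnit.smul (Units.mk0 (-z) (by simpa using hz)) h1 :)
  obtain ⟨r, hr1, hr2⟩ := isUnit_iff_exists.1 h2
  have e1 : (1 + z • t) * (r : R) = 1 := congrArg Subtype.val hr1
  have e2 : (r : R) * (1 + z • t) = 1 := congrArg Subtype.val hr2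
  -- From `(1 + z t) r = 1` one reads off `r - 1 = -z t r`, a multiple of `t` and hence an element
  -- of `J`.
  have e3 : (r : R) - 1 = ((-z) • t) * r := by
    rw [← e1]; simp [add_mul]
  refine ⟨(r : R) - 1, ?_, by rw [add_sub_cancel, e1], by rw [add_sub_cancel, e2]⟩
  rw [e3]
  exact mul_mem_of_mem_closure_adjoin hJ hadd hmul hsmul r.2 (hsmul _ t ht)

end Permanence

variable {B E : Type*} [NonUnitalCStarAlgebra B] [PartialOrder B] [StarOrderedRing B]
  [NormedAddCommGroup E] [NormedSpace ℂ E] [SMul B E] [CStarModule B E]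
variable {γ : ModuleGrading B E} {D : E →ₗ.[ℂ] E} {𝒜 : NonUnitalSubalgebra ℂ (E →L[ℂ] E)}

/-- The commutator in the corner does not affect invertibility. This is the source of spectral
invariance. -/
lemma isUnit_lowerTriangular {a k g : E →L[ℂ] E} (ha : IsUnit a) (hg : IsUnit g) :
    IsUnit (lowerTriangular a k g : C⋆ᵐᵒᵈ(B, E × E) →L[ℂ] C⋆ᵐᵒᵈ(B, E × E)) := by
  obtain ⟨a, rfl⟩ := ha
  obtain ⟨g, rfl⟩ := hg
  refine isUnit_iff_exists.2
    ⟨lowerTriangular (↑a⁻¹) (-(↑g⁻¹ * k * ↑a⁻¹)) (↑g⁻¹), ?_, ?_⟩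
  · rw [lowerTriangular_mul, ← lowerTriangular_one]
    simp [mul_assoc]
  · rw [lowerTriangular_mul, ← lowerTriangular_one]
    simp [mul_assoc]

lemma isUnit_piD {a : E →L[ℂ] E} (ha : IsUnit a) : IsUnit (piD γ D a) :=
  isUnit_lowerTriangular ha (ha.map γ.grHom)

variable [CompleteSpace E]

/-- `EndStar` version of a self-adjoint operator. -/
lemma isSelfAdjoint_mk {x : E →L[ℂ] E} (h : IsAdjointable B x) (hx : adj B x = x) :
    IsSelfAdjoint (⟨x, h⟩ : EndStar B E) := Subtype.ext hx

lemma isUnit_coe {x : EndStar B E} (hx : IsUnit x) : IsUnit (x : E →L[ℂ] E) :=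
  hx.map (adjointableSubalgebra B E).val

set_option maxHeartbeats 1000000 in
/-- If `1 + z x` is invertible for a self-adjoint `x ∈ 𝒜`, then the inverse lies in `1 + 𝒜`. -/
lemma exists_inverse_of_isUnit (hsa : IsSelfAdjointOp B D) (hA : IsDifferentiableAlgebra γ D 𝒜)
    {x : E →L[ℂ] E} (hx : x ∈ 𝒜) (hxsa : adj B x = x) {z : ℂ} (hu : IsUnit (1 + z • x)) :
    ∃ y ∈ 𝒜, (1 + z • x) * (1 + y) = 1 ∧ (1 + y) * (1 + z • x) = 1 := by
  rcases eq_or_ne z 0 with rfl | hz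
  · exact ⟨0, 𝒜.zero_mem, by simp⟩
  have hxl := hA.mem_lip x hx
  have hzx : 1 + z • x ∈ Lip γ D :=
    (lipSubalgebra γ D).add_mem one_mem_lip ((lipSubalgebra γ D).smul_mem hxl z)
  have hlip := hA.mem_lip
  -- `piD x` is not self-adjoint in general; its spectrum is real because `w - x` is invertible for
  -- non-real `w`, and `piD` preserves this.
  have hreal : ∀ w ∈ spectrum ℂ (piD γ D x), w.im = 0 := by
    intro w hw
    by_contra him
    have h1 : w ∉ spectrum ℂ (⟨x, hxl.1⟩ : EndStar B E) := fun h =>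
      him ((isSelfAdjoint_mk hxl.1 hxsa).im_eq_zero_of_mem_spectrum h)
    have h2 : IsUnit (w • 1 - x) := by
      simpa [Algebra.algebraMap_eq_smul_one] using isUnit_coe (spectrum.notMem_iff.1 h1)
    refine spectrum.mem_iff.1 hw ?_
    rw [Algebra.algebraMap_eq_smul_one, ← piD_one hsa (γ := γ), ← piD_smul hsa one_mem_lip,
      ← piD_sub hsa ((lipSubalgebra γ D).smul_mem one_mem_lip w) hxl]
    exact isUnit_piD h2
  have hpx : piD γ D (1 + z • x) = 1 + z • piD γ D x := by
    rw [piD_add hsa one_mem_lip ((lipSubalgebra γ D).smul_mem hxl z), piD_one hsa,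
      piD_smul hsa hxl]
  have hadd : ∀ a ∈ piD γ D '' (𝒜 : Set (E →L[ℂ] E)), ∀ b ∈ piD γ D '' (𝒜 : Set (E →L[ℂ] E)),
      a + b ∈ piD γ D '' (𝒜 : Set (E →L[ℂ] E)) := by
    rintro _ ⟨a, ha, rfl⟩ _ ⟨b, hb, rfl⟩
    exact ⟨a + b, 𝒜.add_mem ha hb, piD_add hsa (hlip a ha) (hlip b hb)⟩
  have hmul : ∀ a ∈ piD γ D '' (𝒜 : Set (E →L[ℂ] E)), ∀ b ∈ piD γ D '' (𝒜 : Set (E →L[ℂ] E)),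
      a * b ∈ piD γ D '' (𝒜 : Set (E →L[ℂ] E)) := by
    rintro _ ⟨a, ha, rfl⟩ _ ⟨b, hb, rfl⟩
    exact ⟨a * b, 𝒜.mul_mem ha hb, piD_mul hsa (hlip a ha) (hlip b hb)⟩
  have hsmul : ∀ w : ℂ, ∀ a ∈ piD γ D '' (𝒜 : Set (E →L[ℂ] E)),
      w • a ∈ piD γ D '' (𝒜 : Set (E →L[ℂ] E)) := by
    rintro w _ ⟨a, ha, rfl⟩
    exact ⟨w • a, 𝒜.smul_mem w ha, piD_smul hsa (hlip a ha) w⟩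
  have hpu : IsUnit (1 + z • piD γ D x) := hpx ▸ isUnit_piD hu
  obtain ⟨Y, ⟨y, hy, rfl⟩, hy1, hy2⟩ := exists_quasiInverse_of_isUnit
    (R := C⋆ᵐᵒᵈ(B, E × E) →L[ℂ] C⋆ᵐᵒᵈ(B, E × E)) (J := piD γ D '' (𝒜 : Set (E →L[ℂ] E)))
    hA.isClosed hadd hmul hsmul (Set.mem_image_of_mem _ hx) hreal hz hpu
  have hy1' : 1 + y ∈ Lip γ D := (lipSubalgebra γ D).add_mem one_mem_lip (hlip y hy)
  have hpy : piD γ D (1 + y) = 1 + piD γ D y := by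
    rw [piD_add hsa one_mem_lip (hlip y hy), piD_one hsa]
  refine ⟨y, hy, piD_injective γ D ?_, piD_injective γ D ?_⟩
  · rw [piD_mul hsa hzx hy1', piD_one hsa, hpy, hpx, hy1]
  · rw [piD_mul hsa hy1' hzx, piD_one hsa, hpy, hpx, hy2]

lemma exists_inverse_one_add_of_isPos (hsa : IsSelfAdjointOp B D)
    (hA : IsDifferentiableAlgebra γ D 𝒜) {x : E →L[ℂ] E} (hx : x ∈ 𝒜) (hpos : IsPos B x) :
    ∃ y ∈ 𝒜, (1 + x) * (1 + y) = 1 ∧ (1 + y) * (1 + x) = 1 := by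
  have h0 : 0 ≤ (⟨x, hpos.1⟩ : EndStar B E) := nonneg_iff_isPos.2 hpos
  have hu : IsUnit (1 + (⟨x, hpos.1⟩ : EndStar B E)) :=
    CStarAlgebra.isUnit_of_le 1 (le_add_of_nonneg_right h0)
  have hxsa : adj B x = x := congrArg Subtype.val (IsSelfAdjoint.of_nonneg h0).star_eq
  have := exists_inverse_of_isUnit hsa hA hx hxsa (z := 1) (by simpa using isUnit_coe hu)
  simpa using this

/-- For `z` outside `[0, ∞)` the inverse of `1 - z⁻¹ x` in `End*_B(E)` lies in `1 + 𝒜` by spectral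
invariance, which makes `-z⁻¹ x` quasiregular in `𝒜`. -/
lemma quasispectrum_of_isPos (hsa : IsSelfAdjointOp B D) (hA : IsDifferentiableAlgebra γ D 𝒜)
    (x : 𝒜) (hpos : IsPos B (x : E →L[ℂ] E)) : ∀ z ∈ quasispectrum ℂ x, 0 ≤ z.re ∧ z.im = 0 := by
  intro z hz
  by_contra hcon
  have hz0 : z ≠ 0 := by rintro rfl; simp at hcon
  have h0 : 0 ≤ (⟨x, hpos.1⟩ : EndStar B E) := nonneg_iff_isPos.2 hpos
  have hX := IsSelfAdjoint.of_nonneg h0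
  have h1 : z ∉ spectrum ℂ (⟨x, hpos.1⟩ : EndStar B E) := fun h => by
    refine hcon ⟨?_, hX.im_eq_zero_of_mem_spectrum h⟩
    rw [hX.mem_spectrum_eq_re h] at h
    exact spectrum_nonneg_of_nonneg h0 (spectrum.of_algebraMap_mem ℂ h)
  have h2 := isUnit_coe (spectrum.notMem_iff.1 h1)
  have hu : IsUnit (1 + (-z⁻¹) • (x : E →L[ℂ] E)) := by
    have : (1 + (-z⁻¹) • (x : E →L[ℂ] E))
        = z⁻¹ • ((algebraMap ℂ (EndStar B E) z - ⟨x, hpos.1⟩ : EndStar B E) : E →L[ℂ] E) := by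
      rw [AddSubgroupClass.coe_sub, Subalgebra.coe_algebraMap, Algebra.algebraMap_eq_smul_one,
        smul_sub, smul_smul, inv_mul_cancel₀ hz0, one_smul, neg_smul, sub_eq_add_neg]
    rw [this]
    exact (IsUnit.smul (Units.mk0 z⁻¹ (by simpa using hz0)) h2 :)
  have hxsa : adj B (x : E →L[ℂ] E) = x := congrArg Subtype.val hX.star_eq
  obtain ⟨y, hy, hy1, hy2⟩ := exists_inverse_of_isUnit hsa hA x.2 hxsa hu
  refine hz (IsUnit.mk0 z hz0) (isQuasiregular_iff.2 ⟨⟨y, hy⟩, Subtype.ext ?_, Subtype.ext ?_⟩)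
  · have := congrArg (· - 1) hy1
    simp only [mul_add, add_mul, mul_one, one_mul, sub_self] at this
    refine Eq.trans ?_ this
    simp [Units.smul_def]
    abel
  · have := congrArg (· - 1) hy2
    simp only [mul_add, add_mul, mul_one, one_mul, sub_self] at this
    refine Eq.trans ?_ this
    simp [Units.smul_def]
    abel

end DiffAlg

end

noncomputable section

namespace DiffAlg

variable {B E : Type*} [NonUnitalCStarAlgebra B] [PartialOrder B] [StarOrderedRing B]
  [NormedAddCommGroup E] [NormedSpace ℂ E] [SMul B E] [CStarModule B E]
variable {γ : ModuleGrading B E} {D : E →ₗ.[ℂ] E} {𝒜 : NonUnitalSubalgebra ℂ (E →L[ℂ] E)}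

/-! ### Essential algebras -/

lemma IsEssential.mem_of_isClosed (hess : IsEssential 𝒜) {V : Submodule ℂ E}
    (hV : IsClosed (V : Set E)) (h : ∀ a ∈ 𝒜, ∀ e, a e ∈ V) (x : E) : x ∈ V := by
  have hx : x ∈ (⊤ : Submodule ℂ E) := trivial
  rw [← hess] at hx
  refine Submodule.topologicalClosure_minimal _ (Submodule.span_le.2 ?_) hV hx
  rintro _ ⟨a, ha, e, rfl⟩
  exact closure_minimal (s := (𝒜 : Set (E →L[ℂ] E))) (t := {a | a e ∈ V}) (fun a ha => h a ha e)
    (hV.preimage (ContinuousLinearMap.apply ℂ E e).continuous) ha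

lemma IsEssential.ext (hess : IsEssential 𝒜) {S T : E →L[ℂ] E} (h : ∀ a ∈ 𝒜, S * a = T * a) :
    S = T := by
  ext x
  have := hess.mem_of_isClosed (V := LinearMap.ker (S - T : E →L[ℂ] E).toLinearMap)
    (S - T).isClosed_ker (fun a ha e => by
      have := congrArg (fun U : E →L[ℂ] E => U e) (h a ha)
      simpa [sub_eq_zero] using this) x
  simpa [sub_eq_zero] using this

lemma IsEssential.denseRange (hess : IsEssential 𝒜) {h : E →L[ℂ] E}
    (hh : LipDense γ D 𝒜 {b | ∃ a ∈ 𝒜, b = h * a}) : DenseRange h := by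
  intro x
  have key := hess.mem_of_isClosed (V := (LinearMap.range h.toLinearMap).topologicalClosure)
    (Submodule.isClosed_topologicalClosure _) (fun a ha e => ?_) x
  · exact key
  refine Metric.mem_closure_iff.2 fun ε hε => ?_
  obtain ⟨_, ⟨b, hb, rfl⟩, hlt⟩ := hh.2 a ha (ε / (‖e‖ + 1)) (by positivity)
  refine ⟨h (b e), ⟨b e, rfl⟩, ?_⟩
  rw [dist_eq_norm]
  calc ‖a e - h (b e)‖ = ‖(a - h * b) e‖ := rfl
    _ ≤ ‖a - h * b‖ * ‖e‖ := ContinuousLinearMap.le_opNorm _ _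
    _ ≤ (ε / (‖e‖ + 1)) * ‖e‖ := by
        gcongr; exact (norm_le_lipNorm γ D _).trans hlt.le
    _ < (ε / (‖e‖ + 1)) * (‖e‖ + 1) := by
        gcongr; linarith
    _ = ε := by field_simp

/-- The kernel of `h` is orthogonal to the range of its adjoint. -/
lemma injective_of_denseRange {h h' : E →L[ℂ] E} (hadj : IsAdjointPair B h' h)
    (hd : DenseRange h') : Function.Injective h := by
  refine (injective_iff_map_eq_zero h).2 fun x hx => ?_
  refine eq_of_dense_forall_inner_eq (B := B) hd ?_
  rintro _ ⟨y, rfl⟩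
  rw [hadj, hx]
  simp

lemma adj_mul {a b : E →L[ℂ] E} (ha : IsAdjointable B a) (hb : IsAdjointable B b) :
    adj B (a * b) = adj B b * adj B a := (ha.pair.mul hb.pair).adj_eq

lemma mul_one_add_mem {a b : E →L[ℂ] E} (ha : a ∈ 𝒜) (hb : b ∈ 𝒜) : a * (1 + b) ∈ 𝒜 := by
  rw [mul_add, mul_one]; exact 𝒜.add_mem ha (𝒜.mul_mem ha hb)

lemma one_add_mul_mem {a b : E →L[ℂ] E} (ha : a ∈ 𝒜) (hb : b ∈ 𝒜) : (1 + b) * a ∈ 𝒜 := by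
  rw [add_mul, one_mul]; exact 𝒜.add_mem ha (𝒜.mul_mem hb ha)

lemma IsDifferentiableAlgebra.one_add_mem_lip (hA : IsDifferentiableAlgebra γ D 𝒜)
    {b : E →L[ℂ] E} (hb : b ∈ 𝒜) : 1 + b ∈ Lip γ D :=
  (lipSubalgebra γ D).add_mem one_mem_lip (hA.mem_lip b hb)

lemma lipNorm_zero (hsa : IsSelfAdjointOp B D) : lipNorm γ D 0 = 0 := by
  refine le_antisymm ?_ (lipNorm_nonneg γ D 0)
  simpa using lipNorm_smul_le hsa (one_mem_lip (γ := γ) (D := D)) 0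

lemma inMultiplierAlgebra_mul (hsa : IsSelfAdjointOp B D) {r : E →L[ℂ] E} (hr : r ∈ 𝒜) :
    InMultiplierAlgebra γ D 𝒜 (fun a => r * a) := by
  refine ⟨pure r, inferInstance, by simpa using hr, fun a ha => ⟨⟨𝒜.mul_mem hr ha, ?_⟩,
    a * r, 𝒜.mul_mem ha hr, ?_⟩⟩
  all_goals
    rw [tendsto_pure_left]
    intro s hs
    rw [sub_self, lipNorm_zero hsa]
    exact mem_of_mem_nhds hs

/-! ### Resolvents and graphs -/

/-- The resolvents exhaust the domain, so the set is `r (Dom D)` and does not depend on `s`. -/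
lemma mem_imMulResolvent {s : ℂ} {r : E →L[ℂ] E} {x : E} :
    x ∈ imMulResolvent D s r ↔ ∃ y v, (y, v) ∈ D.graph ∧ x = r y := by
  constructor
  · rintro ⟨e, y, ⟨v, hv, -⟩, rfl⟩
    exact ⟨y, v, hv, rfl⟩
  · rintro ⟨y, v, hv, rfl⟩
    exact ⟨_, y, ⟨v, hv, rfl⟩, rfl⟩

lemma mem_imResolventMul {s : ℂ} {r : E →L[ℂ] E} {x : E} :
    x ∈ imResolventMul D s r ↔ ∃ e v, (x, v) ∈ D.graph ∧ v + s • x = r e := Iff.rfl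

/-- The multiplication by an invertible `m` with `m, m⁻¹ ∈ Lip(D)` changes neither image. -/
lemma imMulResolvent_mul {s : ℂ} {h m m' : E →L[ℂ] E} (hm : m ∈ Lip γ D) (hm' : m' ∈ Lip γ D)
    (hmm' : m * m' = 1) : imMulResolvent D s (h * m) = imMulResolvent D s h := by
  ext x
  simp only [mem_imMulResolvent]
  constructor
  · rintro ⟨y, v, hv, rfl⟩
    exact ⟨m y, _, comm_isComm hm y v hv, rfl⟩
  · rintro ⟨y, v, hv, rfl⟩
    refine ⟨m' y, _, comm_isComm hm' y v hv, ?_⟩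
    change h y = h ((m * m') y)
    rw [hmm']; rfl

lemma imResolventMul_mul {s : ℂ} {h m m' : E →L[ℂ] E} (hmm' : m * m' = 1) :
    imResolventMul D s (h * m) = imResolventMul D s h := by
  ext x
  simp only [mem_imResolventMul]
  constructor
  · rintro ⟨e, v, hv, he⟩
    exact ⟨m e, v, hv, he⟩
  · rintro ⟨e, v, hv, he⟩
    refine ⟨m' e, v, hv, he.trans ?_⟩
    change h e = h ((m * m') e)
    rw [hmm']; rfl

/-! ### Quadratic form bounds -/

/-- From `0 ≤ b + a ≤ 2 b` one gets `‖b + a‖ ≤ 2 ‖b‖`; subtracting `b` costs one more `‖b‖`. The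
value `3` is not sharp but suffices. -/
lemma norm_le_of_neg_le_of_le {a b : B} (h1 : 0 ≤ b - a) (h2 : 0 ≤ b + a) : ‖a‖ ≤ 3 * ‖b‖ := by
  have h3 : ‖b + a‖ ≤ ‖(2 : ℝ) • b‖ := by
    refine CStarAlgebra.norm_le_norm_of_nonneg_of_le h2 ?_
    rw [two_smul]
    exact add_le_add_right (sub_nonneg.1 h1) b
  rw [norm_smul, Real.norm_ofNat] at h3
  calc ‖a‖ = ‖(b + a) - b‖ := by rw [add_sub_cancel_left]
    _ ≤ ‖b + a‖ + ‖b‖ := norm_sub_le _ _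
    _ ≤ 3 * ‖b‖ := by linarith

/-- The symmetric part `⟨z, X y⟩ + ⟨y, X z⟩` comes from the forms at `z ± y`, where the terms in `h`
combine by the parallelogram law. Replacing `y` by `i y` recovers `⟨z, X y⟩` itself. -/
lemma norm_inner_le_of_form_bounds {X h : E →L[ℂ] E} {C : ℝ} (hC : 0 ≤ C)
    (h1 : ∀ x : E, 0 ≤ C • inner B (h x) (h x) - inner B x (X x))
    (h2 : ∀ x : E, 0 ≤ C • inner B (h x) (h x) + inner B x (X x)) (z y : E) :
    ‖(inner B z (X y) : B)‖ ≤ 3 * C * (‖h z‖ ^ 2 + ‖h y‖ ^ 2) := by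
  have key : ∀ z y : E, ‖(inner B z (X y) + inner B y (X z) : B)‖
      ≤ 3 * C * (‖h z‖ ^ 2 + ‖h y‖ ^ 2) := by
    intro z y
    have e1 : (2 : ℝ) • ((C • inner B (h z) (h z) + C • inner B (h y) (h y))
        - (inner B z (X y) + inner B y (X z)))
        = (C • inner B (h (z + y)) (h (z + y)) - inner B (z + y) (X (z + y)))
        + (C • inner B (h (z - y)) (h (z - y)) + inner B (z - y) (X (z - y))) := by
      simp only [map_add, map_sub, CStarModule.inner_add_left, CStarModule.inner_add_right,
        CStarModule.inner_sub_left, CStarModule.inner_sub_right, smul_add, smul_sub, two_smul]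
      abel
    have e2 : (2 : ℝ) • ((C • inner B (h z) (h z) + C • inner B (h y) (h y))
        + (inner B z (X y) + inner B y (X z)))
        = (C • inner B (h (z + y)) (h (z + y)) + inner B (z + y) (X (z + y)))
        + (C • inner B (h (z - y)) (h (z - y)) - inner B (z - y) (X (z - y))) := by
      simp only [map_add, map_sub, CStarModule.inner_add_left, CStarModule.inner_add_right,
        CStarModule.inner_sub_left, CStarModule.inner_sub_right, smul_add, smul_sub, two_smul]
      abel
    have pos_of_two_smul : ∀ {b : B}, 0 ≤ (2 : ℝ) • b → 0 ≤ b := fun {b} hb => by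
      simpa [smul_smul] using smul_nonneg (by norm_num : (0 : ℝ) ≤ 1 / 2) hb
    have f1 := e1 ▸ add_nonneg (h1 (z + y)) (h2 (z - y))
    have f2 := e2 ▸ add_nonneg (h2 (z + y)) (h1 (z - y))
    have g := norm_le_of_neg_le_of_le (pos_of_two_smul f1) (pos_of_two_smul f2)
    refine g.trans ?_
    rw [mul_assoc]
    gcongr
    refine (norm_add_le _ _).trans_eq ?_
    rw [norm_smul, norm_smul, Real.norm_of_nonneg hC, ← CStarModule.norm_sq_eq B,
      ← CStarModule.norm_sq_eq B]
    ring
  have k1 := key z y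
  have k2 := key z (Complex.I • y)
  have e : (2 : ℂ) • inner B z (X y) = (inner B z (X y) + inner B y (X z))
      - Complex.I • (inner B z (X (Complex.I • y)) + inner B (Complex.I • y) (X z)) := by
    simp [smul_smul, two_smul]
  have k3 : 2 * ‖(inner B z (X y) : B)‖ ≤ 2 * (3 * C * (‖h z‖ ^ 2 + ‖h y‖ ^ 2)) := by
    have := norm_sub_le (inner B z (X y) + inner B y (X z) : B)
      (Complex.I • (inner B z (X (Complex.I • y)) + inner B (Complex.I • y) (X z)))
    rw [← e, norm_smul, norm_smul] at this
    simp only [map_smul, norm_smul, Complex.norm_I, one_mul, Complex.norm_ofNat] at this k2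
    linarith
  linarith

/-- By density the bound holds with any vector `u` in place of `h z`, and `u = δ / (2 C)` is the
optimal multiple of `δ`. -/
lemma norm_le_of_norm_inner_le {h : E →L[ℂ] E} (hd : DenseRange h) {C R : ℝ} (hC : 0 < C)
    (hR : 0 ≤ R) {δ : E} (hδ : ∀ z : E, ‖(inner B (h z) δ : B)‖ ≤ C * (‖h z‖ ^ 2 + R ^ 2)) :
    ‖δ‖ ≤ 2 * C * R := by
  have key : ∀ u : E, ‖(inner B u δ : B)‖ ≤ C * (‖u‖ ^ 2 + R ^ 2) := by
    intro u
    have hc : Continuous fun u : E => (inner B u δ : B) :=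
      CStarModule.continuous_inner.comp (by fun_prop : Continuous fun x : E => (x, δ))
    refine closure_minimal (s := Set.range h) (t := {u | ‖(inner B u δ : B)‖ ≤ C * (‖u‖ ^ 2 + R ^ 2)})
      ?_ (isClosed_le (by fun_prop) (by fun_prop)) (hd u)
    rintro _ ⟨z, rfl⟩
    exact hδ z
  have h1 := key (((1 / (2 * C) : ℝ) : ℂ) • δ)
  rw [CStarModule.inner_smul_left_complex, norm_smul, norm_smul, ← CStarModule.norm_sq_eq B] at h1
  have hn : ‖((1 / (2 * C) : ℝ) : ℂ)‖ = 1 / (2 * C) := by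
    rw [Complex.norm_real, Real.norm_of_nonneg (by positivity)]
  rw [norm_star, hn] at h1
  have h2 : ‖δ‖ ^ 2 ≤ (2 * C * R) ^ 2 := by
    have e1 : C * ((1 / (2 * C) * ‖δ‖) ^ 2 + R ^ 2) = ‖δ‖ ^ 2 / (4 * C) + C * R ^ 2 := by
      field_simp; ring
    have e2 : 1 / (2 * C) * ‖δ‖ ^ 2 = ‖δ‖ ^ 2 / (4 * C) + ‖δ‖ ^ 2 / (4 * C) := by
      field_simp; ring
    rw [e1, e2] at h1
    have h3 : ‖δ‖ ^ 2 / (4 * C) ≤ C * R ^ 2 := by linarith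
    rw [div_le_iff₀ (by positivity)] at h3
    nlinarith
  exact le_of_sq_le_sq h2 (by positivity)

end DiffAlg

end

noncomputable section

namespace DiffAlg

variable {B E : Type*} [NonUnitalCStarAlgebra B] [PartialOrder B] [StarOrderedRing B]
  [NormedAddCommGroup E] [NormedSpace ℂ E] [SMul B E] [CStarModule B E] [CompleteSpace E]
variable {γ : ModuleGrading B E} {D : E →ₗ.[ℂ] E} {𝒜 : NonUnitalSubalgebra ℂ (E →L[ℂ] E)}

/-! ### From a strictly positive element to a complete multiplier -/

/-- The inclusion of `𝒜` into `End*_B(E)`. -/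
def IsDifferentiableAlgebra.inclusion (hA : IsDifferentiableAlgebra γ D 𝒜) :
    𝒜 →ₙₐ[ℂ] EndStar B E where
  toFun a := ⟨a, (hA.mem_lip a a.2).1⟩
  map_smul' _ _ := rfl
  map_zero' := rfl
  map_add' _ _ := rfl
  map_mul' _ _ := rfl

lemma nonneg_of_spectrum_re_nonneg {A : Type*} [CStarAlgebra A] [PartialOrder A]
    [StarOrderedRing A] {a : A} (ha : IsSelfAdjoint a) (h : ∀ z ∈ spectrum ℂ a, 0 ≤ z.re) :
    0 ≤ a :=
  (StarOrderedRing.nonneg_iff_spectrum_nonneg (R := ℝ) a ha).2 fun t ht => by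
    simpa using h _ (spectrum.algebraMap_mem ℂ ht)

/-- The inclusion into `End*_B(E)` can only shrink the quasispectrum, so positivity of the spectrum
in `𝒜` passes to the C*-algebra. -/
lemma IsStrictlyPositive.isPos (hA : IsDifferentiableAlgebra γ D 𝒜) {h : 𝒜}
    (hh : IsStrictlyPositive γ D 𝒜 h) : IsPos B (h : E →L[ℂ] E) := by
  have hsa : IsSelfAdjoint (hA.inclusion h) := Subtype.ext hh.1
  have key : 0 ≤ hA.inclusion h := nonneg_of_spectrum_re_nonneg hsa fun z hz =>
    (hh.2.1 z (NonUnitalAlgHom.quasispectrum_apply_subset hA.inclusion h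
      (spectrum_subset_quasispectrum ℂ _ hz))).1
  exact nonneg_iff_isPos.1 key

variable (𝒜) in
/-- The graph of `h⁻¹`, as an unbounded multiplier of `𝒜`. -/
def inverseGraph (h : E →L[ℂ] E) : Submodule ℂ ((E →L[ℂ] E) × (E →L[ℂ] E)) :=
  𝒜.toSubmodule.map ((LinearMap.mulLeft ℂ h).prod LinearMap.id)

lemma mem_inverseGraph {h a b : E →L[ℂ] E} :
    (a, b) ∈ inverseGraph 𝒜 h ↔ b ∈ 𝒜 ∧ a = h * b := by
  constructor
  · rintro ⟨c, hc, h⟩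
    obtain ⟨rfl, rfl⟩ := Prod.mk.inj h
    exact ⟨hc, rfl⟩
  · rintro ⟨hb, rfl⟩
    exact ⟨b, hb, rfl⟩

lemma inverseGraph_graph_eq {h : E →L[ℂ] E} (hinj : Function.Injective h) :
    (inverseGraph 𝒜 h).toLinearPMap.graph = inverseGraph 𝒜 h := by
  refine Submodule.toLinearPMap_graph_eq _ ?_
  rintro ⟨a, b⟩ hab (rfl : a = 0)
  obtain ⟨-, hb⟩ := mem_inverseGraph.1 hab
  ext x
  refine hinj ?_
  rw [zero_apply, map_zero]
  exact (congrArg (fun T : E →L[ℂ] E => T x) hb).symm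

lemma IsPos.adj_eq {a : E →L[ℂ] E} (ha : IsPos B a) : adj B a = a :=
  congrArg Subtype.val (isSelfAdjoint_of_isPos (T := ⟨a, ha.1⟩) ha).star_eq

lemma IsPos.pair {a : E →L[ℂ] E} (ha : IsPos B a) : IsAdjointPair B a a := by
  have := ha.1.pair
  rwa [ha.adj_eq] at this

lemma exists_inverse_one_add_I_smul (hsa : IsSelfAdjointOp B D)
    (hA : IsDifferentiableAlgebra γ D 𝒜) {h : E →L[ℂ] E} (hh : h ∈ 𝒜) (hhsa : adj B h = h) {s : ℂ}
    (hs : s = Complex.I ∨ s = -Complex.I) :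
    ∃ y ∈ 𝒜, (1 + s • h) * (1 + y) = 1 ∧ (1 + y) * (1 + s • h) = 1 := by
  refine exists_inverse_of_isUnit hsa hA hh hhsa ?_
  have hadj := (hA.mem_lip h hh).1
  have hss : s * s = -1 := by rcases hs with rfl | rfl <;> simp
  have h1 : s ∉ spectrum ℂ (⟨h, hadj⟩ : EndStar B E) := fun h => by
    have := (isSelfAdjoint_mk hadj hhsa).im_eq_zero_of_mem_spectrum h
    rcases hs with rfl | rfl <;> simp at this
  have h2 := isUnit_coe (spectrum.notMem_iff.1 h1)
  have hs0 : -s ≠ 0 := by rintro h; simp [neg_eq_zero.1 h] at hss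
  -- Since `s² = -1`, invertibility of `1 + s h` amounts to `s` not being in the real spectrum of
  -- `h`.
  have e : 1 + s • h
      = (-s) • ((algebraMap ℂ (EndStar B E) s - ⟨h, hadj⟩ : EndStar B E) : E →L[ℂ] E) := by
    rw [AddSubgroupClass.coe_sub, Subalgebra.coe_algebraMap, Algebra.algebraMap_eq_smul_one,
      smul_sub, smul_smul, neg_mul, hss, neg_neg, one_smul, neg_smul, sub_neg_eq_add]
  rw [e]
  exact (IsUnit.smul (Units.mk0 (-s) hs0) h2 :)

/-- Here `1 + y = (1 + s h)⁻¹`, and `(h⁻¹ + s)⁻¹ = h (1 + s h)⁻¹`. -/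
lemma isInverseAt_inverseGraph {h y : E →L[ℂ] E} {s : ℂ} (hinj : Function.Injective h)
    (hy : y ∈ 𝒜) (hy1 : (1 + s • h) * (1 + y) = 1) (hy2 : (1 + y) * (1 + s • h) = 1) :
    IsInverseAt 𝒜 (inverseGraph 𝒜 h).toLinearPMap s (fun a => h * (1 + y) * a) := by
  refine ⟨fun a ha => ?_, fun a b hab => ?_⟩
  · rw [inverseGraph_graph_eq hinj, mem_inverseGraph]
    have e : a - s • (h * (1 + y) * a) = (1 + y) * a := by
      have h1 : (1 + y) + s • (h * (1 + y)) = 1 := by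
        rw [← smul_mul_assoc, ← one_add_mul (s • h), hy1]
      rw [sub_eq_iff_eq_add, ← smul_mul_assoc, ← add_mul, h1, one_mul]
    rw [e]
    exact ⟨one_add_mul_mem ha hy, mul_assoc _ _ _⟩
  · rw [inverseGraph_graph_eq hinj, mem_inverseGraph] at hab
    obtain ⟨-, rfl⟩ := hab
    have e : b + s • (h * b) = (1 + s • h) * b := by rw [add_mul, one_mul, smul_mul_assoc]
    change h * (1 + y) * (b + s • (h * b)) = h * b
    rw [e, ← mul_assoc, mul_assoc h, hy2, mul_one]

lemma isSelfAdjointMultiplier_inverseGraph (hsa : IsSelfAdjointOp B D)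
    (hA : IsDifferentiableAlgebra γ D 𝒜) {h : 𝒜} (hh : IsStrictlyPositive γ D 𝒜 h)
    (hinj : Function.Injective (h : E →L[ℂ] E)) :
    IsSelfAdjointMultiplier γ D 𝒜 (inverseGraph 𝒜 (h : E →L[ℂ] E)).toLinearPMap where
  dense := by
    have e : ((inverseGraph 𝒜 (h : E →L[ℂ] E)).toLinearPMap.domain : Set (E →L[ℂ] E))
        = {b | ∃ a ∈ 𝒜, b = (h : E →L[ℂ] E) * a} := by
      ext b
      rw [SetLike.mem_coe, LinearPMap.mem_domain_iff, inverseGraph_graph_eq hinj]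
      simp only [mem_inverseGraph]; rfl
    rw [e]
    exact hh.2.2
  maps a b hab := by
    rw [inverseGraph_graph_eq hinj, mem_inverseGraph] at hab
    exact hab.1
  mul a ca hab b hb := by
    rw [inverseGraph_graph_eq hinj, mem_inverseGraph] at hab ⊢
    exact ⟨𝒜.mul_mem hab.1 hb, by rw [hab.2, mul_assoc]⟩
  closed a ca a' b' _ hb' hg ha hca := by
    rw [inverseGraph_graph_eq hinj, mem_inverseGraph]
    refine ⟨hb', ?_⟩
    have h1 : Tendsto a atTop (𝓝 a') := tendsto_iff_norm_sub_tendsto_zero.2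
      (squeeze_zero (fun _ => norm_nonneg _) (fun _ => norm_le_lipNorm γ D _) ha)
    have h2 : Tendsto ca atTop (𝓝 b') := tendsto_iff_norm_sub_tendsto_zero.2
      (squeeze_zero (fun _ => norm_nonneg _) (fun _ => norm_le_lipNorm γ D _) hca)
    refine tendsto_nhds_unique h1 ((h2.const_mul (h : E →L[ℂ] E)).congr fun n => ?_)
    have := hg n
    rw [inverseGraph_graph_eq hinj, mem_inverseGraph] at this
    exact this.2.symm
  symmetric a ca b cb hab hab' := by
    rw [inverseGraph_graph_eq hinj, mem_inverseGraph] at hab hab'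
    rw [hab.2, hab'.2, adj_mul (hA.mem_lip h h.2).1 (hA.mem_lip ca hab.1).1, hh.1, mul_assoc]
  resolvent s hs := by
    obtain ⟨y, hy, hy1, hy2⟩ := exists_inverse_one_add_I_smul hsa hA h.2 hh.1 hs
    exact ⟨_, isInverseAt_inverseGraph hinj hy hy1 hy2,
      inMultiplierAlgebra_mul hsa (mul_one_add_mem h.2 hy)⟩

lemma smul_isPos_sub_form {X h : E →L[ℂ] E} (hh : IsAdjointPair B h h) {C : ℝ}
    (hX : IsPos B ((C : ℂ) • (h * h) - X)) (x : E) :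
    0 ≤ C • inner B (h x) (h x) - inner B x (X x) := by
  have := hX.2 x
  simpa [hh x, ← Complex.coe_smul] using this

lemma isCompleteAt_inverseGraph (hsa : IsSelfAdjointOp B D)
    (hA : IsDifferentiableAlgebra γ D 𝒜) {h : 𝒜} (hh : IsStrictlyPositive γ D 𝒜 h)
    (hev : γ.IsEven (h : E →L[ℂ] E)) (hd : DenseRange (h : E →L[ℂ] E))
    (hinj : Function.Injective (h : E →L[ℂ] E)) {C : ℝ} (hC : 0 < C)
    (h1 : IsPos B ((C : ℂ) • (h * h : E →L[ℂ] E) - Complex.I • comm γ D h))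
    (h2 : IsPos B ((C : ℂ) • (h * h : E →L[ℂ] E) + Complex.I • comm γ D h))
    {s : ℂ} (hs : s = Complex.I ∨ s = -Complex.I)
    (him : imResolventMul D s (h : E →L[ℂ] E) = imMulResolvent D s h) :
    IsCompleteAt D 𝒜 (inverseGraph 𝒜 (h : E →L[ℂ] E)).toLinearPMap s := by
  obtain ⟨y, hy, hy1, hy2⟩ := exists_inverse_one_add_I_smul hsa hA h.2 hh.1 hs
  have hl := hA.mem_lip h h.2
  have hpair : IsAdjointPair B (h : E →L[ℂ] E) h := by
    have := hl.1.pair; rwa [hh.1] at this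
  set t : E →L[ℂ] E := (h : E →L[ℂ] E) with ht
  set m : E →L[ℂ] E := 1 + y
  have hm : m ∈ Lip γ D := hA.one_add_mem_lip hy
  have hm' : 1 + s • t ∈ Lip γ D := hA.one_add_mem_lip (𝒜.smul_mem s h.2)
  -- The operator induced on `E` is `h⁻¹`, whichever resolvent is used to describe it.
  have haff : ∀ z : E, (t z, z) ∈ affiliatedGraph s (t * m) := fun z => by
    have e : (t * m) ((1 + s • t) z) = t z := by
      change t ((m * (1 + s • t)) z) = t z
      rw [hy2]; rfl
    refine ⟨(1 + s • t) z, e.symm, ?_⟩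
    rw [e]
    simp
  refine ⟨t * m, mul_one_add_mem h.2 hy, isInverseAt_inverseGraph hinj hy hy1 hy2, ?_,
    2 * (3 * C), ?_⟩
  · rw [imResolventMul_mul hy2, imMulResolvent_mul hm hm' hy2, him]
  · intro x hx
    rw [imResolventMul_mul hy2] at hx
    have hx' := him ▸ hx
    obtain ⟨e, v, hv, hve⟩ := mem_imResolventMul.1 hx
    obtain ⟨z, w, hzw, rfl⟩ := mem_imMulResolvent.1 hx'
    have hv' : v = t (e - s • z) := by
      rw [map_sub, map_smul, ← hve, add_sub_cancel_right]
    subst hv'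
    refine ⟨z, w, t (e - s • z), e - s • z, haff z, hzw, hv, haff _, ?_⟩
    have hc := graph_unique hv (comm_isComm hl z w hzw)
    rw [show γ.gr t = t from hev] at hc
    -- At `x = h z` the vector `δ = D c x - c D x` satisfies `h δ = -[D, h] z`. Hence `⟨h u, δ⟩ =
    -- -⟨u, [D, h] z⟩`, which the form bounds control by `3 C (‖h u‖² + ‖h z‖²)`.
    have hδ : t (w - (e - s • z)) = - comm γ D t z := by
      rw [map_sub, hc]; abel
    refine (norm_le_of_norm_inner_le (B := B) hd (C := 3 * C) (by positivity) (norm_nonneg (t z))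
      fun u => ?_)
    rw [hpair, hδ]
    have hform := norm_inner_le_of_form_bounds (B := B) (X := Complex.I • comm γ D t) (h := t) hC.le
      (smul_isPos_sub_form hpair h1) (fun x => by
        have := smul_isPos_sub_form (X := -(Complex.I • comm γ D t)) hpair
          (by rwa [sub_neg_eq_add]) x
        simpa using this) u z
    simpa [norm_smul] using hform

theorem hasCompleteMultiplier_of_hasGoodPositiveElementTwoSided (hsa : IsSelfAdjointOp B D)
    (hA : IsDifferentiableAlgebra γ D 𝒜) (hess : IsEssential 𝒜)
    (H : HasGoodPositiveElementTwoSided γ D 𝒜) : HasCompleteMultiplier γ D 𝒜 := by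
  obtain ⟨h, hh, hev, him, C, hC, h1, h2⟩ := H
  have hpos := hh.isPos hA
  have hd : DenseRange (h : E →L[ℂ] E) := hess.denseRange hh.2.2
  have hinj := injective_of_denseRange hpos.pair hd
  refine ⟨_, isSelfAdjointMultiplier_inverseGraph hsa hA hh hinj, ?_, ?_, fun s hs =>
    isCompleteAt_inverseGraph hsa hA hh hev hd hinj hC h1 h2 hs (him s hs)⟩
  · intro a ca hab
    rw [inverseGraph_graph_eq hinj, mem_inverseGraph] at hab
    obtain ⟨hca, rfl⟩ := hab
    have hcl := (hA.mem_lip ca hca).1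
    refine ⟨(hcl.pair.symm.mul (hpos.pair.mul hcl.pair)).isAdjointable, fun x => ?_⟩
    rw [mul_apply_eq_comp, ← hcl.pair]
    exact hpos.2 (ca x)
  · intro a ca hab
    rw [inverseGraph_graph_eq hinj, mem_inverseGraph] at hab ⊢
    obtain ⟨hca, rfl⟩ := hab
    exact ⟨hA.gr_mem _ hca, by rw [γ.gr_mul, show γ.gr h = h from hev]⟩

/-- The grading preserves positivity and fixes `h`, while oddness of `D` gives `γ([D, h]) = -[D,
h]`. -/
lemma HasGoodPositiveElement.twoSided (hsa : IsSelfAdjointOp B D)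
    (hA : IsDifferentiableAlgebra γ D 𝒜) (hD : γ.IsOdd D) (H : HasGoodPositiveElement γ D 𝒜) :
    HasGoodPositiveElementTwoSided γ D 𝒜 := by
  obtain ⟨h, hh, hev, him, C, hC, h1⟩ := H
  refine ⟨h, hh, hev, him, C, hC, h1, ?_⟩
  have hl := hA.mem_lip h h.2
  have hc := comm_eq hsa (gr_mem_lip (.inl hD) hl) ((comm_isComm hl).gr_of_isOdd hD)
  rw [show γ.gr h = h from hev] at hc
  have h2 := h1.gr γ
  rwa [γ.gr_sub, γ.gr_smul, γ.gr_smul, γ.gr_mul, show γ.gr h = h from hev,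
    ← neg_neg (γ.gr (comm γ D h)), ← hc, smul_neg, sub_neg_eq_add] at h2

end DiffAlg

end

noncomputable section

namespace DiffAlg

/-! ### Resolvents of a positive operator in terms of its bounded transforms

If `p = (1 + c²)⁻¹` and `q = c (1 + c²)⁻¹` for a positive `c`, then
`(n + c)⁻¹ = (q + p) (1 + (n - 1) p + (n + 1) q)⁻¹` and `(c + i)⁻¹ = q - i p`. -/

section BoundedTransform

variable {R : Type*} [Ring R] [Algebra ℂ R] {p q Z : R} {k : ℂ}

/-- With `k = n - 1`, the inverted element is `(c + 1)(c + n)(1 + c²)⁻¹` and `q + p = (c + 1)(1 +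
c²)⁻¹`, so `(q + p) Z = (n + c)⁻¹`. The claim is the resolvent identity for `(n + c)⁻¹` and `(c +
i)⁻¹`. The extra factor `c + 1` makes the element to be inverted `1` plus a positive combination of
`p` and `q`. -/
lemma resolvent_identity_right (hpq : q * p = p * q) (hp : p = p * p + q * q)
    (hZ : (1 + k • p + (k + 2) • q) * Z = 1) :
    (q + p) * Z + (k + 1 - Complex.I) • ((q - Complex.I • p) * ((q + p) * Z))
      = q - Complex.I • p := by
  have hqq : q * q = p - p * p := by rw [eq_sub_iff_add_eq, add_comm]; exact hp.symm
  have e : (q + p) + (k + 1 - Complex.I) • ((q - Complex.I • p) * (q + p))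
      = (q - Complex.I • p) * (1 + k • p + (k + 2) • q) := by
    simp only [mul_add, sub_mul, smul_mul_assoc, mul_smul_comm, hpq, hqq, mul_one]
    match_scalars <;> ring_nf <;> simp [Complex.I_sq] <;> ring
  calc _ = ((q + p) + (k + 1 - Complex.I) • ((q - Complex.I • p) * (q + p))) * Z := by
        simp only [add_mul, smul_mul_assoc, mul_assoc]
    _ = _ := by rw [e, mul_assoc, hZ, mul_one]

lemma commute_of_inverse {a X : R} (h : Commute a X) (h1 : X * Z = 1) (h2 : Z * X = 1) :
    Commute a Z := by
  calc a * Z = Z * X * (a * Z) := by rw [h2, one_mul]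
    _ = Z * (X * a) * Z := by simp only [mul_assoc]
    _ = Z * (a * X) * Z := by rw [h.eq]
    _ = Z * a * (X * Z) := by simp only [mul_assoc]
    _ = Z * a := by rw [h1, mul_one]

lemma resolvent_identity_left (hpq : q * p = p * q) (hp : p = p * p + q * q)
    (hZ : (1 + k • p + (k + 2) • q) * Z = 1) (hZ' : Z * (1 + k • p + (k + 2) • q) = 1) :
    (q + p) * Z + (k + 1 - Complex.I) • (((q + p) * Z) * (q - Complex.I • p))
      = q - Complex.I • p := by
  have hcp : Commute q p := hpq
  have h1 : Commute (q - Complex.I • p) (1 + k • p + (k + 2) • q) := by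
    refine ((Commute.one_right _).add_right ?_).add_right ?_
    · exact ((hcp.sub_left ((Commute.refl p).smul_left _)).smul_right _)
    · exact (((Commute.refl q).sub_left (hcp.symm.smul_left _)).smul_right _)
  have h2 : Commute (q - Complex.I • p) (q + p) :=
    ((Commute.refl q).sub_left (hcp.symm.smul_left _)).add_right
      (hcp.sub_left ((Commute.refl p).smul_left _))
  have h3 : Commute (q - Complex.I • p) ((q + p) * Z) :=
    h2.mul_right (commute_of_inverse h1 hZ hZ')
  rw [← h3.eq]
  exact resolvent_identity_right hpq hp hZ

end BoundedTransform

/-! ### Order properties of the approximate unit `n (n + c)⁻¹`. -/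

section CStar

variable {A : Type*} [CStarAlgebra A] [PartialOrder A] [StarOrderedRing A] {p q : A} {Z : ℕ → A}

lemma natCast_smul_nonneg {a : A} (ha : 0 ≤ a) (k : ℕ) : 0 ≤ (k : ℂ) • a := by
  rw [Nat.cast_smul_eq_nsmul ℂ]
  exact nsmul_nonneg ha k

/-- The approximate unit `n (n + c)⁻¹`, `n ≥ 1`. -/
lemma boundedTransform_approximateUnit (h0p : 0 ≤ p) (h0q : 0 ≤ q) (hpq : q * p = p * q)
    (hp : p = p * p + q * q) (hZ : ∀ k : ℕ, (1 + (k : ℂ) • p + ((k : ℂ) + 2) • q) * Z k = 1)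
    (hZ' : ∀ k : ℕ, Z k * (1 + (k : ℂ) • p + ((k : ℂ) + 2) • q) = 1) :
    (∀ k : ℕ, 0 ≤ ((k : ℂ) + 1) • ((q + p) * Z k)) ∧
    (∀ k : ℕ, ‖((k : ℂ) + 1) • ((q + p) * Z k)‖ ≤ 1) ∧
    (∀ k : ℕ, 0 ≤ ((k + 1 : ℕ) + 1 : ℂ) • ((q + p) * Z (k + 1)) - ((k : ℂ) + 1) • ((q + p) * Z k)) ∧
    (∀ j k : ℕ, Commute ((q + p) * Z j) ((q + p) * Z k)) := by
  have hcp : Commute q p := hpq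
  set X : ℕ → A := fun k => 1 + (k : ℂ) • p + ((k : ℂ) + 2) • q with hX
  have hXc : ∀ a, Commute a p → Commute a q → ∀ k, Commute a (X k) := fun a h1 h2 k =>
    ((Commute.one_right _).add_right (h1.smul_right _)).add_right (h2.smul_right _)
  have hZc : ∀ a, Commute a p → Commute a q → ∀ k, Commute a (Z k) := fun a h1 h2 k =>
    commute_of_inverse (hXc a h1 h2 k) (hZ k) (hZ' k)
  have hpZ : ∀ k, Commute p (Z k) := hZc p (Commute.refl p) hcp.symm
  have hqZ : ∀ k, Commute q (Z k) := hZc q hcp (Commute.refl q)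
  have hZZ : ∀ j k, Commute (Z j) (Z k) := fun j k => hZc _ (hpZ j).symm (hqZ j).symm k
  have hX1 : ∀ k, 1 ≤ X k := fun k => by
    have h1 : 0 ≤ ((k : ℂ) + 2) • q := by
      have := natCast_smul_nonneg h0q (k + 2); simpa using this
    have := add_nonneg (natCast_smul_nonneg h0p k) h1
    simp only [hX, add_assoc]
    exact le_add_of_nonneg_right this
  have hXle : ∀ k, X k ≤ X (k + 1) := fun k => by
    have : X (k + 1) = X k + (p + q) := by
      simp only [hX, Nat.cast_add, Nat.cast_one]; module
    rw [this]
    exact le_add_of_nonneg_right (add_nonneg h0p h0q)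
  let U : ℕ → Aˣ := fun k => ⟨X k, Z k, hZ k, hZ' k⟩
  have hX0 : ∀ k, 0 ≤ X k := fun k => zero_le_one.trans (hX1 k)
  have hZ0 : ∀ k, 0 ≤ Z k := fun k => CFC.inv_nonneg_of_nonneg (U k) (hX0 k)
  have hZle : ∀ k, Z (k + 1) ≤ Z k := fun k =>
    CStarAlgebra.inv_le_inv (a := U k) (b := U (k + 1)) (hX0 k) (hXle k)
  have hpsa := (IsSelfAdjoint.of_nonneg h0p)
  have hqsa := (IsSelfAdjoint.of_nonneg h0q)
  have h1p : 0 ≤ 1 - p := by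
    -- A sum of squares, obtained from `q² = p - p²`.
    have e : 1 - p = (1 - p) * (1 - p) + q * q := by
      have hqq : q * q = p - p * p := by rw [eq_sub_iff_add_eq, add_comm]; exact hp.symm
      rw [hqq]; simp only [sub_mul, mul_sub, mul_one, one_mul]; abel
    rw [e]
    have h1 : 0 ≤ star (1 - p) * (1 - p) := star_mul_self_nonneg _
    have h2 : 0 ≤ star q * q := star_mul_self_nonneg _
    rw [star_sub, star_one, hpsa.star_eq] at h1
    rw [hqsa.star_eq] at h2
    exact add_nonneg h1 h2
  have hy : 0 ≤ 1 - p + q := add_nonneg h1p h0q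
  have hyZ : ∀ k, Commute (1 - p + q) (Z k) := fun k =>
    ((Commute.one_left _).sub_left (hpZ k)).add_left (hqZ k)
  -- This is `1 - n (n + c)⁻¹ = c (n + c)⁻¹` with `n = k + 1`, since `1 - p + q = c (c + 1)(1 +
  -- c²)⁻¹`. All dependence on `k` is now in `Z k`, which is decreasing, so the approximate unit
  -- increases and is bounded by `1`.
  have hone : ∀ k : ℕ, ((k : ℂ) + 1) • ((q + p) * Z k) = 1 - (1 - p + q) * Z k := fun k => by
    have : (1 - p + q) + ((k : ℂ) + 1) • (q + p) = X k := by simp only [hX]; module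
    rw [eq_sub_iff_add_eq, add_comm, ← smul_mul_assoc, ← add_mul, this, hZ]
  have hpos : ∀ k : ℕ, 0 ≤ ((k : ℂ) + 1) • ((q + p) * Z k) := fun k => by
    have := natCast_smul_nonneg (Commute.mul_nonneg (add_nonneg h0q h0p) (hZ0 k)
      ((hqZ k).add_left (hpZ k))) (k + 1)
    simpa using this
  refine ⟨hpos, fun k => ?_, fun k => ?_, fun j k => ?_⟩
  · rw [CStarAlgebra.norm_le_one_iff_of_nonneg _ (hpos k), hone k]
    exact sub_le_self _ (Commute.mul_nonneg hy (hZ0 k) (hyZ k))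
  · have h1 := hone (k + 1)
    rw [h1, hone k, sub_sub_sub_cancel_left, ← mul_sub]
    exact Commute.mul_nonneg hy (sub_nonneg.2 (hZle k)) ((hyZ k).sub_right (hyZ (k + 1)))
  · have h1 : Commute (q + p) (Z k) := (hqZ k).add_left (hpZ k)
    have h2 : Commute (q + p) (Z j) := (hqZ j).add_left (hpZ j)
    exact ((Commute.refl _).mul_right h1).mul_left ((h2.symm).mul_right (hZZ j k))

end CStar

end DiffAlg

end

noncomputable section

namespace DiffAlg

variable {B E : Type*} [NonUnitalCStarAlgebra B] [PartialOrder B] [StarOrderedRing B]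
  [NormedAddCommGroup E] [NormedSpace ℂ E] [SMul B E] [CStarModule B E] [CompleteSpace E]
variable {γ : ModuleGrading B E} {D : E →ₗ.[ℂ] E} {𝒜 : NonUnitalSubalgebra ℂ (E →L[ℂ] E)}
variable {c : (E →L[ℂ] E) →ₗ.[ℂ] (E →L[ℂ] E)} {r r' : E →L[ℂ] E}

/-! ### From a complete multiplier to an approximate unit -/

lemma adj_adj {a : E →L[ℂ] E} (ha : IsAdjointable B a) : adj B (adj B a) = a :=
  ha.pair.symm.adj_eq

lemma IsEssential.ext_left (hA : IsDifferentiableAlgebra γ D 𝒜) (hess : IsEssential 𝒜)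
    {S T : E →L[ℂ] E} (hS : IsAdjointable B S) (hT : IsAdjointable B T)
    (h : ∀ a ∈ 𝒜, a * S = a * T) : S = T := by
  have key : adj B S = adj B T := hess.ext fun a ha => by
    have ha' := (hA.mem_lip a ha).1
    have h1 := congrArg (adj B) (h _ (hA.adj_mem a ha))
    rwa [adj_mul ha'.pair.symm.isAdjointable hS, adj_mul ha'.pair.symm.isAdjointable hT,
      adj_adj ha'] at h1
  rw [← adj_adj hS, key, adj_adj hT]

/-- The range of the resolvent contains `Dom c`. -/
lemma lipDense_of_isInverseAt (hc : IsSelfAdjointMultiplier γ D 𝒜 c) (hr : r ∈ 𝒜) {s : ℂ}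
    (hinv : IsInverseAt 𝒜 c s (fun a => r * a)) :
    LipDense γ D 𝒜 {b | ∃ a ∈ 𝒜, b = r * a} := by
  refine ⟨fun b ⟨a, ha, hb⟩ => hb ▸ 𝒜.mul_mem hr ha, fun a ha ε hε => ?_⟩
  obtain ⟨b, hb, hlt⟩ := hc.dense.2 a ha ε hε
  obtain ⟨d, hd⟩ := LinearPMap.mem_domain_iff.1 hb
  exact ⟨b, ⟨d + s • b, 𝒜.add_mem (hc.maps _ _ hd) (𝒜.smul_mem s (hc.dense.1 hb)),
    (hinv.2 _ _ hd).symm⟩, hlt⟩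

/-- Symmetry of `c` is tested on `r a*` and `r' b`, for which `c (r a*) = a* - i r a*` and `c (r' b)
= b + i r' b`; after cancellation `a r* b = a r' b`. -/
lemma adj_resolvent (hA : IsDifferentiableAlgebra γ D 𝒜) (hess : IsEssential 𝒜)
    (hc : IsSelfAdjointMultiplier γ D 𝒜 c) (hr : r ∈ 𝒜) (hr' : r' ∈ 𝒜)
    (hinv : IsInverseAt 𝒜 c Complex.I (fun a => r * a))
    (hinv' : IsInverseAt 𝒜 c (-Complex.I) (fun a => r' * a)) : adj B r = r' := by
  have hl := (hA.mem_lip r hr).1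
  have hl' := (hA.mem_lip r' hr').1
  refine hess.ext_left hA hl.pair.symm.isAdjointable hl' fun a ha => ?_
  refine hess.ext fun b hb => ?_
  have ha' := (hA.mem_lip a ha).1
  have haa := hA.adj_mem a ha
  have hla := ha'.pair.symm.isAdjointable
  have h := hc.symmetric _ _ _ _ (hinv.1 _ haa) (hinv'.1 b hb)
  have hp := ((hl.pair.mul hla.pair).smul Complex.I).neg
  have e : adj B (adj B a - Complex.I • (r * adj B a)) = a + Complex.I • (a * adj B r) := by
    rw [sub_eq_add_neg, (hla.pair.add hp).adj_eq, adj_adj ha']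
    simp
  rw [e, adj_mul hl hla, adj_adj ha'] at h
  simp only [add_mul, smul_mul_assoc, neg_smul, sub_neg_eq_add, mul_add, mul_smul_comm,
    ← mul_assoc] at h
  exact (add_right_cancel h).symm

lemma resolvent_sub (hess : IsEssential 𝒜) {s : ℂ}
    (hinv : IsInverseAt 𝒜 c s (fun a => r * a))
    (hinv' : IsInverseAt 𝒜 c (-s) (fun a => r' * a)) : r + (2 * s) • (r * r') = r' := by
  refine hess.ext fun a ha => ?_
  have h := hinv.2 _ _ (hinv'.1 a ha)
  simp only at h
  rw [← h]
  simp only [mul_add, add_mul, smul_mul_assoc, neg_smul, sub_neg_eq_add, mul_smul_comm, mul_assoc]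
  module

/-- The commutator of a complete multiplier: `[D, r] z = r δ` with `‖δ‖ ≤ M ‖r z‖`. -/
lemma exists_comm_eq_of_isCompleteAt {s : ℂ} {M : ℝ} (hr : r ∈ Lip γ D) (hev : γ.gr r = r)
    (hinj : Function.Injective r) (him : imResolventMul D s r = imMulResolvent D s r)
    (hM : ∀ x ∈ imResolventMul D s r, ∃ cx Dcx Dx cDx,
      (x, cx) ∈ affiliatedGraph s r ∧ (cx, Dcx) ∈ D.graph ∧
      (x, Dx) ∈ D.graph ∧ (Dx, cDx) ∈ affiliatedGraph s r ∧ ‖Dcx - cDx‖ ≤ M * ‖x‖)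
    {z w : E} (hz : (z, w) ∈ D.graph) :
    ∃ δ, comm γ D r z = r δ ∧ ‖δ‖ ≤ M * ‖r z‖ := by
  have hx : r z ∈ imResolventMul D s r := by
    rw [him]; exact mem_imMulResolvent.2 ⟨z, w, hz, rfl⟩
  obtain ⟨cx, Dcx, Dx, cDx, ⟨e, he, rfl⟩, hDcx, hDx, ⟨f, hf, rfl⟩, hle⟩ := hM _ hx
  simp only at he hf hDcx hle
  obtain rfl : z = e := hinj he
  have h1 := graph_unique hDcx (graph_sub hz (graph_smul s hDx))
  have h2 := graph_unique hDx (comm_isComm hr z w hz)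
  rw [hev] at h2
  subst h1 hf
  -- At `x = r z` one has `c x = z - s x`, so the terms in `s` cancel in `D c x - c D x = w - f`,
  -- where `D (r z) = r f`.
  refine ⟨f - w, ?_, ?_⟩
  · rw [map_sub, h2]; abel
  · rw [norm_sub_rev]
    rwa [show w - s • r f - (f - s • r f) = w - f by abel] at hle

/-- `a` and `a*` have equal norms and so do their commutators; the `3` comes from `lipNorm_le`. It
turns a left approximate unit of self-adjoint elements into a right one. -/
lemma lipNorm_adj_le (hsa : IsSelfAdjointOp B D) (hD : IsHomogeneous γ D)
    (hA : IsDifferentiableAlgebra γ D 𝒜) {a : E →L[ℂ] E} (ha : a ∈ 𝒜) :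
    lipNorm γ D (adj B a) ≤ 3 * lipNorm γ D a := by
  have hl := hA.mem_lip a ha
  have h := lipNorm_le γ D (adj B a)
  rw [norm_adj hl.1, norm_comm_adj hsa hD hl (hA.mem_lip _ (hA.adj_mem a ha))] at h
  linarith [norm_le_lipNorm γ D a, norm_comm_le_lipNorm γ D a]

lemma tendsto_mul_sub_of_lipDense (hsa : IsSelfAdjointOp B D)
    (hA : IsDifferentiableAlgebra γ D 𝒜) {u : ℕ → E →L[ℂ] E} (hu : ∀ n, u n ∈ 𝒜) {M : ℝ}
    (hM : ∀ n, lipNorm γ D (u n) ≤ M) {S : Set (E →L[ℂ] E)} (hS : LipDense γ D 𝒜 S)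
    (h : ∀ b ∈ S, Tendsto (fun n => lipNorm γ D (u n * b - b)) atTop (𝓝 0)) :
    ∀ a ∈ 𝒜, Tendsto (fun n => lipNorm γ D (u n * a - a)) atTop (𝓝 0) := by
  intro a ha
  have hM0 : 0 ≤ M := (lipNorm_nonneg γ D _).trans (hM 0)
  rw [Metric.tendsto_atTop]
  intro ε hε
  obtain ⟨b, hb, hlt⟩ := hS.2 a ha (ε / (2 * (M + 1))) (by positivity)
  obtain ⟨N, hN⟩ := Metric.tendsto_atTop.1 (h b hb) (ε / 2) (by positivity)
  refine ⟨N, fun n hn => ?_⟩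
  have h1 := hN n hn
  rw [Real.dist_eq, sub_zero, abs_of_nonneg (lipNorm_nonneg γ D _)] at h1 ⊢
  have hb' := hS.1 hb
  have hab := 𝒜.sub_mem ha hb'
  have hl : ∀ x ∈ 𝒜, x ∈ Lip γ D := hA.mem_lip
  have e : u n * a - a = (u n * (a - b) - (a - b)) + (u n * b - b) := by
    rw [mul_sub]; abel
  rw [e]
  have i1 := lipNorm_add_le hsa (hl _ (𝒜.sub_mem (𝒜.mul_mem (hu n) hab) hab))
    (hl _ (𝒜.sub_mem (𝒜.mul_mem (hu n) hb') hb'))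
  have i2 := lipNorm_sub_le hsa (hl _ (𝒜.mul_mem (hu n) hab)) (hl _ hab)
  have i3 := lipNorm_mul_le hsa (hl _ (hu n)) (hl _ hab)
  have i4 : lipNorm γ D (u n) * lipNorm γ D (a - b) ≤ M * lipNorm γ D (a - b) :=
    mul_le_mul_of_nonneg_right (hM n) (lipNorm_nonneg γ D _)
  have i5 : (M + 1) * lipNorm γ D (a - b) < ε / 2 := by
    calc _ < (M + 1) * (ε / (2 * (M + 1))) := by gcongr
      _ = ε / 2 := by field_simp
  linarith

/-- The bounded transforms of a positive even self-adjoint multiplier with resolvents in `𝒜`. -/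
lemma exists_boundedTransform (hA : IsDifferentiableAlgebra γ D 𝒜)
    (hess : IsEssential 𝒜) (hc : IsSelfAdjointMultiplier γ D 𝒜 c)
    (hpos : IsPositiveMultiplier B c) (hr : r ∈ 𝒜) (hr' : r' ∈ 𝒜)
    (hinv : IsInverseAt 𝒜 c Complex.I (fun a => r * a))
    (hinv' : IsInverseAt 𝒜 c (-Complex.I) (fun a => r' * a)) :
    ∃ p ∈ 𝒜, ∃ q ∈ 𝒜, IsPos B p ∧ IsPos B q ∧ q * p = p * q ∧ p = p * p + q * q ∧
      r = q - Complex.I • p := by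
  have hrr' := adj_resolvent hA hess hc hr hr' hinv hinv'
  have hl := (hA.mem_lip r hr).1
  have hpair : IsAdjointPair B r r' := hrr' ▸ hl.pair
  have e1 := resolvent_sub hess hinv hinv'
  have e2 := resolvent_sub hess hinv' (by rwa [neg_neg])
  have hcomm : r' * r = r * r' := by
    have h1 : r' - r = (2 * Complex.I) • (r * r') := sub_eq_iff_eq_add'.2 e1.symm
    have h2 : r' - r = (2 * Complex.I) • (r' * r) := by
      calc r' - r = r' - (r' + (2 * -Complex.I) • (r' * r)) := by rw [e2]
        _ = _ := by module
    have h3 : (2 * Complex.I) ≠ 0 := by simp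
    exact smul_right_injective _ h3 (h2.symm.trans h1)
  -- `p = (c + i)⁻¹ (c - i)⁻¹ = (1 + c²)⁻¹`, and `q = c p` is the real part of `r`.
  set p := r * r' with hp
  have hpA : p ∈ 𝒜 := 𝒜.mul_mem hr hr'
  set q := r + Complex.I • p with hq
  have hqA : q ∈ 𝒜 := 𝒜.add_mem hr (𝒜.smul_mem _ hpA)
  have hrq : r = q - Complex.I • p := by rw [hq]; abel
  have hr'q : r' = q + Complex.I • p := by
    rw [hq, ← e1]; module
  have hpr : p * r = r * p := by rw [hp, mul_assoc, hcomm]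
  have hqp : q * p = p * q := by
    rw [hq, add_mul, mul_add, hpr, smul_mul_assoc, mul_smul_comm]
  have hpp : p = p * p + q * q := by
    conv_lhs => rw [hp, hrq, hr'q]
    simp only [sub_mul, mul_add, smul_mul_assoc, mul_smul_comm, hqp]
    match_scalars <;> ring_nf
    simp [Complex.I_sq]
  have hppair : IsAdjointPair B p p := hpair.mul hpair.symm
  have hposp : IsPos B p := ⟨hppair.isAdjointable, fun x => by
    change 0 ≤ inner B x (r (r' x))
    rw [← hpair.symm]
    exact CStarModule.inner_self_nonneg⟩
  have hd : DenseRange p := by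
    have h1 := hess.denseRange (lipDense_of_isInverseAt hc hr hinv)
    have h2 := hess.denseRange (lipDense_of_isInverseAt hc hr' hinv')
    exact h1.comp h2 r.continuous
  have hqadj : IsAdjointable B q := (hA.mem_lip q hqA).1
  refine ⟨p, hpA, q, hqA, hposp, ⟨hqadj, ?_⟩, hqp, hpp, hrq⟩
  -- Positivity of the multiplier at `a = r p` reads `(c a)* a = p q p ≥ 0`, so the form of `q` is
  -- positive on the dense range of `p`.
  have key : ∀ e, 0 ≤ inner B (p e) (q (p e)) := fun e => by
    have h1 := (hpos _ _ (hinv.1 p hpA)).2 e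
    have h2 : adj B (p - Complex.I • (r * p)) = p + Complex.I • (p * r') := by
      rw [sub_eq_add_neg, (hppair.add ((hpair.mul hppair).smul Complex.I).neg).adj_eq]
      simp
    have h3 : (p + Complex.I • (p * r')) * (r * p) = p * (q * p) := by
      rw [hq, ← hcomm]
      simp only [add_mul, mul_add, smul_mul_assoc, mul_smul_comm, mul_assoc]
    rw [h2, h3] at h1
    rw [hppair]
    exact h1
  intro x
  have hcont : Continuous fun x : E => inner B x (q x) :=
    CStarModule.continuous_inner.comp (by fun_prop : Continuous fun x : E => (x, q x))
  refine closure_minimal (s := Set.range p) (t := {x | 0 ≤ inner B x (q x)}) ?_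
    (CStarAlgebra.isClosed_nonneg.preimage hcont) (hd x)
  rintro _ ⟨e, rfl⟩
  exact key e

theorem hasGoodApproxUnit_of_hasCompleteMultiplier (hsa : IsSelfAdjointOp B D)
    (hD : IsHomogeneous γ D) (hA : IsDifferentiableAlgebra γ D 𝒜) (hess : IsEssential 𝒜)
    (H : HasCompleteMultiplier γ D 𝒜) : HasGoodApproxUnit γ D 𝒜 := by
  obtain ⟨c, hc, hpos, hev, hcomp⟩ := H
  obtain ⟨r, hr, hinv, him, M, hM⟩ := hcomp Complex.I (.inl rfl)
  obtain ⟨r', hr', hinv', -⟩ := hcomp (-Complex.I) (.inr rfl)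
  have hl : ∀ x ∈ 𝒜, x ∈ Lip γ D := hA.mem_lip
  have hrr' := adj_resolvent hA hess hc hr hr' hinv hinv'
  have hinj : Function.Injective r :=
    injective_of_denseRange (B := B) (hrr' ▸ (hl r hr).1.pair.symm)
      (hess.denseRange (lipDense_of_isInverseAt hc hr' hinv'))
  -- Since `c` commutes with the grading, `γ(r)` also inverts `c + i`.
  have hgr : γ.gr r = r := hess.ext fun a ha => by
    have h1 := hinv.2 _ _ (hev _ _ (hinv.1 _ (hA.gr_mem a ha)))
    simp only [γ.gr_sub, γ.gr_smul, γ.gr_mul, γ.gr_gr, sub_add_cancel] at h1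
    exact h1.symm
  obtain ⟨p, hp, q, hq, hp0, hq0, hqp, hpp, hrpq⟩ :=
    exists_boundedTransform hA hess hc hpos hr hr' hinv hinv'
  have hX : ∀ k : ℕ, ∃ y ∈ 𝒜, (1 + (k : ℂ) • p + ((k : ℂ) + 2) • q) * (1 + y) = 1 ∧
      (1 + y) * (1 + (k : ℂ) • p + ((k : ℂ) + 2) • q) = 1 := fun k => by
    have hposX : IsPos B ((k : ℂ) • p + ((k : ℂ) + 2) • q) := by
      have h1 := natCast_smul_nonneg (nonneg_iff_isPos (T := ⟨p, hp0.1⟩) |>.2 hp0) k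
      have h2 := natCast_smul_nonneg (nonneg_iff_isPos (T := ⟨q, hq0.1⟩) |>.2 hq0) (k + 2)
      have := nonneg_iff_isPos.1 (add_nonneg h1 h2)
      simpa using this
    obtain ⟨y, hy, h1, h2⟩ := exists_inverse_one_add_of_isPos hsa hA
      (𝒜.add_mem (𝒜.smul_mem _ hp) (𝒜.smul_mem _ hq)) hposX
    exact ⟨y, hy, by rwa [add_assoc], by rwa [add_assoc]⟩
  choose y hy hy1 hy2 using hX
  set m : ℕ → E →L[ℂ] E := fun k => (q + p) * (1 + y k) with hm
  have hmA : ∀ k, m k ∈ 𝒜 := fun k => mul_one_add_mem (𝒜.add_mem hq hp) (hy k)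
  have hi1 : ∀ k : ℕ, m k + ((k : ℂ) + 1 - Complex.I) • (r * m k) = r := fun k => by
    rw [hrpq]; exact resolvent_identity_right hqp hpp (hy1 k)
  have hi2 : ∀ k : ℕ, m k + ((k : ℂ) + 1 - Complex.I) • (m k * r) = r := fun k => by
    rw [hrpq]; exact resolvent_identity_left hqp hpp (hy1 k) (hy2 k)
  -- Here `m k = (n + c)⁻¹` and `u k = n (n + c)⁻¹` with `n = k + 1`.
  set u : ℕ → E →L[ℂ] E := fun k => ((k : ℂ) + 1) • m k with hu
  have huA : ∀ k, u k ∈ 𝒜 := fun k => 𝒜.smul_mem _ (hmA k)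
  -- order properties, in the C*-algebra of adjointable operators
  obtain ⟨o1, o2, o3, o4⟩ := boundedTransform_approximateUnit (A := EndStar B E)
    (p := ⟨p, hp0.1⟩) (q := ⟨q, hq0.1⟩) (Z := fun k => ⟨1 + y k, (hA.one_add_mem_lip (hy k)).1⟩)
    (nonneg_iff_isPos.2 hp0) (nonneg_iff_isPos.2 hq0) (Subtype.ext hqp) (Subtype.ext hpp)
    (fun k => Subtype.ext (hy1 k)) (fun k => Subtype.ext (hy2 k))
  have hu0 : ∀ k, IsPos B (u k) := fun k => nonneg_iff_isPos.1 (o1 k)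
  have hu1 : ∀ k, ‖u k‖ ≤ 1 := o2
  have hmono : ∀ k, IsPos B (u (k + 1) - u k) := fun k => nonneg_iff_isPos.1 (o3 k)
  have hcommute : ∀ j k, m j * m k = m k * m j := fun j k => congrArg Subtype.val (o4 j k).eq
  have hmu : ∀ k : ℕ, m k = ((k : ℂ) + 1)⁻¹ • u k := fun k => by
    rw [hu]; simp only; rw [smul_smul, inv_mul_cancel₀ (Nat.cast_add_one_ne_zero k), one_smul]
  have hninv : ∀ k : ℕ, ‖((k : ℂ) + 1)⁻¹‖ = ((k : ℝ) + 1)⁻¹ := fun k => by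
    rw [norm_inv]; congr 1; exact_mod_cast Complex.norm_natCast (k + 1)
  have hmnorm : ∀ k : ℕ, ‖m k‖ ≤ ((k : ℝ) + 1)⁻¹ := fun k => by
    rw [hmu, norm_smul, hninv]
    exact mul_le_of_le_one_right (by positivity) (hu1 k)
  -- the commutators
  have hcm : ∀ k : ℕ, ‖comm γ D (m k)‖ ≤ |M| * ((k : ℝ) + 1)⁻¹ * ((k : ℝ) + 1)⁻¹ := fun k => by
    set l : ℂ := (k : ℂ) + 1 - Complex.I
    -- `T` is the bounded operator `(c + i)(n + c)⁻¹`, so `r T = T r = m k`. Taking the commutator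
    -- of the resolvent identity gives `[D, m k] = T [D, r] T`. Completeness rewrites `[D, r] (T x)`
    -- as `r δ` with `‖δ‖ ≤ M ‖m k x‖`, whence `[D, m k] x = m k δ` and two factors `1/n` appear.
    set T : E →L[ℂ] E := 1 - l • m k with hT
    have hTl : T ∈ Lip γ D := (lipSubalgebra γ D).sub_mem one_mem_lip
      (hl _ (𝒜.smul_mem l (hmA k)))
    have hTr : T * r = m k := by
      rw [hT, sub_mul, one_mul, smul_mul_assoc]
      nth_rw 1 [← hi2 k]; abel
    have hrT : r * T = m k := by
      rw [hT, mul_sub, mul_one, mul_smul_comm]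
      nth_rw 1 [← hi1 k]; abel
    have hT1 : T * (1 + l • r) = 1 := by
      rw [mul_add, mul_one, mul_smul_comm, hTr, hT]; abel
    have hd : comm γ D (m k) = T * comm γ D r * T := by
      have h1 := congrArg (comm γ D) (hi1 k)
      rw [comm_add hsa (hl _ (hmA k)) (hl _ (𝒜.smul_mem l (𝒜.mul_mem hr (hmA k)))),
        comm_smul hsa (hl _ (𝒜.mul_mem hr (hmA k))), comm_mul hsa (hl _ hr) (hl _ (hmA k)),
        hgr] at h1
      have h2 : (1 + l • r) * comm γ D (m k) = comm γ D r * T := by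
        rw [add_mul, one_mul, smul_mul_assoc, hT, mul_sub, mul_one, mul_smul_comm]
        rw [eq_sub_iff_add_eq]
        refine Eq.trans ?_ h1
        module
      rw [mul_assoc, ← h2, ← mul_assoc, hT1, one_mul]
    refine hsa.norm_le_of_forall_graph (by positivity) fun x v hv => ?_
    obtain ⟨δ, hδ, hle⟩ := exists_comm_eq_of_isCompleteAt (hl _ hr) hgr hinj him hM
      (comm_isComm hTl x v hv)
    have e1 : comm γ D (m k) x = m k δ := by
      rw [hd, ← hTr]
      change T (comm γ D r (T x)) = T (r δ)
      rw [hδ]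
    have e2 : r (T x) = m k x := by rw [← hrT]; rfl
    rw [e1]
    rw [e2] at hle
    calc ‖m k δ‖ ≤ ‖m k‖ * ‖δ‖ := (m k).le_opNorm δ
      _ ≤ ((k : ℝ) + 1)⁻¹ * (|M| * (((k : ℝ) + 1)⁻¹ * ‖x‖)) := by
          gcongr
          · exact hmnorm k
          · calc ‖δ‖ ≤ M * ‖m k x‖ := hle
              _ ≤ |M| * ‖m k x‖ := by gcongr; exact le_abs_self M
              _ ≤ |M| * (((k : ℝ) + 1)⁻¹ * ‖x‖) := by
                  gcongr
                  exact ((m k).le_opNorm x).trans (by gcongr; exact hmnorm k)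
      _ = _ := by ring
  have hcu : ∀ k : ℕ, ‖comm γ D (u k)‖ ≤ |M| * ((k : ℝ) + 1)⁻¹ := fun k => by
    rw [hu]
    simp only
    rw [comm_smul hsa (hl _ (hmA k)), norm_smul]
    have : ‖(k : ℂ) + 1‖ = (k : ℝ) + 1 := by exact_mod_cast Complex.norm_natCast (k + 1)
    rw [this]
    calc ((k : ℝ) + 1) * ‖comm γ D (m k)‖
        ≤ ((k : ℝ) + 1) * (|M| * ((k : ℝ) + 1)⁻¹ * ((k : ℝ) + 1)⁻¹) := by gcongr; exact hcm k
      _ = _ := by field_simp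
  have hinv0 : Tendsto (fun k : ℕ => ((k : ℝ) + 1)⁻¹) atTop (𝓝 0) := by
    simpa using tendsto_one_div_add_atTop_nhds_zero_nat (𝕜 := ℝ)
  have hlip : ∀ k, lipNorm γ D (u k) ≤ 2 + |M| := fun k => by
    refine (lipNorm_le γ D _).trans ?_
    have h1 : ((k : ℝ) + 1)⁻¹ ≤ 1 := inv_le_one_of_one_le₀ (by linarith [k.cast_nonneg (α := ℝ)])
    have h2 : |M| * ((k : ℝ) + 1)⁻¹ ≤ |M| := mul_le_of_le_one_right (abs_nonneg M) h1
    linarith [hu1 k, hcu k]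
  have hleft : ∀ a ∈ 𝒜, Tendsto (fun n => lipNorm γ D (u n * a - a)) atTop (𝓝 0) := by
    refine tendsto_mul_sub_of_lipDense hsa hA huA hlip (lipDense_of_isInverseAt hc hr hinv) ?_
    rintro _ ⟨b, hb, rfl⟩
    -- `d = c (r b)`, and `n (n + c)⁻¹ - 1 = -(n + c)⁻¹ c` makes the error on `r b` of order `1/n`.
    set d := b - Complex.I • (r * b) with hd
    have hdA : d ∈ 𝒜 := 𝒜.sub_mem hb (𝒜.smul_mem _ (𝒜.mul_mem hr hb))
    have e : ∀ k : ℕ, u k * (r * b) - r * b = (-((k : ℂ) + 1)⁻¹) • (u k * d) := fun k => by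
      rw [neg_smul, ← smul_mul_assoc, ← hmu, hu, hd]
      simp only
      nth_rw 2 [← hi2 k]
      simp only [add_mul, mul_sub, smul_mul_assoc, mul_smul_comm, mul_assoc]
      module
    have hbound : ∀ k : ℕ, lipNorm γ D (u k * (r * b) - r * b)
        ≤ ((k : ℝ) + 1)⁻¹ * ((2 + |M|) * lipNorm γ D d) := fun k => by
      rw [e]
      refine (lipNorm_smul_le hsa (hl _ (𝒜.mul_mem (huA k) hdA)) _).trans ?_
      rw [norm_neg, hninv]
      gcongr
      exact (lipNorm_mul_le hsa (hl _ (huA k)) (hl _ hdA)).trans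
        (mul_le_mul_of_nonneg_right (hlip k) (lipNorm_nonneg γ D _))
    exact squeeze_zero (fun _ => lipNorm_nonneg γ D _) hbound (by simpa using hinv0.mul_const _)
  refine ⟨u, ⟨huA, ⟨_, hlip⟩, hleft, fun a ha => ?_⟩, hmono, fun j k => ?_, ?_⟩
  · have haa := hA.adj_mem a ha
    have ha' := (hl a ha).1
    have e : ∀ k, a * u k - a = adj B (u k * adj B a - adj B a) := fun k => by
      have h1 := ((hu0 k).pair.mul ha'.pair.symm).add ha'.pair.symm.neg
      rw [sub_eq_add_neg _ (adj B a), h1.adj_eq, ← sub_eq_add_neg]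
    have h3 : Tendsto (fun n => 3 * lipNorm γ D (u n * adj B a - adj B a)) atTop (𝓝 0) := by
      simpa using (hleft _ haa).const_mul 3
    refine squeeze_zero (fun _ => lipNorm_nonneg γ D _) (fun k => ?_) h3
    rw [e]
    exact lipNorm_adj_le hsa hD hA (𝒜.sub_mem (𝒜.mul_mem (huA k) haa) haa)
  · simp only [hu, smul_mul_assoc, mul_smul_comm, hcommute j k]
    rw [smul_comm]
  · exact squeeze_zero (fun _ => norm_nonneg _) hcu (by simpa using hinv0.const_mul |M|)

end DiffAlg

end

noncomputable section

namespace DiffAlg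

/-! ### From an approximate unit to a strictly positive element -/

lemma exists_fast_subsequence {F : ℕ → ℝ} {G : ℕ → ℕ → ℝ} (hF : Tendsto F atTop (𝓝 0))
    (hG : ∀ m, Tendsto (G m) atTop (𝓝 0)) :
    ∃ f : ℕ → ℕ, StrictMono f ∧ (∀ k, F (f k) ≤ (1 / 2) ^ k) ∧
      ∀ j k, j < k → G (f j) (f k) ≤ (1 / 2) ^ k := by
  have hev : ∀ k : ℕ, ∀ {H : ℕ → ℝ}, Tendsto H atTop (𝓝 0) → ∀ᶠ n in atTop, H n ≤ (1 / 2) ^ k :=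
    fun k H hH => hH.eventually (eventually_le_nhds (by positivity))
  -- Each chosen pair is an exponent and an index. The exponents increase strictly, so the `k`-th
  -- one is at least `k`.
  obtain ⟨f, hf, hr⟩ := exists_seq_of_forall_finset_exists
    (fun p : ℕ × ℕ => F p.2 ≤ (1 / 2) ^ p.1)
    (fun p q => p.1 < q.1 ∧ p.2 < q.2 ∧ G p.2 q.2 ≤ (1 / 2) ^ q.1) (fun s _ => by
      obtain ⟨K, hK⟩ : ∃ K, ∀ p ∈ s, p.1 < K :=
        ⟨s.sup Prod.fst + 1, fun p hp => Nat.lt_succ_of_le (Finset.le_sup (f := Prod.fst) hp)⟩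
      obtain ⟨n, hn, hn'⟩ := ((hev K hF).and ((Filter.eventually_all_finset s).2
        fun p _ => (eventually_gt_atTop p.2).and (hev K (hG p.2)))).exists
      exact ⟨(K, n), hn, fun p hp => ⟨hK p hp, hn' p hp⟩⟩)
  have hmono : StrictMono fun k => (f k).1 := fun j k hjk => (hr j k hjk).1
  have hle : ∀ k, (1 / 2 : ℝ) ^ (f k).1 ≤ (1 / 2) ^ k := fun k =>
    pow_le_pow_of_le_one (by norm_num) (by norm_num) (hmono.le_apply)
  exact ⟨fun k => (f k).2, fun j k hjk => (hr j k hjk).2.1, fun k => (hf k).trans (hle k),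
    fun j k hjk => (hr j k hjk).2.2.trans (hle k)⟩

/-- If `w k` and `1 - w j` are almost orthogonal for `j < k`, then the inverses of the partial sums
of `1 + ∑ w k` converge. -/
lemma exists_tendsto_inverse {R : Type*} [NormedRing R] [NormedAlgebra ℂ R] [CompleteSpace R]
    {w h : ℕ → R} {L : ℝ} (hw : ∀ k, ‖w k‖ ≤ L) (hh : ∀ N, ‖h N‖ ≤ 1)
    (h1 : ∀ N, h N * (1 + ∑ k ∈ Finset.range N, w k) = 1)
    (h2 : ∀ N, (1 + ∑ k ∈ Finset.range N, w k) * h N = 1)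
    (e1 : ∀ j k, j < k → ‖w k * (1 - w j)‖ ≤ (1 / 2) ^ k)
    (e2 : ∀ j k, j < k → ‖(1 - w j) * w k‖ ≤ (1 / 2) ^ k) :
    ∃ l, Tendsto h atTop (𝓝 l) := by
  have hL : 0 ≤ L := (norm_nonneg _).trans (hw 0)
  have bound : ∀ N, ‖h N - h (N + 1)‖
      ≤ (L + 1) ^ 2 * (1 / ((N + 1 : ℕ) : ℝ) ^ 2) + (1 / 2) ^ N := fun N => by
    set e := ∑ k ∈ Finset.range N, w N * (1 - w k) with he
    set e' := ∑ k ∈ Finset.range N, (1 - w k) * w N with he'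
    have ne : ‖e‖ ≤ N * (1 / 2) ^ N := by
      refine (norm_sum_le_of_le _ fun k hk => e1 k N (Finset.mem_range.1 hk)).trans ?_
      simp
    have ne' : ‖e'‖ ≤ N * (1 / 2) ^ N := by
      refine (norm_sum_le_of_le _ fun k hk => e2 k N (Finset.mem_range.1 hk)).trans ?_
      simp
    have hN1 : (N : ℝ) * (1 / 2) ^ N ≤ 1 := by
      rw [one_div, inv_pow, ← div_eq_mul_inv, div_le_one (by positivity)]
      exact_mod_cast N.lt_two_pow_self.le
    set t : ℝ := (N : ℝ) + 1 with ht
    have ht0 : 0 < t := by positivity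
    -- Almost orthogonality makes `w N` nearly absorb every earlier `w k`, so multiplying it by `1 +
    -- ∑ w k` is nearly multiplication by `t = N + 1`. Consequently `w N * h N` and `h N * w N` are
    -- of order `1 / t`.
    have hwc : w N * (1 + ∑ k ∈ Finset.range N, w k) = t • w N - e := by
      rw [he, ← Finset.mul_sum, Finset.sum_sub_distrib, mul_sub, mul_add]
      simp only [Finset.sum_const, Finset.card_range, mul_one, mul_smul_comm]
      rw [← Nat.cast_smul_eq_nsmul ℝ]
      module
    have hcw : (1 + ∑ k ∈ Finset.range N, w k) * w N = t • w N - e' := by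
      rw [he', ← Finset.sum_mul, Finset.sum_sub_distrib, sub_mul, add_mul]
      simp only [Finset.sum_const, Finset.card_range, one_mul, smul_mul_assoc]
      rw [← Nat.cast_smul_eq_nsmul ℝ]
      module
    have a1 : t • (w N * h N) = w N + e * h N := by
      have := congrArg (· * h N) hwc
      simp only [mul_assoc, h2, mul_one, sub_mul, smul_mul_assoc] at this
      nth_rw 2 [this]
      abel
    have a2 : t • (h N * w N) = w N + h N * e' := by
      have := congrArg (h N * ·) hcw
      simp only [← mul_assoc, h1, one_mul, mul_sub, mul_smul_comm] at this
      nth_rw 2 [this]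
      abel
    have a3 : h N - h (N + 1) = h N * w N * h (N + 1) := by
      have : h N * ((1 + ∑ k ∈ Finset.range (N + 1), w k) * h (N + 1)) = h N := by
        rw [h2, mul_one]
      rw [Finset.sum_range_succ, ← add_assoc, add_mul, mul_add, ← mul_assoc, h1, one_mul,
        ← mul_assoc] at this
      rw [sub_eq_iff_eq_add', this]
    -- This transfers the decay of `w N * h N` to `w N * h (N + 1)`.
    have a4 : w N * h (N + 1) = w N * h N - w N * h N * (w N * h (N + 1)) := by
      have := congrArg (w N * ·) a3
      simp only [mul_sub, mul_assoc] at this ⊢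
      rw [← this]
      abel
    have b1 : ‖w N * h N‖ ≤ (L + 1) / t := by
      rw [le_div_iff₀' ht0, ← abs_of_pos ht0, ← Real.norm_eq_abs, ← norm_smul, a1]
      refine (norm_add_le _ _).trans (add_le_add (hw N) ((norm_mul_le _ _).trans ?_))
      calc ‖e‖ * ‖h N‖ ≤ 1 * 1 := by gcongr; exacts [ne.trans hN1, hh N]
        _ = 1 := one_mul 1
    have b2 : ‖w N * h (N + 1)‖ ≤ (L + 1) ^ 2 / t := by
      have hb : ‖w N * h (N + 1)‖ ≤ L := (norm_mul_le _ _).trans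
        ((mul_le_mul (hw N) (hh _) (norm_nonneg _) hL).trans_eq (mul_one L))
      rw [a4]
      calc _ ≤ ‖w N * h N‖ + ‖w N * h N‖ * ‖w N * h (N + 1)‖ :=
            (norm_sub_le _ _).trans (by gcongr; exact norm_mul_le _ _)
        _ ≤ (L + 1) / t + (L + 1) / t * L := by gcongr
        _ = _ := by ring
    -- In `h N * w N * h (N + 1)` the left pair and the right pair each give one factor `1 / t`, so
    -- the differences are `O(1 / t²)` up to a geometric error, and summable.
    have a5 : t • (h N - h (N + 1)) = w N * h (N + 1) + h N * e' * h (N + 1) := by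
      rw [a3, ← smul_mul_assoc, a2, add_mul]
    have b3 : t * ‖h N - h (N + 1)‖ ≤ (L + 1) ^ 2 / t + t * (1 / 2) ^ N := by
      rw [← abs_of_pos ht0, ← Real.norm_eq_abs, ← norm_smul, a5, Real.norm_eq_abs,
        abs_of_pos ht0]
      refine (norm_add_le _ _).trans (add_le_add b2 ?_)
      calc _ ≤ ‖h N‖ * ‖e'‖ * ‖h (N + 1)‖ :=
            (norm_mul_le _ _).trans (by gcongr; exact norm_mul_le _ _)
        _ ≤ 1 * (N * (1 / 2) ^ N) * 1 := by gcongr; exacts [hh N, hh _]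
        _ ≤ t * (1 / 2) ^ N := by rw [one_mul, mul_one]; gcongr; simp [ht]
    rw [← mul_le_mul_iff_right₀ ht0]
    refine b3.trans_eq ?_
    rw [mul_add]
    congr 1
    push_cast
    rw [← ht]
    field_simp
  have hs : Summable fun N : ℕ => (L + 1) ^ 2 * (1 / ((N + 1 : ℕ) : ℝ) ^ 2) + (1 / 2) ^ N :=
    (((summable_nat_add_iff 1).2 (Real.summable_one_div_nat_pow.2 one_lt_two)).mul_left _).add
      summable_geometric_two
  refine cauchySeq_tendsto_of_complete (cauchySeq_of_dist_le_of_summable _ (fun N => ?_) hs)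
  rw [dist_eq_norm]
  exact bound N

variable {B E : Type*} [NonUnitalCStarAlgebra B] [PartialOrder B] [StarOrderedRing B]
  [NormedAddCommGroup E] [NormedSpace ℂ E] [SMul B E] [CStarModule B E] [CompleteSpace E]
variable {γ : ModuleGrading B E} {D : E →ₗ.[ℂ] E} {𝒜 : NonUnitalSubalgebra ℂ (E →L[ℂ] E)}

lemma mem_of_isClosed_of_norm_sub {X : Type*} [NormedAddCommGroup X] {S : Set X}
    (hS : IsClosed S) {f : ℕ → X} (hf : ∀ n, f n ∈ S) {T : X} {b : ℕ → ℝ}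
    (hb : Tendsto b atTop (𝓝 0)) (h : ∀ n, ‖f n - T‖ ≤ b n) : T ∈ S :=
  hS.mem_of_tendsto (tendsto_iff_norm_sub_tendsto_zero.2
    (squeeze_zero (fun _ => norm_nonneg _) h hb)) (.of_forall hf)

/-- The derivation `[D, ·]` on a differentiable algebra is closed. -/
lemma IsDifferentiableAlgebra.mem_of_tendsto (hA : IsDifferentiableAlgebra γ D 𝒜)
    {a : ℕ → E →L[ℂ] E} (ha : ∀ n, a n ∈ 𝒜) {x K : E →L[ℂ] E} (hx : Tendsto a atTop (𝓝 x))
    (hK : Tendsto (fun n => comm γ D (a n)) atTop (𝓝 K)) : x ∈ 𝒜 ∧ comm γ D x = K := by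
  have hT : (lowerTriangular x K (γ.gr x) : C⋆ᵐᵒᵈ(B, E × E) →L[ℂ] C⋆ᵐᵒᵈ(B, E × E))
      ∈ piD γ D '' (𝒜 : Set (E →L[ℂ] E)) := by
    have hmem : ∀ n, piD γ D (a n) ∈ piD γ D '' (𝒜 : Set (E →L[ℂ] E)) := fun n => ⟨a n, ha n, rfl⟩
    refine mem_of_isClosed_of_norm_sub hA.isClosed hmem
      (b := fun n => ‖a n - x‖ + ‖comm γ D (a n) - K‖ + ‖γ.gr (a n) - γ.gr x‖) ?_ fun n => ?_
    · have h1 := tendsto_iff_norm_sub_tendsto_zero.1 hx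
      have h2 := tendsto_iff_norm_sub_tendsto_zero.1 hK
      have h3 := tendsto_iff_norm_sub_tendsto_zero.1 ((γ.continuous_gr.tendsto x).comp hx)
      simpa using (h1.add h2).add h3
    · refine le_of_eq_of_le (congrArg _ ?_) (norm_lowerTriangular_le _ _ _)
      rw [sub_eq_iff_eq_add]
      refine Eq.trans ?_ (lowerTriangular_add _ _ _ _ _ _)
      simp only [sub_add_cancel]
      rfl
  obtain ⟨a', ha', he⟩ := hT
  have key : ∀ y : E, a' y = x y ∧ comm γ D a' y = K y := fun y => by
    have h1 := congrArg (fun T => (WithCStarModule.equiv B (E × E))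
      (T ((WithCStarModule.equiv B (E × E)).symm (y, 0)))) he
    simpa [piD_eq, lowerTriangular_apply] using h1
  obtain rfl : a' = x := ContinuousLinearMap.ext fun y => (key y).1
  exact ⟨ha', ContinuousLinearMap.ext fun y => (key y).2⟩

/-- The resolvent of a self-adjoint regular operator as a contraction. -/
lemma exists_resolvent_clm (hsa : IsSelfAdjointOp B D) (hreg : IsRegularOp B D) {s : ℂ}
    (hs : s = Complex.I ∨ s = -Complex.I) :
    ∃ R : E →L[ℂ] E, ‖R‖ ≤ 1 ∧ ∀ e, (R e, e - s • R e) ∈ D.graph := by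
  choose r v hr hv using exists_resolvent hsa hreg hs
  have hv' : ∀ e, v e = e - s • r e := fun e => eq_sub_of_add_eq (hv e)
  have huniq : ∀ {x w e : E}, (x, w) ∈ D.graph → w + s • x = e → x = r e := fun {x w e} hx he => by
    have h := hsa.norm_le_norm_add hs (graph_sub hx (hr e))
    rw [smul_sub, show w - v e + (s • x - s • r e) = (w + s • x) - (v e + s • r e) by abel,
      he, hv, sub_self, norm_zero] at h
    exact sub_eq_zero.1 (norm_le_zero_iff.1 h)
  let R : E →ₗ[ℂ] E :=
    { toFun := r
      map_add' := fun e f => (huniq (graph_add (hr e) (hr f)) (by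
        conv_rhs => rw [← hv e, ← hv f]
        rw [smul_add]; abel)).symm
      map_smul' := fun z e => (huniq (graph_smul z (hr e)) (by
        conv_rhs => rw [← hv e]
        module)).symm }
  refine ⟨R.mkContinuous 1 fun e => ?_, R.mkContinuous_norm_le zero_le_one _, fun e => ?_⟩
  · rw [one_mul]
    exact (hsa.norm_le_norm_add hs (hr e)).trans_eq (by rw [hv])
  · have := hr e
    rw [hv'] at this
    exact this

/-- If `[D, h] = - h K h` with `K h` of norm less than one, then `h` intertwines the domain of `D`
with itself. -/
lemma imResolventMul_eq_imMulResolvent (hsa : IsSelfAdjointOp B D) (hreg : IsRegularOp B D)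
    {h K : E →L[ℂ] E} (hh : h ∈ Lip γ D) (hev : γ.gr h = h) (hcomm : comm γ D h = -(h * K * h))
    (hK : ‖K * h‖ < 1) {s : ℂ} (hs : s = Complex.I ∨ s = -Complex.I) :
    imResolventMul D s h = imMulResolvent D s h := by
  have key : ∀ y v, (y, v) ∈ D.graph → (h y, h (v - K (h y))) ∈ D.graph := fun y v hv => by
    have h1 := comm_isComm hh y v hv
    rw [hev, hcomm] at h1
    rw [map_sub, sub_eq_add_neg]
    exact h1
  ext x
  rw [mem_imResolventMul, mem_imMulResolvent]
  constructor
  · rintro ⟨e, v, hv, he⟩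
    obtain ⟨R, hR, hRg⟩ := exists_resolvent_clm hsa hreg hs
    -- With `R = (D + s)⁻¹`, the element `h (R f)` satisfies `(D + s) h R f = h (f - K h R f)`.
    -- Solving `f - K h R f = e` makes the right side `h e`, and injectivity of `D + s` gives `x = h
    -- (R f)`.
    have hu : IsUnit (1 - K * h * R) := isUnit_one_sub_of_norm_lt_one
      ((norm_mul_le _ _).trans_lt ((mul_le_of_le_one_right (norm_nonneg _) hR).trans_lt hK))
    obtain ⟨S, hS, -⟩ := isUnit_iff_exists.1 hu
    have hf : S e - K (h (R (S e))) = e := congrArg (fun T : E →L[ℂ] E => T e) hS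
    set f := S e
    have h1 := key _ _ (hRg f)
    have h2 := hsa.norm_le_norm_add hs (graph_sub hv h1)
    have h3 : v - h (f - s • R f - K (h (R f))) + s • (x - h (R f)) = 0 := by
      rw [smul_sub, show f - s • R f - K (h (R f)) = (f - K (h (R f))) - s • R f by abel, hf,
        map_sub, map_smul, ← he]
      abel
    rw [h3, norm_zero] at h2
    exact ⟨R f, _, hRg f, sub_eq_zero.1 (norm_le_zero_iff.1 h2)⟩
  · rintro ⟨y, v, hv, rfl⟩
    exact ⟨v - K (h y) + s • y, _, key y v hv, by simp⟩

/-- The inverse of `1 + c` for a positive `c` is a positive contraction. -/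
lemma isPos_and_norm_le_one_of_inverse {c h : E →L[ℂ] E} (hc : IsPos B c)
    (hh : IsAdjointable B h) (h1 : (1 + c) * h = 1) : IsPos B h ∧ ‖h‖ ≤ 1 := by
  have happ : ∀ x, h x + c (h x) = x := fun x => congrArg (fun T : E →L[ℂ] E => T x) h1
  have e : ∀ x, inner B (h x) x = inner B (h x) (h x) + inner B (h x) (c (h x)) := fun x => by
    rw [← CStarModule.inner_add_right, happ]
  refine ⟨⟨hh, fun x => ?_⟩, h.opNorm_le_bound zero_le_one fun x => ?_⟩
  · have h0 : 0 ≤ inner B (h x) x := by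
      rw [e]; exact add_nonneg CStarModule.inner_self_nonneg (hc.2 _)
    rw [← CStarModule.star_inner, (IsSelfAdjoint.of_nonneg h0).star_eq]
    exact h0
  · have h2 : ‖h x‖ ^ 2 ≤ ‖h x‖ * ‖x‖ := by
      rw [CStarModule.norm_sq_eq B]
      refine le_trans ?_ (CStarModule.norm_inner_le E (A := B))
      refine CStarAlgebra.norm_le_norm_of_nonneg_of_le CStarModule.inner_self_nonneg ?_
      rw [e]
      exact le_add_of_nonneg_right (hc.2 _)
    rw [one_mul]
    rcases (norm_nonneg (h x)).eq_or_lt with h0 | h0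
    · rw [← h0]; exact norm_nonneg _
    · rw [sq] at h2; exact le_of_mul_le_mul_left h2 h0

end DiffAlg

end

/-! ### Averaging an approximate unit over the grading. -/

noncomputable section

namespace DiffAlg

variable {B E : Type*} [NonUnitalCStarAlgebra B] [PartialOrder B] [StarOrderedRing B]
  [NormedAddCommGroup E] [NormedSpace ℂ E] [SMul B E] [CStarModule B E] [CompleteSpace E]
variable {γ : ModuleGrading B E} {D : E →ₗ.[ℂ] E} {𝒜 : NonUnitalSubalgebra ℂ (E →L[ℂ] E)}

lemma lipNorm_gr_le (hsa : IsSelfAdjointOp B D) (hD : IsHomogeneous γ D) {a : E →L[ℂ] E}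
    (ha : a ∈ Lip γ D) : lipNorm γ D (γ.gr a) ≤ 3 * lipNorm γ D a := by
  have h := lipNorm_le γ D (γ.gr a)
  rw [γ.norm_gr, norm_comm_gr hsa hD ha] at h
  linarith [norm_le_lipNorm γ D a, norm_comm_le_lipNorm γ D a]

/-- A bounded approximate unit of an essential algebra converges strongly to the identity. -/
lemma IsApproxUnit.tendsto_apply (hess : IsEssential 𝒜) {u : ℕ → E →L[ℂ] E}
    (hu : IsApproxUnit γ D 𝒜 u) (x : E) : Tendsto (fun n => u n x) atTop (𝓝 x) := by
  obtain ⟨M, hM⟩ := hu.bounded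
  have hM' : ∀ n, ‖u n‖ ≤ M := fun n => (norm_le_lipNorm γ D _).trans (hM n)
  have hM0 : 0 ≤ M := (norm_nonneg _).trans (hM' 0)
  let V : Submodule ℂ E :=
    { carrier := {x | Tendsto (fun n => u n x) atTop (𝓝 x)}
      add_mem' := fun hx hy => by simpa using Tendsto.add hx hy
      zero_mem' := by simp
      smul_mem' := fun z x hx => by simpa using Tendsto.const_smul hx z }
  refine hess.mem_of_isClosed (V := V) ?_ (fun a ha e => ?_) x
  · refine isClosed_of_closure_subset fun x hx => ?_
    change Tendsto (fun n => u n x) atTop (𝓝 x)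
    rw [Metric.tendsto_atTop]
    intro ε hε
    obtain ⟨y, hy, hxy⟩ := Metric.mem_closure_iff.1 hx (ε / (2 * (M + 1))) (by positivity)
    obtain ⟨N, hN⟩ := Metric.tendsto_atTop.1 (show Tendsto (fun n => u n y) atTop (𝓝 y) from hy)
      (ε / 2) (by positivity)
    refine ⟨N, fun n hn => ?_⟩
    have h1 := hN n hn
    rw [dist_eq_norm] at h1 hxy ⊢
    have h2 : ‖u n (x - y)‖ ≤ M * ‖x - y‖ :=
      ((u n).le_opNorm _).trans (by gcongr; exact hM' n)
    have h3 : (M + 1) * ‖x - y‖ < ε / 2 := by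
      calc _ < (M + 1) * (ε / (2 * (M + 1))) := by gcongr
        _ = ε / 2 := by field_simp
    have e : u n x - x = u n (x - y) + (u n y - y) - (x - y) := by rw [map_sub]; abel
    rw [e]
    linarith [norm_sub_le (u n (x - y) + (u n y - y)) (x - y),
      norm_add_le (u n (x - y)) (u n y - y)]
  · change Tendsto (fun n => u n (a e)) atTop (𝓝 (a e))
    rw [tendsto_iff_norm_sub_tendsto_zero]
    refine squeeze_zero (fun _ => norm_nonneg _) (fun n => ?_)
      (by simpa using (hu.left a ha).mul_const ‖e‖)
    exact ((u n * a - a).le_opNorm e).trans (by gcongr; exact norm_le_lipNorm γ D _)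

/-- For `m ≥ n` the form of `u m - u n` is positive; let `m` tend to infinity, where `u m` tends
strongly to the identity. -/
lemma IsApproxUnit.isPos_one_sub (hA : IsDifferentiableAlgebra γ D 𝒜) (hess : IsEssential 𝒜)
    {u : ℕ → E →L[ℂ] E} (hu : IsApproxUnit γ D 𝒜 u) (hmono : ∀ n, IsPos B (u (n + 1) - u n))
    (n : ℕ) : IsPos B (1 - u n) := by
  let U : ℕ → EndStar B E := fun n => ⟨u n, (hA.mem_lip _ (hu.mem n)).1⟩
  have hU : Monotone U := monotone_nat_of_le_succ fun n =>
    sub_nonneg.1 (nonneg_iff_isPos.2 (hmono n))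
  refine ⟨((1 : EndStar B E) - U n).2, fun x => ?_⟩
  have hlim : Tendsto (fun m => inner B x (u m x - u n x)) atTop (𝓝 (inner B x (x - u n x))) :=
    (CStarModule.continuous_inner.tendsto (x, x - u n x)).comp
      (tendsto_const_nhds.prodMk_nhds ((hu.tendsto_apply hess x).sub_const _))
  refine CStarAlgebra.isClosed_nonneg.mem_of_tendsto hlim ?_
  filter_upwards [eventually_ge_atTop n] with m hm
  exact inner_nonneg_of_nonneg (sub_nonneg.2 (hU hm)) x

/-- The average of an approximate unit over the grading. -/
lemma exists_even_approxUnit (hsa : IsSelfAdjointOp B D) (hD : IsHomogeneous γ D)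
    (hA : IsDifferentiableAlgebra γ D 𝒜) (hess : IsEssential 𝒜)
    (H : HasGoodApproxUnit γ D 𝒜) :
    ∃ v : ℕ → E →L[ℂ] E, IsApproxUnit γ D 𝒜 v ∧ (∀ n, γ.gr (v n) = v n) ∧
      (∀ n, IsPos B (1 - v n)) ∧ Tendsto (fun n => ‖comm γ D (v n)‖) atTop (𝓝 0) := by
  obtain ⟨u, hu, hmono, -, hcomm⟩ := H
  have hl : ∀ x ∈ 𝒜, x ∈ Lip γ D := hA.mem_lip
  have hg : ∀ n, γ.gr (u n) ∈ 𝒜 := fun n => hA.gr_mem _ (hu.mem n)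
  have hpos := hu.isPos_one_sub hA hess hmono
  have hhalf : ‖(1 / 2 : ℂ)‖ = 1 / 2 := by simp
  -- Two elements are needed because, for an average `v` of `u`, the error `v a - a` is the average
  -- of `u a - a` and the image under the grading of `u γ(a) - γ(a)`. The averages need not commute
  -- with one another.
  have avg : ∀ x ∈ 𝒜, ∀ y ∈ 𝒜, lipNorm γ D ((1 / 2 : ℂ) • (x + γ.gr y))
      ≤ lipNorm γ D x + 3 * lipNorm γ D y := fun x hx y hy => by
    have hgy := hl _ (hA.gr_mem y hy)
    have h1 := lipNorm_smul_le hsa (hl _ (𝒜.add_mem hx (hA.gr_mem y hy))) (1 / 2)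
    have h2 := lipNorm_add_le hsa (hl x hx) hgy
    have h3 := lipNorm_gr_le hsa hD (hl y hy)
    rw [hhalf] at h1
    linarith [lipNorm_nonneg γ D x, lipNorm_nonneg γ D y]
  refine ⟨fun n => (1 / 2 : ℂ) • (u n + γ.gr (u n)), ⟨fun n => ?_, ?_, fun a ha => ?_,
    fun a ha => ?_⟩, fun n => ?_, fun n => ?_, ?_⟩
  · exact 𝒜.smul_mem _ (𝒜.add_mem (hu.mem n) (hg n))
  · obtain ⟨M, hM⟩ := hu.bounded
    exact ⟨M + 3 * M, fun n => (avg _ (hu.mem n) _ (hu.mem n)).trans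
      (add_le_add (hM n) (mul_le_mul_of_nonneg_left (hM n) (by norm_num)))⟩
  · have ha' := hA.gr_mem a ha
    refine squeeze_zero (fun _ => lipNorm_nonneg γ D _) (fun n => ?_)
      (by simpa using (hu.left a ha).add ((hu.left _ ha').const_mul 3))
    refine le_of_eq_of_le (congrArg _ ?_) (avg _ (𝒜.sub_mem (𝒜.mul_mem (hu.mem n) ha) ha) _
      (𝒜.sub_mem (𝒜.mul_mem (hu.mem n) ha') ha'))
    rw [γ.gr_sub, γ.gr_mul, γ.gr_gr, smul_mul_assoc, add_mul]
    module
  · have ha' := hA.gr_mem a ha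
    refine squeeze_zero (fun _ => lipNorm_nonneg γ D _) (fun n => ?_)
      (by simpa using (hu.right a ha).add ((hu.right _ ha').const_mul 3))
    refine le_of_eq_of_le (congrArg _ ?_) (avg _ (𝒜.sub_mem (𝒜.mul_mem ha (hu.mem n)) ha) _
      (𝒜.sub_mem (𝒜.mul_mem ha' (hu.mem n)) ha'))
    rw [γ.gr_sub, γ.gr_mul, γ.gr_gr, mul_smul_comm, mul_add]
    module
  · rw [γ.gr_smul, γ.gr_add, γ.gr_gr, add_comm]
  · have h1 := smul_nonneg (by norm_num : (0 : ℝ) ≤ 1 / 2) (add_nonneg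
      (nonneg_iff_isPos (T := ⟨1 - u n, (hpos n).1⟩) |>.2 (hpos n))
      (nonneg_iff_isPos (T := ⟨γ.gr (1 - u n), ((hpos n).gr γ).1⟩) |>.2 ((hpos n).gr γ)))
    have h2 := nonneg_iff_isPos.1 h1
    convert h2 using 1
    change _ = ((1 / 2 : ℝ) : ℂ) • (1 - u n + γ.gr (1 - u n))
    rw [γ.gr_sub, γ.gr_one]
    push_cast
    module
  · refine squeeze_zero (fun _ => norm_nonneg _) (fun n => ?_) hcomm
    rw [comm_smul hsa (hl _ (𝒜.add_mem (hu.mem n) (hg n))),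
      comm_add hsa (hl _ (hu.mem n)) (hl _ (hg n)), norm_smul, hhalf]
    have := norm_add_le (comm γ D (u n)) (comm γ D (γ.gr (u n)))
    rw [norm_comm_gr hsa hD (hl _ (hu.mem n))] at this
    linarith

end DiffAlg

end

/-! ### Limits of adjointable operators and inverses of the partial sums. -/

noncomputable section

namespace DiffAlg

variable {B E : Type*} [NonUnitalCStarAlgebra B] [PartialOrder B] [StarOrderedRing B]
  [NormedAddCommGroup E] [NormedSpace ℂ E] [SMul B E] [CStarModule B E] [CompleteSpace E]
variable {γ : ModuleGrading B E} {D : E →ₗ.[ℂ] E} {𝒜 : NonUnitalSubalgebra ℂ (E →L[ℂ] E)}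

lemma tendsto_inner_apply {T : ℕ → E →L[ℂ] E} {S : E →L[ℂ] E} (hT : Tendsto T atTop (𝓝 S))
    (x y : E) : Tendsto (fun n => (inner B x (T n y) : B)) atTop (𝓝 (inner B x (S y))) :=
  (CStarModule.continuous_inner.tendsto (x, S y)).comp
    (tendsto_const_nhds.prodMk_nhds
      (((ContinuousLinearMap.apply ℂ E y).continuous.tendsto S).comp hT))

lemma IsAdjointPair.of_tendsto {T T' : ℕ → E →L[ℂ] E} {S S' : E →L[ℂ] E}
    (h : ∀ n, IsAdjointPair B (T n) (T' n)) (hT : Tendsto T atTop (𝓝 S))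
    (hT' : Tendsto T' atTop (𝓝 S')) : IsAdjointPair B S S' := fun x y => by
  have h1 := (tendsto_inner_apply (B := B) hT y x).star
  refine tendsto_nhds_unique ?_ (tendsto_inner_apply hT' x y)
  simp only [CStarModule.star_inner] at h1
  exact h1.congr fun n => h n x y

lemma IsPos.sum {ι : Type*} (s : Finset ι) {f : ι → E →L[ℂ] E} (hf : ∀ i ∈ s, IsPos B (f i)) :
    IsPos B (∑ i ∈ s, f i) := by
  refine ⟨(adjointableSubalgebra B E).sum_mem fun i hi => (hf i hi).1, fun x => ?_⟩
  rw [_root_.sum_apply, CStarModule.inner_sum_right]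
  exact Finset.sum_nonneg fun i hi => (hf i hi).2 x

lemma IsPos.conj {X h : E →L[ℂ] E} (hX : IsPos B X) (hh : IsAdjointPair B h h) :
    IsPos B (h * X * h) :=
  ⟨((hh.mul hX.1.pair).mul hh).isAdjointable, fun x => by
    change 0 ≤ inner B x (h (X (h x)))
    rw [← hh]
    exact hX.2 _⟩

lemma isPos_one_add_of_norm_le_one {X : E →L[ℂ] E} (hX : IsAdjointPair B X X) (hn : ‖X‖ ≤ 1) :
    IsPos B (1 + X) := by
  let Y : EndStar B E := ⟨X, hX.isAdjointable⟩
  have hY : IsSelfAdjoint Y := isSelfAdjoint_mk _ hX.adj_eq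
  have h1 := hY.neg_algebraMap_norm_le_self
  have h2 : algebraMap ℝ (EndStar B E) ‖Y‖ ≤ 1 := by
    rw [← map_one (algebraMap ℝ (EndStar B E))]
    exact algebraMap_mono _ hn
  refine nonneg_iff_isPos.1 (show 0 ≤ 1 + Y from ?_)
  calc (0 : EndStar B E) ≤ 1 - algebraMap ℝ (EndStar B E) ‖Y‖ := sub_nonneg.2 h2
    _ ≤ 1 + Y := by rw [sub_eq_add_neg]; exact add_le_add_right h1 1

/-- The commutator of an even self-adjoint element is skew-adjoint. -/
lemma isAdjointPair_comm (hsa : IsSelfAdjointOp B D) {a : E →L[ℂ] E} (ha : a ∈ Lip γ D)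
    (hev : γ.gr a = a) (hadj : adj B a = a) : IsAdjointPair B (comm γ D a) (-comm γ D a) := by
  have h := comm_adj_gr hsa ha (by rwa [hadj, hev])
  rw [hadj, hev] at h
  have := (comm_isAdjointable ha).pair
  rwa [← neg_eq_iff_eq_neg.2 h] at this

/-- The inverse of `1 + ∑ (1 - V k)` belongs to the unitization of `𝒜`. -/
lemma exists_inverse_one_add_sum (hsa : IsSelfAdjointOp B D) (hA : IsDifferentiableAlgebra γ D 𝒜)
    {V : ℕ → E →L[ℂ] E} (hV : ∀ k, V k ∈ 𝒜) (hpos : ∀ k, IsPos B (1 - V k)) (N : ℕ) :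
    ∃ y ∈ 𝒜, (1 + ∑ k ∈ Finset.range N, (1 - V k)) * (((N : ℂ) + 1)⁻¹ • (1 + y)) = 1 ∧
      (((N : ℂ) + 1)⁻¹ • (1 + y)) * (1 + ∑ k ∈ Finset.range N, (1 - V k)) = 1 := by
  set t : ℂ := (N : ℂ) + 1 with ht
  have ht0 : t ≠ 0 := Nat.cast_add_one_ne_zero N
  set c := ∑ k ∈ Finset.range N, (1 - V k) with hc
  set S := ∑ k ∈ Finset.range N, V k with hS
  have hcpos : IsPos B c := IsPos.sum _ fun k _ => hpos k
  have hSA : S ∈ 𝒜 := 𝒜.toSubmodule.sum_mem fun k _ => hV k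
  -- `1 + c = (N + 1) - ∑ V k` becomes `1` plus an element of `𝒜` after division by `t = N + 1`, so
  -- spectral invariance applies.
  have hcS : 1 + (-t⁻¹) • S = t⁻¹ • (1 + c) := by
    have : c = (N : ℂ) • (1 : E →L[ℂ] E) - S := by
      rw [hc, Finset.sum_sub_distrib, Finset.sum_const, Finset.card_range, Nat.cast_smul_eq_nsmul]
    rw [this, smul_add, smul_sub, smul_smul]
    have e : t⁻¹ + t⁻¹ * N = 1 := by rw [← mul_one_add, add_comm, ← ht, inv_mul_cancel₀ ht0]
    calc _ = (t⁻¹ + t⁻¹ * N) • (1 : E →L[ℂ] E) + (-t⁻¹) • S := by rw [e, one_smul]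
      _ = _ := by module
  have hu : IsUnit (1 + c) := by
    have h0 : 0 ≤ (⟨c, hcpos.1⟩ : EndStar B E) := nonneg_iff_isPos.2 hcpos
    exact isUnit_coe (CStarAlgebra.isUnit_of_le 1 (le_add_of_nonneg_right h0))
  have hadj : adj B S = S := by
    have hSl := (hA.mem_lip S hSA).1
    have hS' : S = -t • (t⁻¹ • (1 + c) + -1) := by
      rw [← hcS, add_comm 1, add_assoc, add_neg_cancel, add_zero, smul_smul, neg_mul_neg,
        mul_inv_cancel₀ ht0, one_smul]
    have h1 := ((((IsAdjointPair.one B).add hcpos.pair).smul t⁻¹).add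
      (IsAdjointPair.one B).neg).smul (-t)
    rw [← hS'] at h1
    rw [h1.adj_eq]
    have hst : star t = t := by simp [ht]
    rw [star_neg, star_inv₀, hst, ← hS']
  obtain ⟨y, hy, h1, h2⟩ := exists_inverse_of_isUnit hsa hA hSA hadj (z := -t⁻¹) (by
    rw [hcS]
    exact hu.smul (Units.mk0 t⁻¹ (inv_ne_zero ht0)))
  rw [hcS] at h1 h2
  exact ⟨y, hy, by rwa [mul_smul_comm, ← smul_mul_assoc], by rwa [smul_mul_assoc, ← mul_smul_comm]⟩

end DiffAlg

end

/-! ### Construction of the strictly positive element. -/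

noncomputable section

namespace DiffAlg

variable {B E : Type*} [NonUnitalCStarAlgebra B] [PartialOrder B] [StarOrderedRing B]
  [NormedAddCommGroup E] [NormedSpace ℂ E] [SMul B E] [CStarModule B E] [CompleteSpace E]
variable {γ : ModuleGrading B E} {D : E →ₗ.[ℂ] E} {𝒜 : NonUnitalSubalgebra ℂ (E →L[ℂ] E)}

/-- If `h` is a limit of inverses of `1 + ∑_{k < N} (1 - V k)` in `Lip(D)` and `(1 - V k) V j` is
small for `j < k`, then `h 𝒜` is dense. -/
lemma lipDense_mul_of_tendsto (hsa : IsSelfAdjointOp B D) (hA : IsDifferentiableAlgebra γ D 𝒜)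
    {V : ℕ → E →L[ℂ] E} (hV : ∀ k, V k ∈ 𝒜)
    (hV1 : ∀ j k, j < k → lipNorm γ D (V k * V j - V j) ≤ (1 / 2) ^ k)
    (hVa : ∀ a ∈ 𝒜, Tendsto (fun k => lipNorm γ D (V k * a - a)) atTop (𝓝 0))
    {g : ℕ → E →L[ℂ] E} (hg : ∀ N, g N ∈ Lip γ D)
    (hginv : ∀ N, g N * (1 + ∑ k ∈ Finset.range N, (1 - V k)) = 1) {h : E →L[ℂ] E} (hh : h ∈ 𝒜)
    (hlim : Tendsto (fun N => lipNorm γ D (h - g N)) atTop (𝓝 0)) :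
    LipDense γ D 𝒜 {b | ∃ a ∈ 𝒜, b = h * a} := by
  have hl : ∀ x ∈ 𝒜, x ∈ Lip γ D := hA.mem_lip
  set c : ℕ → E →L[ℂ] E := fun N => 1 + ∑ k ∈ Finset.range N, (1 - V k) with hc
  have hcA : ∀ N, ∀ x ∈ 𝒜, c N * x ∈ 𝒜 := fun N x hx => by
    simp only [hc, add_mul, Finset.sum_mul, one_mul, sub_mul]
    exact 𝒜.add_mem hx (𝒜.toSubmodule.sum_mem fun k _ =>
      𝒜.sub_mem hx (𝒜.mul_mem (hV k) hx))
  -- For fixed `j`, each later summand adds only `(1 - V k) V j`, of Lipschitz norm at most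
  -- `(1/2)^k`, so `c N * V j` stays bounded as `N` grows.
  have hbound : ∀ j, ∃ Q, 0 ≤ Q ∧ ∀ i, lipNorm γ D (c (j + 1 + i) * V j) ≤ Q := fun j => by
    refine ⟨lipNorm γ D (c (j + 1) * V j) + 2, by linarith [lipNorm_nonneg γ D (c (j + 1) * V j)],
      fun i => ?_⟩
    suffices lipNorm γ D (c (j + 1 + i) * V j)
        ≤ lipNorm γ D (c (j + 1) * V j) + ∑ k ∈ Finset.range i, (1 / 2 : ℝ) ^ k from
      this.trans (by gcongr; exact sum_geometric_two_le i)
    induction i with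
    | zero => simp
    | succ i ih =>
      have e : c (j + 1 + (i + 1)) * V j
          = c (j + 1 + i) * V j - (V (j + 1 + i) * V j - V j) := by
        simp only [hc, ← add_assoc, Finset.sum_range_succ _ (j + 1 + i), add_mul, sub_mul, one_mul]
        abel
      have h1 := lipNorm_sub_le hsa (hl _ (hcA (j + 1 + i) _ (hV j)))
        (hl _ (𝒜.sub_mem (𝒜.mul_mem (hV (j + 1 + i)) (hV j)) (hV j)))
      have h2 := hV1 j (j + 1 + i) (by omega)
      have h3 : (1 / 2 : ℝ) ^ (j + 1 + i) ≤ (1 / 2) ^ i :=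
        pow_le_pow_of_le_one (by norm_num) (by norm_num) (by omega)
      rw [e, Finset.sum_range_succ]
      linarith
  refine ⟨fun b ⟨a, ha, hb⟩ => hb ▸ 𝒜.mul_mem hh ha, fun a ha ε hε => ?_⟩
  obtain ⟨j, hj⟩ := ((hVa a ha).eventually (gt_mem_nhds (half_pos hε))).exists
  obtain ⟨Q, hQ0, hQ⟩ := hbound j
  have hlim' := (((tendsto_add_atTop_iff_nat (j + 1)).2 hlim).mul_const
    (Q * lipNorm γ D a))
  rw [zero_mul] at hlim'
  obtain ⟨i, hi⟩ := (hlim'.eventually (gt_mem_nhds (half_pos hε))).exists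
  rw [add_comm i] at hi
  set N := j + 1 + i
  have hva := 𝒜.mul_mem (hV j) ha
  have hd : h - g N ∈ Lip γ D := (lipSubalgebra γ D).sub_mem (hl _ hh) (hg N)
  refine ⟨h * (c N * (V j * a)), ⟨_, hcA N _ hva, rfl⟩, ?_⟩
  -- Since `g N` inverts `c N`, the element `h * (c N * (V j * a))` differs from `V j * a` by `(h -
  -- g N)` times something bounded in `N`.
  have e : a - h * (c N * (V j * a)) = -(1 : ℂ) • ((V j * a - a) + (h - g N) * (c N * V j * a)) := by
    have : g N * (c N * V j * a) = V j * a := by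
      rw [← mul_assoc, ← mul_assoc, hginv, one_mul]
    rw [sub_mul, this, mul_assoc (c N)]
    module
  have hm := hl _ (𝒜.mul_mem (hcA N _ (hV j)) ha)
  have hm' := (lipSubalgebra γ D).mul_mem hd hm
  have h0 := hl _ (𝒜.sub_mem hva ha)
  rw [e]
  have i1 := lipNorm_smul_le hsa ((lipSubalgebra γ D).add_mem h0 hm') (-1)
  rw [norm_neg, norm_one, one_mul] at i1
  have i2 := lipNorm_add_le hsa h0 hm'
  have i3 := lipNorm_mul_le hsa hd hm
  have i4 := lipNorm_mul_le hsa (hl _ (hcA N _ (hV j))) (hl a ha)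
  have i5 : lipNorm γ D (h - g N) * lipNorm γ D (c N * V j * a)
      ≤ lipNorm γ D (h - g N) * (Q * lipNorm γ D a) :=
    mul_le_mul_of_nonneg_left (i4.trans
      (mul_le_mul_of_nonneg_right (hQ i) (lipNorm_nonneg γ D a))) (lipNorm_nonneg γ D _)
  linarith

theorem hasGoodPositiveElementTwoSided_of_hasGoodApproxUnit (hsa : IsSelfAdjointOp B D)
    (hreg : IsRegularOp B D) (hD : IsHomogeneous γ D) (hA : IsDifferentiableAlgebra γ D 𝒜)
    (hess : IsEssential 𝒜) (H : HasGoodApproxUnit γ D 𝒜) :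
    HasGoodPositiveElementTwoSided γ D 𝒜 := by
  obtain ⟨v, hv, hvev, hvpos, hvcomm⟩ := exists_even_approxUnit hsa hD hA hess H
  have hl : ∀ x ∈ 𝒜, x ∈ Lip γ D := hA.mem_lip
  -- The factor `4` makes the commutators sum to at most `1/2`. That bounds `‖K h‖` below `1` and
  -- lets the constant in the form bound be `1`.
  obtain ⟨f, hf, hf1, hf2⟩ := exists_fast_subsequence
    (F := fun n => 4 * ‖comm γ D (v n)‖)
    (G := fun m n => lipNorm γ D (v n * v m - v m) + lipNorm γ D (v m * v n - v m))
    (by simpa using hvcomm.const_mul 4)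
    (fun m => by simpa using (hv.left _ (hv.mem m)).add (hv.right _ (hv.mem m)))
  set V : ℕ → E →L[ℂ] E := fun k => v (f k) with hVdef
  have hV : ∀ k, V k ∈ 𝒜 := fun k => hv.mem _
  have hVev : ∀ k, γ.gr (V k) = V k := fun k => hvev _
  have hVpos : ∀ k, IsPos B (1 - V k) := fun k => hvpos _
  have hVadj : ∀ k, adj B (V k) = V k := fun k => by
    have := (IsAdjointPair.one B).add (hVpos k).pair.neg
    rw [← sub_eq_add_neg, sub_sub_cancel] at this
    exact this.adj_eq
  have hVc : ∀ k, ‖comm γ D (V k)‖ ≤ 1 / 4 * (1 / 2) ^ k := fun k => by linarith [hf1 k]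
  have hV1 : ∀ j k, j < k → lipNorm γ D (V k * V j - V j) ≤ (1 / 2) ^ k := fun j k hjk =>
    (le_add_of_nonneg_right (lipNorm_nonneg γ D _)).trans (hf2 j k hjk)
  have hV2 : ∀ j k, j < k → lipNorm γ D (V j * V k - V j) ≤ (1 / 2) ^ k := fun j k hjk =>
    (le_add_of_nonneg_left (lipNorm_nonneg γ D _)).trans (hf2 j k hjk)
  -- the resolvents of the partial sums of `∑ (1 - V k)`
  choose y hyA hy1 hy2 using exists_inverse_one_add_sum hsa hA hV hVpos
  set c : ℕ → E →L[ℂ] E := fun N => ∑ k ∈ Finset.range N, (1 - V k) with hc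
  set g : ℕ → E →L[ℂ] E := fun N => ((N : ℂ) + 1)⁻¹ • (1 + y N) with hg
  have hg1 : ∀ N, (1 + c N) * g N = 1 := hy1
  have hg2 : ∀ N, g N * (1 + c N) = 1 := hy2
  have hgl : ∀ N, g N ∈ Lip γ D := fun N =>
    (lipSubalgebra γ D).smul_mem (hA.one_add_mem_lip (hyA N)) _
  have hwl : ∀ k, 1 - V k ∈ Lip γ D := fun k =>
    (lipSubalgebra γ D).sub_mem one_mem_lip (hl _ (hV k))
  have hcl : ∀ N, c N ∈ Lip γ D := fun N => (lipSubalgebra γ D).sum_mem fun k _ => hwl k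
  have hgpos : ∀ N, IsPos B (g N) ∧ ‖g N‖ ≤ 1 := fun N =>
    isPos_and_norm_le_one_of_inverse (IsPos.sum _ fun k _ => hVpos k) (hgl N).1 (hg1 N)
  have hcev : ∀ N, γ.gr (1 + c N) = 1 + c N := fun N => by
    have : γ.gr (c N) = c N := by
      change γ.grHom (∑ k ∈ Finset.range N, (1 - V k)) = _
      rw [map_sum]
      refine Finset.sum_congr rfl fun k _ => ?_
      change γ.gr (1 - V k) = _
      rw [γ.gr_sub, γ.gr_one, hVev]
    rw [γ.gr_add, γ.gr_one, this]
  have hgev : ∀ N, γ.gr (g N) = g N := fun N => by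
    have h1 := congrArg γ.gr (hg2 N)
    rw [γ.gr_mul, hcev, γ.gr_one] at h1
    exact left_inv_eq_right_inv h1 (hg1 N)
  obtain ⟨M, hM⟩ := hv.bounded
  obtain ⟨h, hglim⟩ := exists_tendsto_inverse (w := fun k => 1 - V k) (h := g)
    (L := ‖(1 : E →L[ℂ] E)‖ + M)
    (fun k => (norm_sub_le _ _).trans (by gcongr; exact (norm_le_lipNorm γ D _).trans (hM _)))
    (fun N => (hgpos N).2) hg2 hg1
    (fun j k hjk => by
      rw [show (1 - V k) * (1 - (1 - V j)) = -(V k * V j - V j) by noncomm_ring, norm_neg]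
      exact (norm_le_lipNorm γ D _).trans (hV1 j k hjk))
    (fun j k hjk => by
      rw [show (1 - (1 - V j)) * (1 - V k) = -(V j * V k - V j) by noncomm_ring, norm_neg]
      exact (norm_le_lipNorm γ D _).trans (hV2 j k hjk))
  -- the commutators
  have hKN : ∀ N, comm γ D (1 + c N) = -∑ k ∈ Finset.range N, comm γ D (V k) := fun N => by
    rw [comm_add hsa one_mem_lip (hcl N), comm_one hsa, zero_add, hc]
    simp only
    rw [comm_sum hsa _ hwl, ← Finset.sum_neg_distrib]
    refine Finset.sum_congr rfl fun k _ => ?_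
    rw [comm_sub hsa one_mem_lip (hl _ (hV k)), comm_one hsa, zero_sub]
  have hsum := (summable_geometric_two.mul_left (1 / 4 : ℝ)).of_norm_bounded
    (f := fun k => comm γ D (V k)) hVc
  set K : E →L[ℂ] E := -∑' k, comm γ D (V k) with hK
  have hKlim : Tendsto (fun N => comm γ D (1 + c N)) atTop (𝓝 K) := by
    simp only [hKN]
    exact hsum.hasSum.tendsto_sum_nat.neg
  have hKnorm : ‖K‖ ≤ 1 / 2 := by
    rw [hK, norm_neg]
    have := tsum_of_norm_bounded (hasSum_geometric_two.mul_left (1 / 4 : ℝ)) hVc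
    linarith
  have hKadj : IsAdjointPair B K (-K) := by
    refine IsAdjointPair.of_tendsto (fun N => ?_) hKlim hKlim.neg
    refine isAdjointPair_comm hsa ((lipSubalgebra γ D).add_mem one_mem_lip (hcl N)) (hcev N) ?_
    exact ((IsAdjointPair.one B).add (IsPos.sum _ fun k _ => hVpos k).pair).adj_eq
  -- Taking the commutator of `g N * (1 + c N) = 1`, with `g N` even, gives the derivative of an
  -- inverse.
  have hcg : ∀ N, comm γ D (g N) = -(g N * comm γ D (1 + c N) * g N) := fun N => by
    have h1 := congrArg (comm γ D) (hg2 N)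
    rw [comm_mul hsa (hgl N) ((lipSubalgebra γ D).add_mem one_mem_lip (hcl N)), comm_one hsa,
      hgev, ← eq_neg_iff_add_eq_zero] at h1
    rw [← neg_mul, ← h1, mul_assoc, hg1, mul_one]
  have hcglim : Tendsto (fun N => comm γ D (g N)) atTop (𝓝 (-(h * K * h))) := by
    simp only [hcg]
    exact ((hglim.mul hKlim).mul hglim).neg
  have hinv0 : Tendsto (fun N : ℕ => ((N : ℂ) + 1)⁻¹ • (1 : E →L[ℂ] E)) atTop (𝓝 0) := by
    have : Tendsto (fun N : ℕ => ((N : ℂ) + 1)⁻¹) atTop (𝓝 0) := by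
      simpa using tendsto_one_div_add_atTop_nhds_zero_nat (𝕜 := ℂ)
    simpa using this.smul_const (1 : E →L[ℂ] E)
  -- The scalar part `1 / (N + 1)` of `g N` tends to zero, so the limit `h` lies in `𝒜` and not
  -- merely in its unitization.
  have hgy : ∀ N : ℕ, ((N : ℂ) + 1)⁻¹ • y N = g N - ((N : ℂ) + 1)⁻¹ • (1 : E →L[ℂ] E) := fun N => by
    rw [hg]; simp only; rw [smul_add]; abel
  obtain ⟨hhA, hcomm⟩ := hA.mem_of_tendsto (a := fun N : ℕ => ((N : ℂ) + 1)⁻¹ • y N)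
    (x := h) (K := -(h * K * h)) (fun N => 𝒜.smul_mem _ (hyA N))
    (by simp only [hgy]; simpa using hglim.sub hinv0)
    (hcglim.congr fun N => by
      rw [hgy, comm_sub hsa (hgl N) ((lipSubalgebra γ D).smul_mem one_mem_lip _),
        comm_smul hsa one_mem_lip, comm_one hsa, smul_zero, sub_zero])
  have hhev : γ.gr h = h :=
    tendsto_nhds_unique (((γ.continuous_gr.tendsto h).comp hglim).congr hgev) hglim
  have hhpos : IsPos B h := ⟨(hl h hhA).1, fun x =>
    CStarAlgebra.isClosed_nonneg.mem_of_tendsto (tendsto_inner_apply hglim x x)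
      (.of_forall fun N => (hgpos N).1.2 x)⟩
  have hhnorm : ‖h‖ ≤ 1 := le_of_tendsto hglim.norm (.of_forall fun N => (hgpos N).2)
  have hlip : Tendsto (fun N => lipNorm γ D (h - g N)) atTop (𝓝 0) := by
    refine tendsto_lipNorm_zero ?_ ?_
    · simpa using (hglim.const_sub h).norm
    · have := (hcglim.const_sub (comm γ D h)).norm
      rw [hcomm, sub_self, norm_zero] at this
      refine this.congr fun N => ?_
      rw [comm_sub hsa (hl h hhA) (hgl N), hcomm]
  -- `h² - z [D, h] = h (1 + z K) h`, where `z K` is self-adjoint of norm at most `1/2` because `K`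
  -- is skew-adjoint and `z = ± i`.
  have hbd : ∀ z : ℂ, z = Complex.I ∨ z = -Complex.I →
      IsPos B (((1 : ℝ) : ℂ) • (h * h) - z • comm γ D h) := fun z hz => by
    have h1 : IsAdjointPair B (z • K) (z • K) := by
      have := hKadj.smul z
      rcases hz with rfl | rfl <;> simpa using this
    have h2 : ‖z • K‖ ≤ 1 := by
      have : ‖z‖ = 1 := by rcases hz with rfl | rfl <;> simp
      rw [norm_smul, this]; linarith
    have h3 := (isPos_one_add_of_norm_le_one h1 h2).conj hhpos.pair
    convert h3 using 1
    rw [hcomm, mul_add, add_mul, mul_one, mul_smul_comm, smul_mul_assoc]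
    simp
  refine ⟨⟨h, hhA⟩, ⟨hhpos.adj_eq, quasispectrum_of_isPos hsa hA ⟨h, hhA⟩ hhpos, ?_⟩, hhev,
    fun s hs => ?_, 1, one_pos, hbd _ (.inl rfl), ?_⟩
  · exact lipDense_mul_of_tendsto hsa hA hV hV1
      (fun a ha => (hv.left a ha).comp hf.tendsto_atTop) hgl hg2 hhA hlip
  · refine imResolventMul_eq_imMulResolvent hsa hreg (hl h hhA) hhev hcomm ?_ hs
    calc ‖K * h‖ ≤ ‖K‖ * ‖h‖ := norm_mul_le _ _
      _ ≤ 1 / 2 * 1 := by gcongr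
      _ < 1 := by norm_num
  · simpa using hbd _ (.inr rfl)

end DiffAlg

end

/-! ### The two equivalences. -/

theorem theorem1p18 {B E : Type*} [NonUnitalCStarAlgebra B] [PartialOrder B] [StarOrderedRing B]
    [NormedAddCommGroup E] [NormedSpace ℂ E] [SMul B E] [CStarModule B E] [CompleteSpace E]
    (γ : DiffAlg.ModuleGrading B E) (D : E →ₗ.[ℂ] E)
    (hsa : DiffAlg.IsSelfAdjointOp B D) (hreg : DiffAlg.IsRegularOp B D)
    (𝒜 : NonUnitalSubalgebra ℂ (E →L[ℂ] E))
    (hA : DiffAlg.IsDifferentiableAlgebra γ D 𝒜) (hess : DiffAlg.IsEssential 𝒜) :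
    (γ.IsOdd D →
      [DiffAlg.HasGoodApproxUnit γ D 𝒜,
        DiffAlg.HasCompleteMultiplier γ D 𝒜,
        DiffAlg.HasGoodPositiveElement γ D 𝒜].TFAE) ∧
    (γ.IsTrivial →
      [DiffAlg.HasGoodApproxUnit γ D 𝒜,
        DiffAlg.HasCompleteMultiplier γ D 𝒜,
        DiffAlg.HasGoodPositiveElementTwoSided γ D 𝒜].TFAE) := by
  refine ⟨fun hodd => ?_, fun htriv => ?_⟩
  · tfae_have 1 → 3 := fun H => by
      obtain ⟨h, h1, h2, h3, C, hC, h4, -⟩ :=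
        DiffAlg.hasGoodPositiveElementTwoSided_of_hasGoodApproxUnit hsa hreg (.inl hodd) hA hess H
      exact ⟨h, h1, h2, h3, C, hC, h4⟩
    tfae_have 3 → 2 := fun H =>
      DiffAlg.hasCompleteMultiplier_of_hasGoodPositiveElementTwoSided hsa hA hess
        (H.twoSided hsa hA hodd)
    tfae_have 2 → 1 :=
      DiffAlg.hasGoodApproxUnit_of_hasCompleteMultiplier hsa (.inl hodd) hA hess
    tfae_finish
  · tfae_have 1 → 3 :=
      DiffAlg.hasGoodPositiveElementTwoSided_of_hasGoodApproxUnit hsa hreg (.inr htriv) hA hess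
    tfae_have 3 → 2 :=
      DiffAlg.hasCompleteMultiplier_of_hasGoodPositiveElementTwoSided hsa hA hess
    tfae_have 2 → 1 :=
      DiffAlg.hasGoodApproxUnit_of_hasCompleteMultiplier hsa (.inr htriv) hA hess
    tfae_finish
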